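/- Let $\Gamma$ be the infinite chain graph whose rings, numbered by $j\in\mathbb Z$, have circumference $2\pi$. Ring $j$ consists of an upper and a lower half-circle, each identified with $[0,\pi]$ and running from the vertex $x_j$ to the vertex $x_{j+1}$, where it touches ring $j+1$. Given real sequences $(\alpha_j)$, $(A_j)$, the magnetic Hamiltonian in $L^2(\Gamma)$ acts as $-\mathscr D_j^2$, where $\mathscr D_j=\frac{d}{dx}+iA_j$ on the upper and $\mathscr D_j=\frac{d}{dx}-iA_j$ on the lower half-circle of ring $j$. Its domain consists of all functions in $L^2(\Gamma)$ with components $\psi_j$ (upper) and $\varphi_j$ (lower) in $H^2(0,\pi)$ that are mapped into $L^2(\Gamma)$ and satisfy the $\delta$-coupling at every vertex, \[ \psi_j(x_j)=\varphi_j(x_j)=\psi_{j-1}(x_j)=\varphi_{j-1}(x_j),\qquad \mathscr D_j\psi_j(x_j)+\mathscr D_j\varphi_j(x_j)-\mathscr D_{j-1}\psi_{j-1}(x_j)-\mathscr D_{j-1}\varphi_{j-1}(x_j)=\alpha_j\psi_j(x_j). \] Let $\alpha,A,\alpha_1,A_1\in\mathbb R$ with $A\notin\mathbb Z$, and let $-\Delta_{\alpha_1,A_1}$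 be this Hamiltonian with $\alpha_j=\alpha$ and $A_j=A$ for all $j\neq1$, while the first ring has the potential $A_1$ and its left vertex $x_1$ has the coupling constant $\alpha_1$. The gaps of the essential spectrum of $-\Delta_{\alpha_1,A_1}$ are the connected components of its complement in $\mathbb R$. They are numbered upwards, the first gap being the one below the essential spectrum, and a gap is called odd or even according to its number. **Theorem.** 1. Suppose that $|\cos A_1\pi|>|\cos A\pi|$. (a) If $\alpha_1>\alpha$, then $-\Delta_{\alpha_1,A_1}$ has precisely one eigenvalue, and this eigenvalue is simple, in every gap of its essential spectrum, except possibly in a finite number of odd gaps. (b) If $\alpha_1<\alpha$, then $-\Delta_{\alpha_1,A_1}$ has precisely one eigenvalue, and this eigenvalue is simple, in every gap of its essential spectrum, except possibly in a finite number of even gaps. (c) There is $\delta>0$, depending only on $\alpha,A,A_1$, such that for $0<|\alpha_1-\alpha|<\delta$ there is precisely one eigenvalue, and it is simple, in every gap. 2. Suppose that $|\cos A_1\pi|<|\cos A\pi|$. (a) If $\alpha_1>\alpha$, then there is a (possibly empty) finite set of even gaps such that $-\Delta_{\alpha_1,A_1}$ has precisely one eigenvalue, and this eigenvalue is simple, in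 each gap of this set, and has no eigenvalue in any other gap. (b) If $\alpha_1<\alpha$, then the same holds with a (possibly empty) finite set of odd gaps. (c) There is $\delta>0$, depending only on $\alpha,A,A_1$, such that for $0<|\alpha_1-\alpha|<\delta$ the operator $-\Delta_{\alpha_1,A_1}$ has no eigenvalue in the gaps of its essential spectrum; moreover, each of its eigenvalues belongs to the essential spectrum and is of the form $n^2$ with $n\in\mathbb N$, $n\ge1$. -/

import Mathlib

open MeasureTheory Filter Topology

noncomputable section

namespace MagneticChain

/-! ### The Hilbert space of the chain graph -/

/-- Lebesgue measure on a half-circle, parametrized by `[0, π]`. -/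
abbrev edgeMeasure : Measure ℝ := volume.restrict (Set.Icc (0 : ℝ) Real.pi)

/-- The edges of the chain: `(j, true)` is the upper and `(j, false)` the lower half-circle of the
ring number `j`. Both run from the vertex `j` (local coordinate `0`) to the vertex `j + 1` (local
coordinate `π`). -/
abbrev Edge : Type := ℤ × Bool

/-- `L²(Γ)`, the Hilbert direct sum of the spaces `L²(0, π)` over all edges. -/
abbrev L2Chain : Type := lp (fun _ : Edge => Lp ℂ 2 edgeMeasure) 2

/-! ### The Hamiltonian -/

/-- `f` belongs to the Sobolev space `H²(0, π)`, is its own `C¹([0, π])` representative, and has first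
derivative `f'` and weak second derivative `f''`: the function `f''` is square integrable, `f'` is a
primitive of `f''` (so that `f'` is absolutely continuous), and `f` is a primitive of `f'`. -/
structure IsH2 (f f' f'' : ℝ → ℂ) : Prop where
  memLp : MemLp f'' 2 edgeMeasure
  eq_integral : ∀ x ∈ Set.Icc (0 : ℝ) Real.pi, f x = f 0 + ∫ t in (0 : ℝ)..x, f' t
  deriv_eq_integral : ∀ x ∈ Set.Icc (0 : ℝ) Real.pi, f' x = f' 0 + ∫ t in (0 : ℝ)..x, f'' t

/-- The tangential magnetic potential on an edge enters the quasiderivative `𝒟 = d/dx + i a` through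
`a = A j` on the upper half-circle and `a = - A j` on the lower half-circle of the ring `j`. -/
def potential (A : ℤ → ℝ) (e : Edge) : ℂ := if e.2 then (A e.1 : ℂ) else -(A e.1 : ℂ)

/-- The quasiderivative `𝒟 f = f' + i a f` on the edge `e`. -/
def quasiDeriv (A : ℤ → ℝ) (e : Edge) (f f' : ℝ → ℂ) (x : ℝ) : ℂ :=
  f' x + Complex.I * potential A e * f x

/-- The action `-𝒟² f = (i d/dx - a)² f = -f'' - 2 i a f' + a² f` on the edge `e`. -/
def edgeAction (A : ℤ → ℝ) (e : Edge) (f f' f'' : ℝ → ℂ) (x : ℝ) : ℂ :=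
  -f'' x - 2 * Complex.I * potential A e * f' x + potential A e ^ 2 * f x

/-- The `δ`-coupling of strength `α` at the vertex `j`, where the ring `j - 1` (on the left) touches
the ring `j` (on the right). -/
structure DeltaCoupling (A : ℤ → ℝ) (α : ℝ) (j : ℤ) (f f' : Edge → ℝ → ℂ) : Prop where
  lower_right : f (j, false) 0 = f (j, true) 0
  upper_left : f (j - 1, true) Real.pi = f (j, true) 0
  lower_left : f (j - 1, false) Real.pi = f (j, true) 0
  jump :
    quasiDeriv A (j, true) (f (j, true)) (f' (j, true)) 0
      + quasiDeriv A (j, false) (f (j, false)) (f' (j, false)) 0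
      - quasiDeriv A (j - 1, true) (f (j - 1, true)) (f' (j - 1, true)) Real.pi
      - quasiDeriv A (j - 1, false) (f (j - 1, false)) (f' (j - 1, false)) Real.pi
    = (α : ℂ) * f (j, true) 0

/-- `u` lies in the domain of the Hamiltonian with coupling constants `α j` at the vertices and
magnetic potentials `A j` on the rings, and the Hamiltonian maps `u` to `v`. -/
def ActsTo (α A : ℤ → ℝ) (u v : L2Chain) : Prop :=
  ∃ f f' f'' : Edge → ℝ → ℂ,
    (∀ e, IsH2 (f e) (f' e) (f'' e)) ∧
    (∀ e, (u e : ℝ → ℂ) =ᵐ[edgeMeasure] f e) ∧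
    (∀ e, (v e : ℝ → ℂ) =ᵐ[edgeMeasure] edgeAction A e (f e) (f' e) (f'' e)) ∧
    ∀ j, DeltaCoupling A (α j) j f f'

theorem IsH2.intervalIntegrable {f f' f'' : ℝ → ℂ} (h : IsH2 f f' f'') {x : ℝ}
    (hx : x ∈ Set.Icc (0 : ℝ) Real.pi) : IntervalIntegrable f'' volume 0 x := by
  have h1 : IntegrableOn f'' (Set.Icc 0 Real.pi) volume := h.memLp.integrable (by norm_num)
  rw [intervalIntegrable_iff_integrableOn_Icc_of_le hx.1]
  exact h1.mono_set (Set.Icc_subset_Icc_right hx.2)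

theorem IsH2.continuousOn_deriv {f f' f'' : ℝ → ℂ} (h : IsH2 f f' f'') :
    ContinuousOn f' (Set.Icc 0 Real.pi) := by
  have h1 : IntegrableOn f'' (Set.Icc 0 Real.pi) volume := h.memLp.integrable (by norm_num)
  have h2 : ContinuousOn (fun x => f' 0 + ∫ t in (0 : ℝ)..x, f'' t) (Set.Icc 0 Real.pi) := by
    refine continuousOn_const.add ?_
    have := intervalIntegral.continuousOn_primitive_interval (μ := volume) (f := f'') (a := 0)
      (b := Real.pi) (by rwa [Set.uIcc_of_le Real.pi_pos.le])
    rwa [Set.uIcc_of_le Real.pi_pos.le] at this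
  exact h2.congr h.deriv_eq_integral

theorem IsH2.intervalIntegrable_deriv {f f' f'' : ℝ → ℂ} (h : IsH2 f f' f'') {x : ℝ}
    (hx : x ∈ Set.Icc (0 : ℝ) Real.pi) : IntervalIntegrable f' volume 0 x := by
  refine ContinuousOn.intervalIntegrable_of_Icc hx.1 ?_
  exact h.continuousOn_deriv.mono (Set.Icc_subset_Icc_right hx.2)

theorem IsH2.continuousOn {f f' f'' : ℝ → ℂ} (h : IsH2 f f' f'') :
    ContinuousOn f (Set.Icc 0 Real.pi) := by
  have h1 : IntegrableOn f' (Set.Icc 0 Real.pi) volume :=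
    h.continuousOn_deriv.integrableOn_Icc
  have h2 : ContinuousOn (fun x => f 0 + ∫ t in (0 : ℝ)..x, f' t) (Set.Icc 0 Real.pi) := by
    refine continuousOn_const.add ?_
    have := intervalIntegral.continuousOn_primitive_interval (μ := volume) (f := f') (a := 0)
      (b := Real.pi) (by rwa [Set.uIcc_of_le Real.pi_pos.le])
    rwa [Set.uIcc_of_le Real.pi_pos.le] at this
  exact h2.congr h.eq_integral

theorem IsH2.zero : IsH2 0 0 0 := ⟨MemLp.zero, by simp, by simp⟩

theorem IsH2.add {f f' f'' g g' g'' : ℝ → ℂ} (hf : IsH2 f f' f'') (hg : IsH2 g g' g'') :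
    IsH2 (f + g) (f' + g') (f'' + g'') := by
  refine ⟨hf.memLp.add hg.memLp, fun x hx => ?_, fun x hx => ?_⟩
  · simp only [Pi.add_apply]
    rw [intervalIntegral.integral_add (hf.intervalIntegrable_deriv hx)
      (hg.intervalIntegrable_deriv hx), hf.eq_integral x hx, hg.eq_integral x hx]
    ring
  · simp only [Pi.add_apply]
    rw [intervalIntegral.integral_add (hf.intervalIntegrable hx)
      (hg.intervalIntegrable hx), hf.deriv_eq_integral x hx, hg.deriv_eq_integral x hx]
    ring

theorem IsH2.smul {f f' f'' : ℝ → ℂ} (c : ℂ) (hf : IsH2 f f' f'') :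
    IsH2 (c • f) (c • f') (c • f'') := by
  refine ⟨hf.memLp.const_smul c, fun x hx => ?_, fun x hx => ?_⟩
  · simp only [Pi.smul_apply]
    rw [intervalIntegral.integral_smul, hf.eq_integral x hx, smul_add]
  · simp only [Pi.smul_apply]
    rw [intervalIntegral.integral_smul, hf.deriv_eq_integral x hx, smul_add]

theorem eqOn_zero_of_ae {g : ℝ → ℂ} (hg : ContinuousOn g (Set.Icc 0 Real.pi))
    (h : g =ᵐ[edgeMeasure] 0) : Set.EqOn g 0 (Set.Icc 0 Real.pi) :=
  Measure.eqOn_Icc_of_ae_eq volume Real.pi_pos.ne h hg continuousOn_const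

/-- A locally integrable function all of whose primitives vanish is almost everywhere zero. -/
theorem ae_zero_of_primitive {g : ℝ → ℂ} (hg : IntegrableOn g (Set.Icc 0 Real.pi))
    (h : ∀ x ∈ Set.Icc (0 : ℝ) Real.pi, ∫ t in (0 : ℝ)..x, g t = 0) : g =ᵐ[edgeMeasure] 0 := by
  have hi : IntervalIntegrable g volume 0 Real.pi := by
    rwa [intervalIntegrable_iff_integrableOn_Icc_of_le Real.pi_pos.le]
  have hne : ∀ a : ℝ, ∀ᵐ x : ℝ, x ≠ a := fun a => by simp [ae_iff]
  refine (ae_restrict_iff' measurableSet_Icc).2 ?_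
  filter_upwards [hi.ae_hasDerivAt_integral, hne 0, hne Real.pi] with x hx hx0 hxpi hmem
  have hd := hx (by rwa [Set.uIcc_of_le Real.pi_pos.le]) 0
    (by rw [Set.uIcc_of_le Real.pi_pos.le]; exact ⟨le_rfl, Real.pi_pos.le⟩)
  have hnhds : Set.Icc (0 : ℝ) Real.pi ∈ 𝓝 x :=
    Icc_mem_nhds (lt_of_le_of_ne hmem.1 (Ne.symm hx0)) (lt_of_le_of_ne hmem.2 hxpi)
  have hc : (fun y => ∫ t in (0 : ℝ)..y, g t) =ᶠ[𝓝 x] fun _ => (0 : ℂ) := by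
    filter_upwards [hnhds] with y hy using h y hy
  exact hd.unique ((hasDerivAt_const x (0 : ℂ)).congr_of_eventuallyEq hc)

theorem IsH2.ae_zero {f f' f'' : ℝ → ℂ} (h : IsH2 f f' f'') (h0 : f =ᵐ[edgeMeasure] 0) :
    f' =ᵐ[edgeMeasure] 0 ∧ f'' =ᵐ[edgeMeasure] 0 := by
  have e0 := eqOn_zero_of_ae h.continuousOn h0
  have z0 : (0 : ℝ) ∈ Set.Icc (0 : ℝ) Real.pi := ⟨le_rfl, Real.pi_pos.le⟩
  have h1 : f' =ᵐ[edgeMeasure] 0 := by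
    refine ae_zero_of_primitive h.continuousOn_deriv.integrableOn_Icc fun x hx => ?_
    have := h.eq_integral x hx
    rw [e0 hx, e0 z0] at this
    simpa using this.symm
  refine ⟨h1, ?_⟩
  have e1 := eqOn_zero_of_ae h.continuousOn_deriv h1
  refine ae_zero_of_primitive (h.memLp.integrable (by norm_num)) fun x hx => ?_
  have := h.deriv_eq_integral x hx
  rw [e1 hx, e1 z0] at this
  simpa using this.symm

/-- The graph of the Hamiltonian. -/
def hamiltonianGraph (α A : ℤ → ℝ) : Submodule ℂ (L2Chain × L2Chain) where
  carrier := {p | ActsTo α A p.1 p.2}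
  zero_mem' := by
    refine ⟨0, 0, 0, fun e => IsH2.zero, fun e => Lp.coeFn_zero _ _ _, fun e => ?_, fun j => ?_⟩
    · filter_upwards [Lp.coeFn_zero ℂ 2 edgeMeasure] with x hx
      simpa [edgeAction] using hx
    · constructor <;> simp [quasiDeriv]
  add_mem' := by
    rintro ⟨u, v⟩ ⟨w, z⟩ ⟨f, f', f'', h1, h2, h3, h4⟩ ⟨g, g', g'', k1, k2, k3, k4⟩
    refine ⟨f + g, f' + g', f'' + g'', fun e => (h1 e).add (k1 e), fun e => ?_, fun e => ?_,
      fun j => ?_⟩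
    · exact (Lp.coeFn_add (u e) (w e)).trans ((h2 e).add (k2 e))
    · refine (Lp.coeFn_add (v e) (z e)).trans (((h3 e).add (k3 e)).trans ?_)
      refine Eventually.of_forall fun x => ?_
      simp only [edgeAction, Pi.add_apply]
      ring
    · obtain ⟨a1, a2, a3, a4⟩ := h4 j
      obtain ⟨b1, b2, b3, b4⟩ := k4 j
      constructor
      · simp only [Pi.add_apply, a1, b1]
      · simp only [Pi.add_apply, a2, b2]
      · simp only [Pi.add_apply, a3, b3]
      · simp only [quasiDeriv, Pi.add_apply] at a4 b4 ⊢
        linear_combination a4 + b4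
  smul_mem' := by
    rintro c ⟨u, v⟩ ⟨f, f', f'', h1, h2, h3, h4⟩
    refine ⟨c • f, c • f', c • f'', fun e => (h1 e).smul c, fun e => ?_, fun e => ?_, fun j => ?_⟩
    · exact (Lp.coeFn_smul c (u e)).trans ((h2 e).const_smul c)
    · refine (Lp.coeFn_smul c (v e)).trans (((h3 e).const_smul c).trans ?_)
      refine Eventually.of_forall fun x => ?_
      simp only [edgeAction, Pi.smul_apply, smul_eq_mul]
      ring
    · obtain ⟨a1, a2, a3, a4⟩ := h4 j
      constructor
      · simp only [Pi.smul_apply, a1]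
      · simp only [Pi.smul_apply, a2]
      · simp only [Pi.smul_apply, a3]
      · simp only [quasiDeriv, Pi.smul_apply, smul_eq_mul] at a4 ⊢
        linear_combination c * a4

/-- The graph is single valued, so that it is the graph of an operator. -/
theorem hamiltonianGraph_single_valued (α A : ℤ → ℝ) :
    ∀ p ∈ hamiltonianGraph α A, p.1 = 0 → p.2 = 0 := by
  rintro ⟨u, v⟩ ⟨f, f', f'', h1, h2, h3, -⟩ hu
  dsimp only at hu h2 h3
  subst hu
  dsimp only
  ext1
  funext e
  have hf : f e =ᵐ[edgeMeasure] 0 := (h2 e).symm.trans (Lp.coeFn_zero _ _ _)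
  obtain ⟨hf', hf''⟩ := (h1 e).ae_zero hf
  refine Lp.ext ((h3 e).trans (EventuallyEq.trans ?_ (Lp.coeFn_zero ℂ 2 edgeMeasure).symm))
  filter_upwards [hf, hf', hf''] with x a b c
  simp [edgeAction, a, b, c]

/-- The magnetic Schrödinger operator `-Δ_{α, A}` in `L²(Γ)` of the chain of rings of circumference
`2π`, with coupling constants `α j` at the vertices `j` and magnetic potentials `A j` on the
rings `j`. -/
def hamiltonian (α A : ℤ → ℝ) : L2Chain →ₗ.[ℂ] L2Chain := (hamiltonianGraph α A).toLinearPMap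

theorem graph_hamiltonian (α A : ℤ → ℝ) : (hamiltonian α A).graph = hamiltonianGraph α A :=
  Submodule.toLinearPMap_graph_eq _ (hamiltonianGraph_single_valued α A)

/-- The chain with coupling constant `α` and magnetic potential `A` everywhere, except that the ring
number `1` carries the potential `A₁` and its left vertex (number `1`) the coupling constant
`α₁`. -/
def perturbedHamiltonian (α A α₁ A₁ : ℝ) : L2Chain →ₗ.[ℂ] L2Chain :=
  hamiltonian (fun j => if j = 1 then α₁ else α) (fun j => if j = 1 then A₁ else A)

/-! ### Eigenvalues, essential spectrum and gaps -/

section Spectral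

variable {H : Type*} [NormedAddCommGroup H] [InnerProductSpace ℂ H]

/-- The eigenspace of `T` at the real energy `E`, as a subspace of the domain of `T`. -/
def eigenspace (T : H →ₗ.[ℂ] H) (E : ℝ) : Submodule ℂ T.domain :=
  LinearMap.ker (T.toFun - (E : ℂ) • T.domain.subtype)

/-- `E` is an eigenvalue of `T`. -/
def HasEigenvalue (T : H →ₗ.[ℂ] H) (E : ℝ) : Prop := eigenspace T E ≠ ⊥

/-- `E` is a simple eigenvalue of `T`. -/
def HasSimpleEigenvalue (T : H →ₗ.[ℂ] H) (E : ℝ) : Prop := Module.finrank ℂ (eigenspace T E) = 1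

/-- The essential spectrum of a self-adjoint operator: the real numbers `E` that admit a singular
Weyl sequence. -/
def essentialSpectrum (T : H →ₗ.[ℂ] H) : Set ℝ :=
  {E | ∃ u : ℕ → T.domain, Orthonormal ℂ (fun n => (u n : H)) ∧
    Tendsto (fun n => T (u n) - (E : ℂ) • (u n : H)) atTop (𝓝 0)}

/-- `T` has exactly one eigenvalue in `I`, and it is simple. -/
def HasExactlyOneSimpleEigenvalueIn (T : H →ₗ.[ℂ] H) (I : Set ℝ) : Prop :=
  ∃ E ∈ I, HasSimpleEigenvalue T E ∧ ∀ E' ∈ I, HasEigenvalue T E' → E' = E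

end Spectral

/-- The gaps of a subset `S` of the real line: the connected components of its complement. -/
def gaps (S : Set ℝ) : Set (Set ℝ) := {I | ∃ x ∈ Sᶜ, I = connectedComponentIn Sᶜ x}

/-- The number of a gap `I`, when the gaps are counted upwards and the lowest gap has number `1`. -/
def gapNumber (S I : Set ℝ) : ℕ∞ := {J ∈ gaps S | ∀ x ∈ J, ∀ y ∈ I, x < y}.encard + 1

/-- `I` is a gap with an odd number. -/
def IsOddGap (S I : Set ℝ) : Prop := I ∈ gaps S ∧ ∃ n : ℕ, Odd n ∧ gapNumber S I = n

/-- `I` is a gap with an even number. -/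
def IsEvenGap (S I : Set ℝ) : Prop := I ∈ gaps S ∧ ∃ n : ℕ, Even n ∧ gapNumber S I = n

end MagneticChain

end

open MeasureTheory Filter Topology

noncomputable section

namespace MagneticChain

section


/-! ### Fundamental solutions -/

/-! On each half-circle the gauge factor `exp (i a x)` reduces the equation to `-g'' = E g`, which
is solved by `cs` and `sn`. The field survives only in the sum `2 cos (A j π)` of the two gauge
factors of a ring. Write `s = sn E π`, `c = cos (A π)`, `η = eta α E`. If `s ≠ 0`, that is, if `E`
is none of the Dirichlet eigenvalues `n²` with `n ≥ 1`, the quasiderivatives can be eliminated. The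
`δ`-couplings then become a three-term recursion for the vertex values, and square-summable
solutions correspond to eigenfunctions (`exists_vertexData`, `exists_eigenfunction`). Away from ring
1 the recursion reads `c (U (j + 1) + U (j - 1)) = 2 η U j`.

The essential spectrum is `s = 0` or `|η| ≤ |c|` (`mem_essentialSpectrum_iff`). At these energies
truncated Bloch solutions form Weyl sequences; at all others the recursion is coercive up to two
vertex values. Between consecutive Dirichlet eigenvalues there is one band, possibly a single point,
with a gap on either side of it. Since `|η| = 1 > |c|` at `n²`, no band reaches a Dirichlet
eigenvalue. Counting upwards, the odd gaps have their band edge at the top and the even ones at the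
bottom.

In a gap a decaying solution is geometric with ratio `c / μ`, where `μ = mu α c σ E` is the root of
larger modulus of `μ + c² / μ = 2 η`. Matching across ring 1 leaves the single condition `μ (μ + b
s) = t` with `b = (α₁ - α) / 2` and `t = cos² (A₁ π)` (`eigenvalue_condition`). Solved for `b`, it
becomes `(t - μ²) / (s μ) = b`. The left side is strictly increasing in `E` (`strictMonoOn_zeta`),
which rests on the energy monotonicity of the Dirichlet-to-Neumann map (`abs_mul_cs_sub_sn_lt`). So
a gap contains at most one eigenvalue.

To decide whether there is one, compare `μ (μ + b s)` with `t` at the two ends. Near the end away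
from the band it exceeds `1 ≥ t`. At the band edge it equals `c² + τ b |c| |s|`, with `τ = 1` in odd
and `τ = -1` in even gaps (`GapData.phi_edge`). An eigenvalue exists if the edge value is below `t`
(`GapData.exactlyOne`), and none exists otherwise, provided `c ≠ 0` (`GapData.no_eigenvalue`).
Everything is thus a comparison of `t - c²` with `τ b |c| |s|`. Because `|s| ≤ 1 / n` in the `n`-th
Dirichlet interval, an unfavourable sign matters in finitely many gaps only, and in none if `b` is
small. -/

/-- The even fundamental solution of `-y'' = E y`. -/
def cs (E x : ℝ) : ℝ := Real.cos (√E * x) * Real.cosh (√(-E) * x)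

/-- The odd fundamental solution of `-y'' = E y`. -/
def sn (E x : ℝ) : ℝ := ∫ t in (0 : ℝ)..x, cs E t

theorem continuous_cs : Continuous fun p : ℝ × ℝ => cs p.1 p.2 := by
  unfold cs; fun_prop

theorem continuous_cs_right (E : ℝ) : Continuous (cs E) :=
  continuous_cs.comp (by fun_prop : Continuous fun x : ℝ => (E, x))

theorem continuous_cs_left (x : ℝ) : Continuous fun E => cs E x :=
  continuous_cs.comp (by fun_prop : Continuous fun E : ℝ => (E, x))

theorem continuous_sn_left (x : ℝ) : Continuous fun E => sn E x :=
  intervalIntegral.continuous_parametric_intervalIntegral_of_continuous' continuous_cs 0 x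

theorem hasDerivAt_sn (E x : ℝ) : HasDerivAt (sn E) (cs E x) x :=
  intervalIntegral.integral_hasDerivAt_right ((continuous_cs_right E).intervalIntegrable _ _)
    ((continuous_cs_right E).stronglyMeasurableAtFilter _ _) (continuous_cs_right E).continuousAt

theorem continuous_sn_right (E : ℝ) : Continuous (sn E) :=
  continuous_iff_continuousAt.2 fun x => (hasDerivAt_sn E x).continuousAt

@[simp] theorem cs_zero_right (E : ℝ) : cs E 0 = 1 := by simp [cs]

@[simp] theorem sn_zero_right (E : ℝ) : sn E 0 = 0 := by simp [sn]

theorem cs_sq {k : ℝ} (hk : 0 ≤ k) (x : ℝ) : cs (k ^ 2) x = Real.cos (k * x) := by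
  have : √(-k ^ 2) = 0 := Real.sqrt_eq_zero_of_nonpos (by nlinarith [sq_nonneg k])
  simp [cs, Real.sqrt_sq hk, this]

theorem cs_neg_sq {k : ℝ} (hk : 0 ≤ k) (x : ℝ) : cs (-k ^ 2) x = Real.cosh (k * x) := by
  have : √(-k ^ 2) = 0 := Real.sqrt_eq_zero_of_nonpos (by nlinarith [sq_nonneg k])
  simp [cs, Real.sqrt_sq hk, this]

theorem sn_sq {k : ℝ} (hk : 0 < k) (x : ℝ) : sn (k ^ 2) x = Real.sin (k * x) / k := by
  have h : ∀ y ∈ Set.uIcc 0 x, HasDerivAt (fun y => Real.sin (k * y) / k) (cs (k ^ 2) y) y := by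
    intro y _
    refine ((hasDerivAt_const_mul k).sin.div_const k).congr_deriv ?_
    rw [cs_sq hk.le]; field_simp
  rw [sn, intervalIntegral.integral_eq_sub_of_hasDerivAt h
    ((continuous_cs_right _).intervalIntegrable _ _)]
  simp

theorem sn_neg_sq {k : ℝ} (hk : 0 < k) (x : ℝ) : sn (-k ^ 2) x = Real.sinh (k * x) / k := by
  have h : ∀ y ∈ Set.uIcc 0 x, HasDerivAt (fun y => Real.sinh (k * y) / k) (cs (-k ^ 2) y) y := by
    intro y _
    refine ((hasDerivAt_const_mul k).sinh.div_const k).congr_deriv ?_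
    rw [cs_neg_sq hk.le]; field_simp
  rw [sn, intervalIntegral.integral_eq_sub_of_hasDerivAt h
    ((continuous_cs_right _).intervalIntegrable _ _)]
  simp

/-- A real number is a positive square, zero, or the negative of a positive square. -/
theorem sq_cases (E : ℝ) : (∃ k > 0, E = k ^ 2) ∨ E = 0 ∨ ∃ k > 0, E = -k ^ 2 := by
  rcases lt_trichotomy E 0 with h | h | h
  · exact .inr (.inr ⟨√(-E), Real.sqrt_pos.2 (by linarith), by rw [Real.sq_sqrt] <;> linarith⟩)
  · exact .inr (.inl h)
  · exact .inl ⟨√E, Real.sqrt_pos.2 h, by rw [Real.sq_sqrt h.le]⟩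

theorem cs_zero_left (x : ℝ) : cs 0 x = 1 := by simp [cs]

theorem sn_zero_left (x : ℝ) : sn 0 x = x := by simp [sn, cs_zero_left]

theorem hasDerivAt_cs (E x : ℝ) : HasDerivAt (cs E) (-E * sn E x) x := by
  rcases sq_cases E with ⟨k, hk, rfl⟩ | rfl | ⟨k, hk, rfl⟩
  · rw [show cs (k ^ 2) = fun x => Real.cos (k * x) from funext (cs_sq hk.le)]
    refine (hasDerivAt_const_mul k).cos.congr_deriv ?_
    rw [sn_sq hk]; field_simp
  · rw [show cs 0 = fun x => 1 from funext cs_zero_left]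
    simpa using hasDerivAt_const x (1 : ℝ)
  · rw [show cs (-k ^ 2) = fun x => Real.cosh (k * x) from funext (cs_neg_sq hk.le)]
    refine (hasDerivAt_const_mul k).cosh.congr_deriv ?_
    rw [sn_neg_sq hk]; field_simp

theorem cs_sq_add (E x : ℝ) : cs E x ^ 2 + E * sn E x ^ 2 = 1 := by
  rcases sq_cases E with ⟨k, hk, rfl⟩ | rfl | ⟨k, hk, rfl⟩
  · rw [cs_sq hk.le, sn_sq hk]; field_simp; exact Real.cos_sq_add_sin_sq _
  · simp [cs_zero_left]
  · rw [cs_neg_sq hk.le, sn_neg_sq hk]; field_simp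
    linear_combination Real.cosh_sq (k * x)

/-! ### Absolutely continuous functions -/

theorem absolutelyContinuousOnInterval_congr {f g : ℝ → ℂ} {a b : ℝ}
    (hf : AbsolutelyContinuousOnInterval f a b) (h : Set.EqOn f g (Set.uIcc a b)) :
    AbsolutelyContinuousOnInterval g a b := by
  refine Tendsto.congr' ?_ hf
  refine eventually_inf_principal.2 (Eventually.of_forall fun E hE => ?_)
  refine Finset.sum_congr rfl fun i hi => ?_
  rw [h (hE.1 i hi).1, h (hE.1 i hi).2]

/-- The real and imaginary parts have absolutely continuous primitives, and these are recombined. -/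
theorem absolutelyContinuous_primitive {w : ℝ → ℂ} {a b : ℝ} (h : IntervalIntegrable w volume a b) :
    AbsolutelyContinuousOnInterval (fun x => ∫ t in a..x, w t) a b := by
  have hr : IntervalIntegrable (fun t => (w t).re) volume a b := ⟨h.1.re, h.2.re⟩
  have hi : IntervalIntegrable (fun t => (w t).im) volume a b := ⟨h.1.im, h.2.im⟩
  have hR := hr.absolutelyContinuousOnInterval_intervalIntegral (c := a) (by simp)
  have hI := hi.absolutelyContinuousOnInterval_intervalIntegral (c := a) (by simp)
  have hR' : AbsolutelyContinuousOnInterval (fun x => ((∫ t in a..x, (w t).re : ℝ) : ℂ)) a b := by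
    refine hR.congr fun E => Finset.sum_congr rfl fun i _ => ?_
    rw [Complex.dist_eq, ← Complex.ofReal_sub, Complex.norm_real, Real.dist_eq, Real.norm_eq_abs]
  have hI' : AbsolutelyContinuousOnInterval (fun x => ((∫ t in a..x, (w t).im : ℝ) : ℂ)) a b := by
    refine hI.congr fun E => Finset.sum_congr rfl fun i _ => ?_
    rw [Complex.dist_eq, ← Complex.ofReal_sub, Complex.norm_real, Real.dist_eq, Real.norm_eq_abs]
  refine absolutelyContinuousOnInterval_congr (hR'.add (hI'.const_smul Complex.I)) fun x hx => ?_
  have hx' : Set.uIcc a x ⊆ Set.uIcc a b := Set.uIcc_subset_uIcc_left hx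
  have e := intervalIntegral.integral_congr (μ := volume) (a := a) (b := x) (f := w)
    (g := fun t => ((w t).re : ℂ) + Complex.I • ((w t).im : ℂ))
    (fun t _ => by simp [mul_comm Complex.I, Complex.re_add_im])
  have hr' : IntervalIntegrable (fun t => ((w t).re : ℂ)) volume a x :=
    ⟨(hr.mono_set hx').1.ofReal, (hr.mono_set hx').2.ofReal⟩
  have hi' : IntervalIntegrable (fun t => ((w t).im : ℂ)) volume a x :=
    ⟨(hi.mono_set hx').1.ofReal, (hi.mono_set hx').2.ofReal⟩
  have hi'' : IntervalIntegrable (fun t => Complex.I • ((w t).im : ℂ)) volume a x :=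
    hi'.const_mul Complex.I
  simp only [Pi.add_apply]
  rw [e, intervalIntegral.integral_add hr' hi'', intervalIntegral.integral_smul,
    intervalIntegral.integral_ofReal, intervalIntegral.integral_ofReal]

/-- The difference of `φ` and the primitive of `φ'` is absolutely continuous with derivative zero
almost everywhere, hence constant. -/
theorem integral_eq_sub_of_absolutelyContinuous {φ φ' : ℝ → ℂ} {a b : ℝ}
    (h : AbsolutelyContinuousOnInterval φ a b)
    (hd : ∀ᵐ x, x ∈ Set.uIcc a b → HasDerivAt φ (φ' x) x)
    (hi : IntervalIntegrable φ' volume a b) : ∫ t in a..b, φ' t = φ b - φ a := by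
  obtain ⟨c, hc⟩ := (h.sub (absolutelyContinuous_primitive hi)).const_of_ae_hasDerivAt_zero (by
    filter_upwards [hd, hi.ae_hasDerivAt_integral] with x h1 h2 hx
    simpa using (h1 hx).sub (h2 hx a (by simp)))
  have h1 := hc a (by simp)
  have h2 := hc b (by simp)
  simp only [Pi.sub_apply, intervalIntegral.integral_same] at h1 h2
  linear_combination h1 - h2

/-- Integration by parts for a primitive `p` of an integrable function `w` and a `C¹` function. -/
theorem integral_mul_add_mul_deriv {p w χ χ' : ℝ → ℂ} {b : ℝ} (hb : 0 ≤ b)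
    (hw : IntervalIntegrable w volume 0 b)
    (hp : ∀ x ∈ Set.Icc 0 b, p x = p 0 + ∫ t in (0 : ℝ)..x, w t)
    (hχ : ∀ x, HasDerivAt χ (χ' x) x) (hχ' : Continuous χ') :
    ∫ t in (0 : ℝ)..b, (w t * χ t + p t * χ' t) = p b * χ b - p 0 * χ 0 := by
  have hχc : Continuous χ := continuous_iff_continuousAt.2 fun x => (hχ x).continuousAt
  have hac : AbsolutelyContinuousOnInterval χ 0 b := by
    refine ContDiffOn.absolutelyContinuousOnInterval (ContDiff.contDiffOn ?_)
    refine contDiff_one_iff_deriv.2 ⟨fun x => (hχ x).differentiableAt, ?_⟩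
    rwa [show deriv χ = χ' from funext fun x => (hχ x).deriv]
  -- `p` is controlled on `[0, b]` only, so the explicit primitive replaces it until the end.
  have hq : AbsolutelyContinuousOnInterval (fun x => p 0 + ∫ t in (0 : ℝ)..x, w t) 0 b :=
    ((contDiffOn_const (c := p 0)).absolutelyContinuousOnInterval).add
      (absolutelyContinuous_primitive hw)
  have hcont := hq.continuousOn
  have := integral_eq_sub_of_absolutelyContinuous
    (φ' := fun t => w t * χ t + (p 0 + ∫ t in (0 : ℝ)..t, w t) * χ' t) (hq.smul hac) (by
    filter_upwards [hw.ae_hasDerivAt_integral] with x h2 hx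
    exact (((h2 hx 0 (by simp)).const_add (p 0)).mul (hχ x))) (by
    exact (hw.mul_continuousOn hχc.continuousOn).add
      ((hcont.mul hχ'.continuousOn).intervalIntegrable))
  simp only [Pi.smul_apply', smul_eq_mul, intervalIntegral.integral_same, add_zero] at this
  rw [hp b ⟨hb, le_rfl⟩, ← this]
  refine intervalIntegral.integral_congr fun t ht => ?_
  rw [Set.uIcc_of_le hb] at ht
  rw [← hp t ht]

/-! ### Removing the magnetic potential on an edge -/

theorem memLp_edge {f : ℝ → ℂ} (h : ContinuousOn f (Set.Icc 0 Real.pi)) : MemLp f 2 edgeMeasure := by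
  obtain ⟨K, hK⟩ := isCompact_Icc.exists_bound_of_continuousOn h
  refine MemLp.of_bound (h.aestronglyMeasurable measurableSet_Icc) K ?_
  filter_upwards [ae_restrict_mem measurableSet_Icc] with x hx using hK x hx

theorem IsH2.of_hasDerivAt {f f' f'' : ℝ → ℂ} (h : ∀ x, HasDerivAt f (f' x) x)
    (h' : ∀ x, HasDerivAt f' (f'' x) x) (hc : Continuous f'') : IsH2 f f' f'' := by
  have hc' : Continuous f' := continuous_iff_continuousAt.2 fun x => (h' x).continuousAt
  refine ⟨?_, fun x _ => ?_, fun x _ => ?_⟩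
  · exact memLp_edge hc.continuousOn
  · rw [intervalIntegral.integral_eq_sub_of_hasDerivAt (fun y _ => h y)
      (hc'.intervalIntegrable _ _)]; ring
  · rw [intervalIntegral.integral_eq_sub_of_hasDerivAt (fun y _ => h' y)
      (hc.intervalIntegrable _ _)]; ring

/-- Lagrange's identity on `[0, x]`. -/
theorem IsH2.lagrange {g g' g'' χ χ' χ'' : ℝ → ℂ} (h : IsH2 g g' g'')
    (hχ : ∀ x, HasDerivAt χ (χ' x) x) (hχ' : ∀ x, HasDerivAt χ' (χ'' x) x) (hc : Continuous χ'')
    {x : ℝ} (hx : x ∈ Set.Icc 0 Real.pi) :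
    ∫ t in (0 : ℝ)..x, (g'' t * χ t - g t * χ'' t) =
      (g' x * χ x - g x * χ' x) - (g' 0 * χ 0 - g 0 * χ' 0) := by
  have c0 : Continuous χ := continuous_iff_continuousAt.2 fun x => (hχ x).continuousAt
  have c1 : Continuous χ' := continuous_iff_continuousAt.2 fun x => (hχ' x).continuousAt
  have hsub : Set.Icc 0 x ⊆ Set.Icc 0 Real.pi := Set.Icc_subset_Icc_right hx.2
  have hu : Set.uIcc 0 x ⊆ Set.Icc 0 Real.pi := by rwa [Set.uIcc_of_le hx.1]
  have e1 := integral_mul_add_mul_deriv hx.1 (h.intervalIntegrable hx)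
    (fun y hy => h.deriv_eq_integral y (hsub hy)) hχ c1
  have e2 := integral_mul_add_mul_deriv hx.1 (h.intervalIntegrable_deriv hx)
    (fun y hy => h.eq_integral y (hsub hy)) hχ' hc
  have i1 := ((h.intervalIntegrable hx).mul_continuousOn c0.continuousOn).add
    ((h.intervalIntegrable_deriv hx).mul_continuousOn c1.continuousOn)
  have i2 := ((h.intervalIntegrable_deriv hx).mul_continuousOn c1.continuousOn).add
    (((h.continuousOn.mono hu).intervalIntegrable).mul_continuousOn hc.continuousOn)
  have e3 := intervalIntegral.integral_sub i1 i2
  rw [e1, e2] at e3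
  rw [show (g' x * χ x - g x * χ' x) - (g' 0 * χ 0 - g 0 * χ' 0) = g' x * χ x - g' 0 * χ 0 -
    (g x * χ' x - g 0 * χ' 0) by ring, ← e3]
  refine intervalIntegral.integral_congr fun t _ => ?_
  ring

theorem hasDerivAt_cexp_mul_I (a : ℂ) (x : ℝ) :
    HasDerivAt (fun x : ℝ => Complex.exp (Complex.I * a * x))
      (Complex.I * a * Complex.exp (Complex.I * a * x)) x := by
  have := ((hasDerivAt_id x).ofReal_comp.const_mul (Complex.I * a)).cexp
  simpa [mul_comm] using this

theorem IsH2.mul {f f' f'' χ χ' χ'' : ℝ → ℂ} (h : IsH2 f f' f'')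
    (hχ : ∀ x, HasDerivAt χ (χ' x) x) (hχ' : ∀ x, HasDerivAt χ' (χ'' x) x) (hc : Continuous χ'') :
    IsH2 (fun x => f x * χ x) (fun x => f' x * χ x + f x * χ' x)
      (fun x => f'' x * χ x + 2 * (f' x * χ' x) + f x * χ'' x) := by
  have c0 : Continuous χ := continuous_iff_continuousAt.2 fun x => (hχ x).continuousAt
  have c1 : Continuous χ' := continuous_iff_continuousAt.2 fun x => (hχ' x).continuousAt
  refine ⟨?_, fun x hx => ?_, fun x hx => ?_⟩
  · have m1 : MemLp (fun x => f'' x * χ x) 2 edgeMeasure := by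
      obtain ⟨K, hK⟩ := isCompact_Icc.exists_bound_of_continuousOn (c0.continuousOn (s := Set.Icc 0 Real.pi))
      refine (h.memLp.const_mul (K : ℂ)).of_le (h.memLp.1.mul c0.aestronglyMeasurable) ?_
      filter_upwards [ae_restrict_mem measurableSet_Icc] with x hx
      rw [norm_mul, norm_mul, mul_comm]
      gcongr
      exact (hK x hx).trans (by simpa using le_abs_self K)
    have m2 : MemLp (fun x => 2 * (f' x * χ' x) + f x * χ'' x) 2 edgeMeasure := by
      refine memLp_edge ?_
      exact (continuousOn_const.mul (h.continuousOn_deriv.mul c1.continuousOn)).add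
        (h.continuousOn.mul hc.continuousOn)
    refine (m1.add m2).ae_eq (Eventually.of_forall fun x => ?_)
    simp only [Pi.add_apply]; ring
  · have hsub : Set.Icc 0 x ⊆ Set.Icc 0 Real.pi := Set.Icc_subset_Icc_right hx.2
    have e2 := integral_mul_add_mul_deriv hx.1 (h.intervalIntegrable_deriv hx)
      (fun y hy => h.eq_integral y (hsub hy)) hχ c1
    rw [e2]; ring
  · have hsub : Set.Icc 0 x ⊆ Set.Icc 0 Real.pi := Set.Icc_subset_Icc_right hx.2
    have hu : Set.uIcc 0 x ⊆ Set.Icc 0 Real.pi := by rwa [Set.uIcc_of_le hx.1]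
    have e1 := integral_mul_add_mul_deriv hx.1 (h.intervalIntegrable hx)
      (fun y hy => h.deriv_eq_integral y (hsub hy)) hχ c1
    have e2 := integral_mul_add_mul_deriv hx.1 (h.intervalIntegrable_deriv hx)
      (fun y hy => h.eq_integral y (hsub hy)) hχ' hc
    have i1 := ((h.intervalIntegrable hx).mul_continuousOn c0.continuousOn).add
      ((h.intervalIntegrable_deriv hx).mul_continuousOn c1.continuousOn)
    have i2 := ((h.intervalIntegrable_deriv hx).mul_continuousOn c1.continuousOn).add
      (((h.continuousOn.mono hu).intervalIntegrable).mul_continuousOn hc.continuousOn)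
    have e3 := intervalIntegral.integral_add i1 i2
    rw [e1, e2] at e3
    have : ∫ t in (0:ℝ)..x, (f'' t * χ t + 2 * (f' t * χ' t) + f t * χ'' t) = _ :=
      (intervalIntegral.integral_congr fun t _ => by ring).trans e3
    rw [this]; ring

end

section


/-! ### Solutions on an edge -/

/-- The gauge factor `exp (i a x)` of an edge. -/
def gauge (A : ℤ → ℝ) (e : Edge) (x : ℝ) : ℂ := Complex.exp (Complex.I * potential A e * x)

theorem hasDerivAt_gauge (A : ℤ → ℝ) (e : Edge) (x : ℝ) :
    HasDerivAt (gauge A e) (Complex.I * potential A e * gauge A e x) x :=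
  hasDerivAt_cexp_mul_I _ _

theorem continuous_gauge (A : ℤ → ℝ) (e : Edge) : Continuous (gauge A e) :=
  continuous_iff_continuousAt.2 fun x => (hasDerivAt_gauge A e x).continuousAt

theorem gauge_ne_zero (A : ℤ → ℝ) (e : Edge) (x : ℝ) : gauge A e x ≠ 0 := Complex.exp_ne_zero _

@[simp] theorem gauge_zero (A : ℤ → ℝ) (e : Edge) : gauge A e 0 = 1 := by simp [gauge]

theorem norm_gauge (A : ℤ → ℝ) (e : Edge) (x : ℝ) : ‖gauge A e x‖ = 1 := by
  unfold gauge potential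
  split_ifs
  · rw [show Complex.I * (A e.1 : ℂ) * x = ((A e.1 * x : ℝ) : ℂ) * Complex.I by push_cast; ring,
      Complex.norm_exp_ofReal_mul_I]
  · rw [show Complex.I * -(A e.1 : ℂ) * x = ((-(A e.1 * x) : ℝ) : ℂ) * Complex.I by push_cast; ring,
      Complex.norm_exp_ofReal_mul_I]

/-- The two half-circles carry inverse phases. This sum is how the field of a ring enters the vertex
equation, which therefore depends on it through a real cosine only. -/
theorem gauge_true_add_gauge_false (A : ℤ → ℝ) (j : ℤ) (x : ℝ) :
    gauge A (j, true) x + gauge A (j, false) x = 2 * (Real.cos (A j * x) : ℂ) := by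
  simp only [gauge, potential, if_true, Bool.false_eq_true, if_false]
  rw [Complex.ofReal_cos, Complex.two_cos]
  push_cast
  congr 2 <;> ring

theorem gauge_false (A : ℤ → ℝ) (j : ℤ) (x : ℝ) :
    gauge A (j, false) x = (gauge A (j, true) x)⁻¹ := by
  simp only [gauge, potential, if_true, Bool.false_eq_true, if_false]
  rw [← Complex.exp_neg]; congr 1; ring

/-- Multiplication by the gauge factor turns the magnetic action into `-d²/dx²`. -/
theorem IsH2.gauged {f f' f'' : ℝ → ℂ} (h : IsH2 f f' f'') (A : ℤ → ℝ) (e : Edge) :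
    IsH2 (fun x => gauge A e x * f x) (fun x => gauge A e x * quasiDeriv A e f f' x)
      (fun x => -(gauge A e x * edgeAction A e f f' f'' x)) := by
  have := h.mul (hasDerivAt_gauge A e) (fun x => (hasDerivAt_gauge A e x).const_mul _)
    (continuous_const.mul (continuous_const.mul (continuous_gauge A e)))
  refine cast (congrArg₂ (fun a b => a b) (congrArg₂ IsH2 ?_ ?_) ?_) this <;> funext x
  · ring
  · simp only [quasiDeriv]; ring
  · simp only [edgeAction]
    linear_combination f x * gauge A e x * potential A e ^ 2 * Complex.I_sq

theorem hasDerivAt_ofReal_comp_sub {y : ℝ → ℝ} {y' x t : ℝ} (h : HasDerivAt y y' (x - t)) :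
    HasDerivAt (fun t : ℝ => (y (x - t) : ℂ)) (-y' : ℂ) t := by
  have := (h.comp_const_sub x t).ofReal_comp
  simpa using this

variable {A : ℤ → ℝ} {e : Edge} {f f' f'' : ℝ → ℂ}

/-- Variation of constants: Lagrange's identity is tested against `t ↦ sn E (x - t)`, which solves
the equation and vanishes at `t = x`. The function `f` need not be a solution; its defect appears as
a source, so that eigenfunctions and Weyl sequences are covered at once. -/
theorem IsH2.edge_value (h : IsH2 f f' f'') (E : ℝ) {x : ℝ} (hx : x ∈ Set.Icc 0 Real.pi) :
    gauge A e x * f x = cs E x * f 0 + sn E x * quasiDeriv A e f f' 0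
      - ∫ t in (0 : ℝ)..x, gauge A e t * (edgeAction A e f f' f'' t - E * f t) * sn E (x - t) := by
  have := (h.gauged A e).lagrange (χ := fun t => (sn E (x - t) : ℂ))
    (χ' := fun t => (-cs E (x - t) : ℂ)) (χ'' := fun t => (-E * sn E (x - t) : ℂ))
    (fun t => hasDerivAt_ofReal_comp_sub (hasDerivAt_sn E _))
    (fun t => by simpa using (hasDerivAt_ofReal_comp_sub (hasDerivAt_cs E (x - t))).fun_neg)
    (by have := continuous_sn_right E; fun_prop) hx
  simp only [sub_self, sub_zero, sn_zero_right, cs_zero_right, gauge_zero, Complex.ofReal_zero,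
    Complex.ofReal_one] at this
  have e2 : ∫ t in (0 : ℝ)..x, gauge A e t * (edgeAction A e f f' f'' t - E * f t) * sn E (x - t)
      = - ∫ t in (0 : ℝ)..x, (-(gauge A e t * edgeAction A e f f' f'' t) * sn E (x - t) -
        gauge A e t * f t * (-E * sn E (x - t))) := by
    rw [← intervalIntegral.integral_neg]
    exact intervalIntegral.integral_congr fun t _ => by ring
  rw [e2, this]; ring

/-- The companion formula for the derivative, with `t ↦ cs E (x - t)` as test function. -/
theorem IsH2.edge_quasiDeriv (h : IsH2 f f' f'') (E : ℝ) {x : ℝ} (hx : x ∈ Set.Icc 0 Real.pi) :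
    gauge A e x * quasiDeriv A e f f' x = -E * sn E x * f 0 + cs E x * quasiDeriv A e f f' 0
      - ∫ t in (0 : ℝ)..x, gauge A e t * (edgeAction A e f f' f'' t - E * f t) * cs E (x - t) := by
  have := (h.gauged A e).lagrange (χ := fun t => (cs E (x - t) : ℂ))
    (χ' := fun t => (E * sn E (x - t) : ℂ)) (χ'' := fun t => (-E * cs E (x - t) : ℂ))
    (fun t => by simpa using hasDerivAt_ofReal_comp_sub (hasDerivAt_cs E (x - t)))
    (fun t => by simpa using (hasDerivAt_ofReal_comp_sub (hasDerivAt_sn E (x - t))).const_mul (E : ℂ))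
    (by have := continuous_cs_right E; fun_prop) hx
  simp only [sub_self, sub_zero, sn_zero_right, cs_zero_right, gauge_zero, Complex.ofReal_zero,
    Complex.ofReal_one] at this
  have e2 : ∫ t in (0 : ℝ)..x, gauge A e t * (edgeAction A e f f' f'' t - E * f t) * cs E (x - t)
      = - ∫ t in (0 : ℝ)..x, (-(gauge A e t * edgeAction A e f f' f'' t) * cs E (x - t) -
        gauge A e t * f t * (-E * cs E (x - t))) := by
    rw [← intervalIntegral.integral_neg]
    exact intervalIntegral.integral_congr fun t _ => by ring
  rw [e2, this]; ring

/-! ### Estimates -/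

/-- The Cauchy–Schwarz inequality on an interval of length `π`. -/
theorem exists_integral_norm_le : ∃ K : ℝ, 0 < K ∧ ∀ w : Lp ℂ 2 edgeMeasure,
    ∫ x, ‖w x‖ ∂edgeMeasure ≤ K * ‖w‖ := by
  refine ⟨√Real.pi, Real.sqrt_pos.2 Real.pi_pos, fun w => ?_⟩
  have h1 : MemLp w 2 edgeMeasure := Lp.memLp w
  have h2 := eLpNorm_le_eLpNorm_mul_rpow_measure_univ (p := 1) (q := 2) (by norm_num) h1.1
  rw [integral_norm_eq_lintegral_enorm h1.1, ← eLpNorm_one_eq_lintegral_enorm, Lp.norm_def]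
  have h3 := ENNReal.toReal_mono (ENNReal.mul_ne_top h1.2.ne (ENNReal.rpow_ne_top_of_nonneg (by norm_num) (by simp))) h2
  refine h3.trans (le_of_eq ?_)
  rw [ENNReal.toReal_mul, mul_comm]
  congr 1
  rw [← ENNReal.toReal_rpow]
  simp [Real.sqrt_eq_rpow, Real.pi_pos.le]
  norm_num

/-- `z` is the value at the left endpoint of the continuous representative of `w`. -/
def IsLeftValue (w : Lp ℂ 2 edgeMeasure) (z : ℂ) : Prop :=
  ∃ f : ℝ → ℂ, ContinuousOn f (Set.Icc 0 Real.pi) ∧ w =ᵐ[edgeMeasure] f ∧ f 0 = z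

/-- Makes the vertex values depend on the `L²` element alone, so that the vertex data of a
difference are the differences of the vertex data. -/
theorem IsLeftValue.unique {w : Lp ℂ 2 edgeMeasure} {z z' : ℂ} (h : IsLeftValue w z)
    (h' : IsLeftValue w z') : z = z' := by
  obtain ⟨f, hf, hw, rfl⟩ := h
  obtain ⟨g, hg, hw', rfl⟩ := h'
  have := eqOn_zero_of_ae (hf.sub hg) (by
    filter_upwards [hw, hw'] with x h1 h2
    simp [← h1, ← h2])
  have := this ⟨le_rfl, Real.pi_pos.le⟩
  simpa [sub_eq_zero] using this

theorem IsLeftValue.sub {w w' : Lp ℂ 2 edgeMeasure} {z z' : ℂ} (h : IsLeftValue w z)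
    (h' : IsLeftValue w' z') : IsLeftValue (w - w') (z - z') := by
  obtain ⟨f, hf, hw, rfl⟩ := h
  obtain ⟨g, hg, hw', rfl⟩ := h'
  exact ⟨f - g, hf.sub hg, (Lp.coeFn_sub _ _).trans (hw.sub hw'), rfl⟩

theorem IsLeftValue.smul {w : Lp ℂ 2 edgeMeasure} {z : ℂ} (c : ℂ) (h : IsLeftValue w z) :
    IsLeftValue (c • w) (c * z) := by
  obtain ⟨f, hf, hw, rfl⟩ := h
  exact ⟨c • f, hf.const_smul c, (Lp.coeFn_smul _ _).trans (hw.const_smul c), rfl⟩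

/-- `∫ w k` over a subinterval is controlled by the `L²` norm of `w`. -/
theorem norm_integral_mul_le {K M : ℝ} (hM : 0 ≤ M)
    (hK : ∀ w : Lp ℂ 2 edgeMeasure, ∫ x, ‖w x‖ ∂edgeMeasure ≤ K * ‖w‖)
    {w : Lp ℂ 2 edgeMeasure} {g k : ℝ → ℂ} (hg : w =ᵐ[edgeMeasure] g) {x : ℝ}
    (hx : x ∈ Set.Icc 0 Real.pi) (hk : ∀ t ∈ Set.Icc 0 x, ‖k t‖ ≤ M) :
    ‖∫ t in (0 : ℝ)..x, g t * k t‖ ≤ M * K * ‖w‖ := by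
  have hwi : Integrable (fun x => ‖w x‖) edgeMeasure :=
    ((Lp.memLp w).integrable (by norm_num)).norm
  have hgi : Integrable (fun x => ‖g x‖) edgeMeasure := hwi.congr (hg.fun_comp norm)
  have hgi' : IntegrableOn (fun x => ‖g x‖) (Set.Icc 0 Real.pi) volume := hgi
  have hsub : Set.Ioc 0 x ⊆ Set.Icc 0 Real.pi := fun t ht => ⟨ht.1.le, ht.2.trans hx.2⟩
  calc ‖∫ t in (0 : ℝ)..x, g t * k t‖ ≤ ∫ t in (0:ℝ)..x, M * ‖g t‖ := by
        refine intervalIntegral.norm_integral_le_of_norm_le hx.1 ?_ ?_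
        · refine Eventually.of_forall fun t ht => ?_
          rw [norm_mul, mul_comm]
          exact mul_le_mul_of_nonneg_right (hk t ⟨ht.1.le, ht.2⟩) (norm_nonneg _)
        · rw [intervalIntegrable_iff_integrableOn_Ioc_of_le hx.1]
          exact (hgi'.mono_set hsub).const_mul M
    _ = M * ∫ t in Set.Ioc 0 x, ‖g t‖ := by
        rw [intervalIntegral.integral_const_mul, intervalIntegral.integral_of_le hx.1]
    _ ≤ M * ∫ t in Set.Icc 0 Real.pi, ‖g t‖ := by
        refine mul_le_mul_of_nonneg_left ?_ hM
        exact setIntegral_mono_set hgi' (Eventually.of_forall fun t => norm_nonneg _)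
          (Eventually.of_forall hsub)
    _ = M * ∫ t, ‖w t‖ ∂edgeMeasure := by
        congr 1; exact integral_congr_ae (hg.symm.fun_comp norm)
    _ ≤ M * K * ‖w‖ := by
        rw [mul_assoc]; exact mul_le_mul_of_nonneg_left (hK w) hM

end

/-! ### Boundary data and vertex values of functions in the domain -/

section


theorem exists_fundamental_bound (E : ℝ) : ∃ M : ℝ, 0 < M ∧
    ∀ x ∈ Set.Icc 0 Real.pi, |cs E x| ≤ M ∧ |sn E x| ≤ M := by
  obtain ⟨a, ha⟩ := isCompact_Icc.exists_bound_of_continuousOn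
    ((continuous_cs_right E).continuousOn (s := Set.Icc 0 Real.pi))
  obtain ⟨b, hb⟩ := isCompact_Icc.exists_bound_of_continuousOn
    ((continuous_sn_right E).continuousOn (s := Set.Icc 0 Real.pi))
  refine ⟨max (max a b) 1, by positivity, fun x hx => ⟨?_, ?_⟩⟩
  · exact (ha x hx).trans ((le_max_left _ _).trans (le_max_left _ _))
  · exact (hb x hx).trans ((le_max_right _ _).trans (le_max_left _ _))

/-- Boundary data of a function on an edge, up to an error controlled by `M`. -/
structure EdgeBounds (E M : ℝ) (g f0 fπ d0 dπ : ℂ) (H : ℝ) : Prop where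
  right : ‖sn E Real.pi * d0 - (g * fπ - cs E Real.pi * f0)‖ ≤ M * H
  left : ‖sn E Real.pi * dπ - (cs E Real.pi * fπ - g⁻¹ * f0)‖ ≤ M * H

theorem norm_coeFn_sub_smul {A : ℤ → ℝ} {e : Edge} {f f' f'' : ℝ → ℂ} {u v : Lp ℂ 2 edgeMeasure}
    (E : ℝ) (hu : u =ᵐ[edgeMeasure] f) (hv : v =ᵐ[edgeMeasure] edgeAction A e f f' f'') :
    (v - (E : ℂ) • u : Lp ℂ 2 edgeMeasure) =ᵐ[edgeMeasure]
      fun x => edgeAction A e f f' f'' x - E * f x := by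
  filter_upwards [Lp.coeFn_sub v ((E : ℂ) • u), Lp.coeFn_smul (E : ℂ) u, hu, hv] with x h1 h2 h3 h4
  rw [h1, Pi.sub_apply, h2, Pi.smul_apply, h3, h4, smul_eq_mul]

/-- The basic estimates on an edge. -/
theorem exists_edge_estimates (E : ℝ) : ∃ M : ℝ, 0 < M ∧
    ∀ (A : ℤ → ℝ) (e : Edge) (f f' f'' : ℝ → ℂ) (u v : Lp ℂ 2 edgeMeasure), IsH2 f f' f'' →
      u =ᵐ[edgeMeasure] f → v =ᵐ[edgeMeasure] edgeAction A e f f' f'' →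
      EdgeBounds E M (gauge A e Real.pi) (f 0) (f Real.pi) (quasiDeriv A e f f' 0)
        (quasiDeriv A e f f' Real.pi) ‖v - (E : ℂ) • u‖ ∧
      ‖u‖ ≤ M * (‖f 0‖ + ‖quasiDeriv A e f f' 0‖ + ‖v - (E : ℂ) • u‖) ∧
      ‖f 0‖ ≤ M * (‖u‖ + ‖v - (E : ℂ) • u‖) := by
  obtain ⟨K, hK0, hK⟩ := exists_integral_norm_le
  obtain ⟨B, hB0, hB⟩ := exists_fundamental_bound E
  have hpi := Real.pi_pos
  have hpm : Real.pi ∈ Set.Icc 0 Real.pi := ⟨hpi.le, le_rfl⟩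
  refine ⟨2 * B * B * K + (B * K + B) * (1 + √Real.pi) + 100 * (1 + |E|) * K + 1, by positivity, ?_⟩
  set M := 2 * B * B * K + (B * K + B) * (1 + √Real.pi) + 100 * (1 + |E|) * K + 1 with hM
  intro A e f f' f'' u v hf hu hv
  have hw := norm_coeFn_sub_smul E hu hv
  set w := v - (E : ℂ) • u with hwdef
  have k1 : ∀ x ∈ Set.Icc 0 Real.pi, ‖∫ t in (0 : ℝ)..x,
      gauge A e t * (edgeAction A e f f' f'' t - E * f t) * sn E (x - t)‖ ≤ B * K * ‖w‖ := by
    intro x hx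
    have := norm_integral_mul_le hB0.le hK hw hx (k := fun t => gauge A e t * sn E (x - t))
      (fun t ht => by
        rw [norm_mul, norm_gauge, one_mul, Complex.norm_real]
        exact (hB _ ⟨by linarith [ht.2], by linarith [ht.1, hx.2]⟩).2)
    refine le_trans (le_of_eq ?_) this
    congr 1
    exact intervalIntegral.integral_congr fun t _ => by ring
  have k2 : ∀ x ∈ Set.Icc 0 Real.pi, ‖∫ t in (0 : ℝ)..x,
      gauge A e t * (edgeAction A e f f' f'' t - E * f t) * cs E (x - t)‖ ≤ B * K * ‖w‖ := by
    intro x hx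
    have := norm_integral_mul_le hB0.le hK hw hx (k := fun t => gauge A e t * cs E (x - t))
      (fun t ht => by
        rw [norm_mul, norm_gauge, one_mul, Complex.norm_real]
        exact (hB _ ⟨by linarith [ht.2], by linarith [ht.1, hx.2]⟩).1)
    refine le_trans (le_of_eq ?_) this
    congr 1
    exact intervalIntegral.integral_congr fun t _ => by ring
  have v1 := hf.edge_value (A := A) (e := e) E hpm
  have d1 := hf.edge_quasiDeriv (A := A) (e := e) E hpm
  have b1 := k1 _ hpm
  have b2 := k2 _ hpm
  set I1 := ∫ t in (0 : ℝ)..Real.pi,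
      gauge A e t * (edgeAction A e f f' f'' t - E * f t) * sn E (Real.pi - t)
  set I2 := ∫ t in (0 : ℝ)..Real.pi,
      gauge A e t * (edgeAction A e f f' f'' t - E * f t) * cs E (Real.pi - t)
  have hg0 := gauge_ne_zero A e Real.pi
  have hsq : (cs E Real.pi : ℂ) ^ 2 + E * sn E Real.pi ^ 2 = 1 := by
    exact_mod_cast cs_sq_add E Real.pi
  have hB1 := hB _ hpm
  have hs0 : 0 ≤ √Real.pi := Real.sqrt_nonneg _
  refine ⟨⟨?_, ?_⟩, ?_, ?_⟩
  · rw [v1]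
    calc ‖_‖ = ‖I1‖ := by congr 1; ring
      _ ≤ B * K * ‖w‖ := b1
      _ ≤ M * ‖w‖ := by
        refine mul_le_mul_of_nonneg_right ?_ (norm_nonneg _)
        have : 0 ≤ 2 * B * B * K + B * (1 + √Real.pi) + B * K * √Real.pi + 100 * (1 + |E|) * K + 1 := by
          positivity
        rw [hM]; linarith
  · have e1 : sn E Real.pi * quasiDeriv A e f f' Real.pi - (cs E Real.pi * f Real.pi -
        (gauge A e Real.pi)⁻¹ * f 0) = (gauge A e Real.pi)⁻¹ * (cs E Real.pi * I1 - sn E Real.pi * I2) := by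
      field_simp
      linear_combination (sn E Real.pi : ℂ) * d1 - (cs E Real.pi : ℂ) * v1 - f 0 * hsq
    rw [e1, norm_mul, norm_inv, norm_gauge, inv_one, one_mul]
    calc _ ≤ B * (B * K * ‖w‖) + B * (B * K * ‖w‖) := by
          refine (norm_sub_le _ _).trans (add_le_add ?_ ?_) <;> rw [norm_mul, Complex.norm_real]
          · exact mul_le_mul hB1.1 b1 (norm_nonneg _) hB0.le
          · exact mul_le_mul hB1.2 b2 (norm_nonneg _) hB0.le
      _ = (2 * B * B * K) * ‖w‖ := by ring
      _ ≤ M * ‖w‖ := by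
        refine mul_le_mul_of_nonneg_right ?_ (norm_nonneg _)
        have : 0 ≤ (B * K + B) * (1 + √Real.pi) + 100 * (1 + |E|) * K + 1 := by positivity
        rw [hM]; linarith
  · set d := quasiDeriv A e f f' 0
    have hpt : ∀ᵐ x ∂edgeMeasure, ‖u x‖ ≤ (B * K + B) * (‖f 0‖ + ‖d‖ + ‖w‖) := by
      filter_upwards [hu, ae_restrict_mem measurableSet_Icc] with x hx hxm
      rw [hx]
      have e1 := hf.edge_value (A := A) (e := e) E hxm
      have : ‖f x‖ = ‖gauge A e x * f x‖ := by rw [norm_mul, norm_gauge, one_mul]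
      rw [this, e1]
      have c1 : ‖(cs E x : ℂ) * f 0‖ ≤ B * ‖f 0‖ := by
        rw [norm_mul, Complex.norm_real]; exact mul_le_mul_of_nonneg_right (hB x hxm).1 (norm_nonneg _)
      have c2 : ‖(sn E x : ℂ) * d‖ ≤ B * ‖d‖ := by
        rw [norm_mul, Complex.norm_real]; exact mul_le_mul_of_nonneg_right (hB x hxm).2 (norm_nonneg _)
      have c3 := (norm_sub_le ((cs E x : ℂ) * f 0 + sn E x * d) (∫ t in (0 : ℝ)..x,
        gauge A e t * (edgeAction A e f f' f'' t - E * f t) * sn E (x - t)))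
      have c4 := norm_add_le ((cs E x : ℂ) * f 0) (sn E x * d)
      have c5 := k1 x hxm
      have : 0 ≤ B * K * (‖f 0‖ + ‖d‖) + B * ‖w‖ := by positivity
      linarith
    have := Lp.norm_le_of_ae_bound (p := 2) (f := u) (by positivity) hpt
    refine this.trans ?_
    have h2 : (measureUnivNNReal edgeMeasure : ℝ) ^ (ENNReal.toReal 2)⁻¹ = √Real.pi := by
      rw [Real.sqrt_eq_rpow, measureUnivNNReal]
      simp only [MeasurableSet.univ, Measure.restrict_apply, Set.univ_inter, Real.volume_Icc,
        sub_zero, ENNReal.toReal_ofNat, one_div]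
      rw [ENNReal.coe_toNNReal_eq_toReal, ENNReal.toReal_ofReal hpi.le]
    rw [h2, ← mul_assoc]
    refine mul_le_mul_of_nonneg_right ?_ (by positivity)
    have : 0 ≤ 2 * B * B * K + (B * K + B) + 100 * (1 + |E|) * K + 1 := by positivity
    rw [hM]; linarith
  · -- test function `t (π - t)²`
    have l1 := (hf.gauged A e).lagrange (χ := fun t : ℝ => (t * (Real.pi - t) ^ 2 : ℂ))
      (χ' := fun t : ℝ => ((Real.pi - t) ^ 2 - 2 * t * (Real.pi - t) : ℂ))
      (χ'' := fun t : ℝ => (-4 * (Real.pi - t) + 2 * t : ℂ))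
      (fun t => by
        have h1 : HasDerivAt (fun t : ℝ => (t : ℂ)) 1 t := Complex.ofRealCLM.hasDerivAt
        have := h1.mul ((h1.const_sub (Real.pi : ℂ)).pow 2)
        refine this.congr_deriv ?_
        simp; ring)
      (fun t => by
        have h1 : HasDerivAt (fun t : ℝ => (t : ℂ)) 1 t := Complex.ofRealCLM.hasDerivAt
        have := ((h1.const_sub (Real.pi : ℂ)).pow 2).sub
          ((h1.const_mul 2).mul (h1.const_sub (Real.pi : ℂ)))
        refine this.congr_deriv ?_
        simp; ring)
      (by fun_prop) hpm
    have hiu : IntervalIntegrable (u : ℝ → ℂ) volume 0 Real.pi :=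
      (intervalIntegrable_iff_integrableOn_Icc_of_le hpi.le).2 ((Lp.memLp u).integrable (by norm_num))
    have hiw : IntervalIntegrable (w : ℝ → ℂ) volume 0 Real.pi :=
      (intervalIntegrable_iff_integrableOn_Icc_of_le hpi.le).2 ((Lp.memLp w).integrable (by norm_num))
    have hae : edgeMeasure = volume.restrict (Set.Icc 0 Real.pi) := rfl
    have hgc := continuous_gauge A e
    set k₁ : ℝ → ℂ := fun t => gauge A e t * (t * (Real.pi - t) ^ 2) with hk₁
    set k₂ : ℝ → ℂ := fun t =>
      gauge A e t * (E * (t * (Real.pi - t) ^ 2) + (-4 * (Real.pi - t) + 2 * t)) with hk₂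
    have hk₁c : Continuous k₁ := by fun_prop
    have hk₂c : Continuous k₂ := by fun_prop
    -- The test function vanishes at `0` with slope `π²` and has a double zero at `π`, so `f 0` is
    -- the only boundary term left. This bounds the vertex value without involving any derivative of
    -- `f`.
    have e1 : ∫ t in (0 : ℝ)..Real.pi, ((w : ℝ → ℂ) t * k₁ t + (u : ℝ → ℂ) t * k₂ t) =
        -(Real.pi ^ 2 * f 0) := by
      have : -(Real.pi ^ 2 * f 0 : ℂ) = -(∫ t in (0 : ℝ)..Real.pi,
          (-(gauge A e t * edgeAction A e f f' f'' t) * (t * (Real.pi - t) ^ 2) -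
            gauge A e t * f t * (-4 * (Real.pi - t) + 2 * t))) := by
        rw [l1]; simp [mul_comm]
      rw [this, ← intervalIntegral.integral_neg, intervalIntegral.integral_of_le hpi.le,
        intervalIntegral.integral_of_le hpi.le, ← integral_Icc_eq_integral_Ioc,
        ← integral_Icc_eq_integral_Ioc]
      refine integral_congr_ae ?_
      filter_upwards [hw, hu] with t h1 h2
      rw [h1, h2, hk₁, hk₂]; ring
    rw [intervalIntegral.integral_add (hiw.mul_continuousOn hk₁c.continuousOn)
      (hiu.mul_continuousOn hk₂c.continuousOn)] at e1
    have hp4 : Real.pi ≤ 4 := Real.pi_le_four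
    have q1 : ∀ t ∈ Set.Icc 0 Real.pi, ‖(t * (Real.pi - t) ^ 2 : ℂ)‖ ≤ 64 := by
      intro t ht
      have h0 : 0 ≤ Real.pi - t := by linarith [ht.2]
      rw [show (t * (Real.pi - t) ^ 2 : ℂ) = ((t * (Real.pi - t) ^ 2 : ℝ) : ℂ) by push_cast; ring,
        Complex.norm_real, Real.norm_eq_abs, abs_of_nonneg (mul_nonneg ht.1 (sq_nonneg _))]
      calc t * (Real.pi - t) ^ 2 ≤ 4 * 4 ^ 2 := by
            gcongr
            · linarith [ht.2]
            · linarith [ht.1]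
        _ = 64 := by norm_num
    have q2 : ∀ t ∈ Set.Icc 0 Real.pi, ‖(-4 * (Real.pi - t) + 2 * t : ℂ)‖ ≤ 16 := by
      intro t ht
      rw [show (-4 * (Real.pi - t) + 2 * t : ℂ) = ((-4 * (Real.pi - t) + 2 * t : ℝ) : ℂ) by
        push_cast; ring, Complex.norm_real, Real.norm_eq_abs, abs_le]
      constructor <;> linarith [ht.1, ht.2]
    have b3 := norm_integral_mul_le (M := 64) (by norm_num) hK (EventuallyEq.refl _ (w : ℝ → ℂ)) hpm
      (k := k₁) (fun t ht => by
        rw [hk₁]; simp only [norm_mul, norm_gauge, one_mul]; simpa using q1 t ht)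
    have b4 := norm_integral_mul_le (M := 64 * |E| + 16) (by positivity) hK
      (EventuallyEq.refl _ (u : ℝ → ℂ)) hpm (k := k₂) (fun t ht => by
        rw [hk₂]; simp only; rw [norm_mul, norm_gauge, one_mul]
        refine (norm_add_le _ _).trans (add_le_add ?_ (q2 t ht))
        rw [norm_mul, Complex.norm_real, mul_comm]
        exact mul_le_mul_of_nonneg_right (q1 t ht) (abs_nonneg _))
    have n1 : Real.pi ^ 2 * ‖f 0‖ ≤ 64 * K * ‖w‖ + (64 * |E| + 16) * K * ‖u‖ := by
      have := congrArg norm e1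
      rw [norm_neg, norm_mul, norm_pow, Complex.norm_real, Real.norm_eq_abs, abs_of_pos hpi] at this
      rw [← this]
      exact (norm_add_le _ _).trans (add_le_add b3 b4)
    have n2 : ‖f 0‖ ≤ Real.pi ^ 2 * ‖f 0‖ := by
      have : 1 ≤ Real.pi ^ 2 := by nlinarith [Real.pi_gt_three]
      nlinarith [norm_nonneg (f 0)]
    have hM' : 100 * (1 + |E|) * K ≤ M := by
      have : 0 ≤ 2 * B * B * K + (B * K + B) * (1 + √Real.pi) + 1 := by positivity
      rw [hM]; linarith
    calc ‖f 0‖ ≤ 100 * (1 + |E|) * K * (‖u‖ + ‖w‖) := by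
          have a1 : 0 ≤ K * ‖w‖ := by positivity
          have a2 : 0 ≤ K * ‖u‖ := by positivity
          have a3 : 0 ≤ |E| * (K * ‖w‖) := by positivity
          have a4 : 0 ≤ |E| * (K * ‖u‖) := by positivity
          nlinarith
      _ ≤ M * (‖u‖ + ‖w‖) := mul_le_mul_of_nonneg_right hM' (by positivity)


/-! ### The equation for the vertex values -/

/-- The difference operator for the vertex values. -/
def vertexDefect (α A : ℤ → ℝ) (E : ℝ) (U : ℤ → ℂ) (j : ℤ) : ℂ :=
  Real.cos (A j * Real.pi) * U (j + 1) + Real.cos (A (j - 1) * Real.pi) * U (j - 1)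
    - (2 * cs E Real.pi + α j * sn E Real.pi / 2) * U j

/-- Vertex values of an element of the domain. -/
structure IsVertexData (α A : ℤ → ℝ) (E M : ℝ) (u v : L2Chain) (U : ℤ → ℂ) : Prop where
  isLeftValue : ∀ j, IsLeftValue (u (j, true)) (U j)
  defect : ∀ j, ‖vertexDefect α A E U j‖ ≤ M * (‖(v - (E : ℂ) • u) (j, true)‖ +
    ‖(v - (E : ℂ) • u) (j, false)‖ + ‖(v - (E : ℂ) • u) (j - 1, true)‖ +
    ‖(v - (E : ℂ) • u) (j - 1, false)‖)
  norm_le : ∀ e, ‖u e‖ ≤ M * (‖U e.1‖ + ‖U (e.1 + 1)‖ + ‖(v - (E : ℂ) • u) e‖)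
  value_le : ∀ j, ‖U j‖ ≤ M * (‖u (j, true)‖ + ‖(v - (E : ℂ) • u) (j, true)‖)

/-- Multiply the jump condition by `sn E π` and replace the four quasiderivatives by means of
`EdgeBounds`; only vertex values and errors of the size of `v - E u` remain. Dividing by `sn E π ≠
0` also recovers the quasiderivatives, and with them the norm of `u` on each edge. The constant
depends on `E` alone. -/
theorem exists_vertexData {E : ℝ} (hs : sn E Real.pi ≠ 0) : ∃ M : ℝ, 0 < M ∧
    ∀ (α A : ℤ → ℝ) (u v : L2Chain), ActsTo α A u v → ∃ U : ℤ → ℂ, IsVertexData α A E M u v U := by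
  obtain ⟨M, hM0, hM⟩ := exists_edge_estimates E
  set s := sn E Real.pi
  set C := cs E Real.pi
  refine ⟨M + M * (1 + |s|⁻¹ * (1 + |C| + M)), by positivity, ?_⟩
  set N := M + M * (1 + |s|⁻¹ * (1 + |C| + M)) with hN
  have hMN : M ≤ N := by
    have : 0 ≤ M * (1 + |s|⁻¹ * (1 + |C| + M)) := by positivity
    rw [hN]; linarith
  rintro α A u v ⟨f, f', f'', h1, h2, h3, h4⟩
  have key := fun e => hM A e (f e) (f' e) (f'' e) (u e) (v e) (h1 e) (h2 e) (h3 e)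
  refine ⟨fun j => f (j, true) 0, fun j => ⟨_, (h1 _).continuousOn, h2 _, rfl⟩, fun j => ?_,
    fun e => ?_, fun j => ?_⟩
  · have hl := (h4 j).lower_right
    have hj := (h4 j).jump
    have hr1 := (h4 (j + 1)).upper_left
    have hr2 := (h4 (j + 1)).lower_left
    have hp1 := (h4 j).upper_left
    have hp2 := (h4 j).lower_left
    have hp3 := (h4 (j - 1)).lower_right
    rw [add_sub_cancel_right] at hr1 hr2
    have a1 := (key (j, true)).1.right
    have a2 := (key (j, false)).1.right
    have a3 := (key (j - 1, true)).1.left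
    have a4 := (key (j - 1, false)).1.left
    rw [gauge_false] at a2
    rw [gauge_false, inv_inv] at a4
    have g1 := gauge_true_add_gauge_false A j Real.pi
    have g2 := gauge_true_add_gauge_false A (j - 1) Real.pi
    rw [gauge_false] at g1 g2
    rw [hr1] at a1
    rw [hr2, hl] at a2
    rw [hp1] at a3
    rw [hp2, hp3] at a4
    simp only [vertexDefect]
    have e1 : ∀ r1 r2 r3 r4 : ℂ, ‖r1 + r2 - r3 - r4‖ ≤ ‖r1‖ + ‖r2‖ + ‖r3‖ + ‖r4‖ := by
      intro r1 r2 r3 r4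
      have := norm_sub_le (r1 + r2 - r3) r4
      have := norm_sub_le (r1 + r2) r3
      have := norm_add_le r1 r2
      linarith
    have e2 := (e1 _ _ _ _).trans (add_le_add (add_le_add (add_le_add a1 a2) a3) a4)
    -- The sum of the four edge errors is `-2` times the vertex defect.
    have e3 : ∀ z w : ℂ, z = -(2 * w) → ‖w‖ ≤ ‖z‖ := by
      intro z w h
      rw [h, norm_neg, norm_mul]; norm_num; linarith [norm_nonneg w]
    refine (e3 _ _ ?_).trans (e2.trans ?_)
    · linear_combination (s : ℂ) * hj - f (j + 1, true) 0 * g1 - f (j - 1, true) 0 * g2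
    · rw [← mul_add, ← mul_add, ← mul_add]
      exact mul_le_mul_of_nonneg_right hMN (by positivity)
  · have hd : ‖quasiDeriv A e (f e) (f' e) 0‖ ≤ |s|⁻¹ * (‖f e Real.pi‖ + |C| * ‖f e 0‖ +
        M * ‖v e - (E : ℂ) • u e‖) := by
      rw [inv_mul_eq_div, le_div_iff₀ (abs_pos.2 hs)]
      have a1 := (key e).1.right
      set d := quasiDeriv A e (f e) (f' e) 0
      have : ‖d‖ * |s| = ‖(s : ℂ) * d‖ := by rw [norm_mul, Complex.norm_real, mul_comm]; rfl
      rw [this]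
      have n1 := norm_sub_norm_le ((s : ℂ) * d)
        (gauge A e Real.pi * f e Real.pi - C * f e 0)
      have n2 := norm_sub_le (gauge A e Real.pi * f e Real.pi) (C * f e 0)
      rw [norm_mul, norm_gauge, one_mul, norm_mul, Complex.norm_real, Real.norm_eq_abs] at n2
      linarith
    have hv1 : f e 0 = f (e.1, true) 0 := by
      obtain ⟨j, b⟩ := e
      cases b
      · exact (h4 j).lower_right
      · rfl
    have hv2 : f e Real.pi = f (e.1 + 1, true) 0 := by
      obtain ⟨j, b⟩ := e
      cases b
      · simpa using (h4 (j + 1)).lower_left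
      · simpa using (h4 (j + 1)).upper_left
    rw [hv1, hv2] at hd
    have := (key e).2.1
    rw [hv1] at this
    refine this.trans ?_
    set a := ‖f (e.1, true) 0‖
    set b := ‖f (e.1 + 1, true) 0‖
    have hw : ‖(v - (E : ℂ) • u) e‖ = ‖v e - (E : ℂ) • u e‖ := rfl
    rw [hw]
    set w := ‖v e - (E : ℂ) • u e‖
    have ha : 0 ≤ a := norm_nonneg _
    have hb : 0 ≤ b := norm_nonneg _
    have hw0 : 0 ≤ w := norm_nonneg _
    calc M * (a + ‖quasiDeriv A e (f e) (f' e) 0‖ + w)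
        ≤ M * (a + |s|⁻¹ * (b + |C| * a + M * w) + w) := by gcongr
      _ ≤ M * ((1 + |s|⁻¹ * (1 + |C| + M)) * (a + b + w)) := by
          refine mul_le_mul_of_nonneg_left ?_ hM0.le
          have p : 0 ≤ |s|⁻¹ := by positivity
          have : b + |C| * a + M * w ≤ (1 + |C| + M) * (a + b + w) := by
            have h1 : 0 ≤ |C| * (b + w) := by positivity
            have h2 : 0 ≤ M * (a + b) := by positivity
            linarith
          have := mul_le_mul_of_nonneg_left this p
          linarith
      _ ≤ N * (a + b + w) := by
          rw [← mul_assoc]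
          refine mul_le_mul_of_nonneg_right ?_ (by positivity)
          rw [hN]; linarith
  · exact (key (j, true)).2.2.trans (mul_le_mul_of_nonneg_right hMN (by positivity))

end

section


/-! ### The operator and its graph -/

theorem actsTo_domain {α A : ℤ → ℝ} (x : (hamiltonian α A).domain) :
    ActsTo α A x (hamiltonian α A x) := by
  have := (hamiltonian α A).mem_graph x
  rw [graph_hamiltonian] at this
  exact this

theorem ActsTo.exists_domain {α A : ℤ → ℝ} {u v : L2Chain} (h : ActsTo α A u v) :
    ∃ x : (hamiltonian α A).domain, (x : L2Chain) = u ∧ hamiltonian α A x = v := by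
  have : (u, v) ∈ (hamiltonian α A).graph := by
    rw [graph_hamiltonian]; exact h
  exact (LinearPMap.mem_graph_iff _).1 this

theorem ActsTo.sub {α A : ℤ → ℝ} {u v u' v' : L2Chain} (h : ActsTo α A u v) (h' : ActsTo α A u' v') :
    ActsTo α A (u - u') (v - v') :=
  (hamiltonianGraph α A).sub_mem (x := (u, v)) (y := (u', v')) h h'

theorem ActsTo.smul {α A : ℤ → ℝ} {u v : L2Chain} (c : ℂ) (h : ActsTo α A u v) :
    ActsTo α A (c • u) (c • v) :=
  (hamiltonianGraph α A).smul_mem c (x := (u, v)) h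

theorem mem_eigenspace_iff {α A : ℤ → ℝ} {E : ℝ} {x : (hamiltonian α A).domain} :
    x ∈ eigenspace (hamiltonian α A) E ↔ hamiltonian α A x = (E : ℂ) • (x : L2Chain) := by
  simp only [eigenspace, LinearMap.mem_ker, LinearMap.sub_apply, LinearMap.smul_apply,
    Submodule.subtype_apply, sub_eq_zero]
  rfl

theorem hasEigenvalue_iff {α A : ℤ → ℝ} {E : ℝ} :
    HasEigenvalue (hamiltonian α A) E ↔ ∃ u ≠ 0, ActsTo α A u ((E : ℂ) • u) := by
  unfold HasEigenvalue
  rw [Submodule.ne_bot_iff]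
  constructor
  · rintro ⟨x, hx, hx0⟩
    refine ⟨x, fun h => hx0 (Subtype.ext h), ?_⟩
    rw [← mem_eigenspace_iff.1 hx]
    exact actsTo_domain x
  · rintro ⟨u, hu, h⟩
    obtain ⟨x, rfl, hx⟩ := h.exists_domain
    exact ⟨x, mem_eigenspace_iff.2 hx, fun h => hu (by rw [h]; rfl)⟩

theorem hasSimpleEigenvalue_of {α A : ℤ → ℝ} {E : ℝ} {u : L2Chain} (hu : u ≠ 0)
    (h : ActsTo α A u ((E : ℂ) • u))
    (huniq : ∀ w, ActsTo α A w ((E : ℂ) • w) → ∃ c : ℂ, w = c • u) :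
    HasSimpleEigenvalue (hamiltonian α A) E := by
  obtain ⟨x, rfl, hx⟩ := h.exists_domain
  refine finrank_eq_one (⟨x, mem_eigenspace_iff.2 hx⟩ : eigenspace (hamiltonian α A) E) ?_ ?_
  · intro h0
    apply hu
    have := congrArg (fun y : eigenspace (hamiltonian α A) E => ((y : (hamiltonian α A).domain) : L2Chain)) h0
    simpa using this
  · rintro ⟨w, hw⟩
    obtain ⟨c, hc⟩ := huniq w (by rw [← mem_eigenspace_iff.1 hw]; exact actsTo_domain w)
    exact ⟨c, Subtype.ext (Subtype.ext hc.symm)⟩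

/-! ### Explicit functions -/

theorem norm_sq_summable (u : L2Chain) : Summable fun e => ‖u e‖ ^ 2 := by
  have := (lp.memℓp u).summable (by norm_num)
  simpa using this

theorem norm_sq_eq_tsum (u : L2Chain) : ‖u‖ ^ 2 = ∑' e, ‖u e‖ ^ 2 := by
  have := lp.norm_rpow_eq_tsum (p := 2) (by norm_num) u
  simpa using this

/-- The factor `2` is a convenient bound for `√π`. -/
theorem norm_toLp_le {f : ℝ → ℂ} (hf : MemLp f 2 edgeMeasure) {a : ℝ} (ha : 0 ≤ a)
    (h : ∀ x ∈ Set.Icc 0 Real.pi, ‖f x‖ ≤ a) : ‖hf.toLp f‖ ≤ 2 * a := by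
  have h1 : ∀ᵐ x ∂edgeMeasure, ‖hf.toLp f x‖ ≤ a := by
    filter_upwards [hf.coeFn_toLp, ae_restrict_mem measurableSet_Icc] with x h1 h2
    rw [h1]; exact h x h2
  refine (Lp.norm_le_of_ae_bound ha h1).trans (mul_le_mul_of_nonneg_right ?_ ha)
  rw [measureUnivNNReal]
  simp only [MeasurableSet.univ, Measure.restrict_apply, Set.univ_inter, Real.volume_Icc,
    sub_zero, ENNReal.toReal_ofNat]
  rw [ENNReal.coe_toNNReal_eq_toReal, ENNReal.toReal_ofReal Real.pi_pos.le, ← one_div,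
    ← Real.sqrt_eq_rpow, Real.sqrt_le_left (by norm_num)]
  linarith [Real.pi_le_four]

theorem exists_L2Chain {f : Edge → ℝ → ℂ} (hf : ∀ e, ContinuousOn (f e) (Set.Icc 0 Real.pi))
    {a : Edge → ℝ} (ha : ∀ e, 0 ≤ a e) (hfa : ∀ e, ∀ x ∈ Set.Icc 0 Real.pi, ‖f e x‖ ≤ a e)
    (hs : Summable fun e => a e ^ 2) :
    ∃ u : L2Chain, (∀ e, u e =ᵐ[edgeMeasure] f e) ∧ ∀ e, ‖u e‖ ≤ 2 * a e := by
  have hn : ∀ e, ‖(memLp_edge (hf e)).toLp (f e)‖ ≤ 2 * a e := fun e =>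
    norm_toLp_le _ (ha e) (hfa e)
  have hm : Memℓp (fun e => (memLp_edge (hf e)).toLp (f e)) 2 := by
    refine memℓp_gen ?_
    simp only [ENNReal.toReal_ofNat, Real.rpow_ofNat]
    refine Summable.of_nonneg_of_le (fun e => by positivity) (fun e => ?_) (hs.mul_left 4)
    calc _ ≤ (2 * a e) ^ 2 := by gcongr; exact hn e
      _ = 4 * a e ^ 2 := by ring
  exact ⟨⟨_, hm⟩, fun e => (memLp_edge (hf e)).coeFn_toLp, hn⟩

theorem summable_edge {g : ℤ → ℝ} (hg0 : ∀ j, 0 ≤ g j) (hg : Summable g) :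
    Summable fun e : Edge => g e.1 := by
  refine (summable_prod_of_nonneg fun e => hg0 e.1).2 ⟨fun j => (hasSum_fintype _).summable, ?_⟩
  simpa using hg.mul_left 2

/-- The quasiderivative of the solution `edgeSol`. -/
def edgeSolQuasi (A : ℤ → ℝ) (e : Edge) (E : ℝ) (p d : ℂ) (x : ℝ) : ℂ :=
  (gauge A e x)⁻¹ * (-E * sn E x * p + cs E x * d)

/-- The solution of `-𝒟² f = E f` on an edge with `f 0 = p` and `𝒟 f 0 = d`. -/
def edgeSol (A : ℤ → ℝ) (e : Edge) (E : ℝ) (p d : ℂ) (x : ℝ) : ℂ :=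
  (gauge A e x)⁻¹ * (cs E x * p + sn E x * d)

variable {A : ℤ → ℝ} {e : Edge} {E : ℝ} {p d : ℂ}

theorem hasDerivAt_gauge_inv (x : ℝ) : HasDerivAt (fun x => (gauge A e x)⁻¹)
    (-(Complex.I * potential A e) * (gauge A e x)⁻¹) x := by
  refine ((hasDerivAt_gauge A e x).fun_inv (gauge_ne_zero A e x)).congr_deriv ?_
  have := gauge_ne_zero A e x
  field_simp

theorem hasDerivAt_edgeSol (x : ℝ) : HasDerivAt (edgeSol A e E p d)
    (edgeSolQuasi A e E p d x - Complex.I * potential A e * edgeSol A e E p d x) x := by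
  have := (hasDerivAt_gauge_inv (A := A) (e := e) x).mul
    (((hasDerivAt_cs E x).ofReal_comp.mul_const p).add ((hasDerivAt_sn E x).ofReal_comp.mul_const d))
  refine this.congr_deriv ?_
  simp only [edgeSolQuasi, edgeSol, Pi.add_apply]; push_cast; ring

theorem hasDerivAt_edgeSolQuasi (x : ℝ) : HasDerivAt (edgeSolQuasi A e E p d)
    (-E * edgeSol A e E p d x - Complex.I * potential A e * edgeSolQuasi A e E p d x) x := by
  have := (hasDerivAt_gauge_inv (A := A) (e := e) x).mul
    (((((hasDerivAt_sn E x).ofReal_comp).const_mul (-E : ℂ)).mul_const p).add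
      ((hasDerivAt_cs E x).ofReal_comp.mul_const d))
  refine this.congr_deriv ?_
  simp only [edgeSolQuasi, edgeSol, Pi.add_apply]; push_cast; ring

theorem continuous_edgeSol : Continuous (edgeSol A e E p d) :=
  continuous_iff_continuousAt.2 fun x => (hasDerivAt_edgeSol x).continuousAt

theorem continuous_edgeSolQuasi : Continuous (edgeSolQuasi A e E p d) :=
  continuous_iff_continuousAt.2 fun x => (hasDerivAt_edgeSolQuasi x).continuousAt

@[simp] theorem edgeSol_zero : edgeSol A e E p d 0 = p := by simp [edgeSol]

@[simp] theorem edgeSolQuasi_zero : edgeSolQuasi A e E p d 0 = d := by simp [edgeSolQuasi]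

/-- A solution on an edge times a smooth function: the derivative. -/
def cutDeriv (A : ℤ → ℝ) (e : Edge) (E : ℝ) (p d : ℂ) (χ χ' : ℝ → ℂ) (x : ℝ) : ℂ :=
  χ' x * edgeSol A e E p d x + χ x * (edgeSolQuasi A e E p d x -
    Complex.I * potential A e * edgeSol A e E p d x)

/-- A solution on an edge times a smooth function: the second derivative. -/
def cutDeriv2 (A : ℤ → ℝ) (e : Edge) (E : ℝ) (p d : ℂ) (χ χ' χ'' : ℝ → ℂ) (x : ℝ) : ℂ :=
  χ'' x * edgeSol A e E p d x + 2 * χ' x * (edgeSolQuasi A e E p d x -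
    Complex.I * potential A e * edgeSol A e E p d x) + χ x * (-E * edgeSol A e E p d x -
    2 * Complex.I * potential A e * edgeSolQuasi A e E p d x
     - potential A e ^ 2 * edgeSol A e E p d x)

section cut

variable {χ χ' χ'' : ℝ → ℂ}

/-- Used with `χ = 1` for eigenfunctions and with a ramp for Weyl sequences. -/
theorem isH2_cut (hχ : ∀ x, HasDerivAt χ (χ' x) x) (hχ' : ∀ x, HasDerivAt χ' (χ'' x) x)
    (hc : Continuous χ'') : IsH2 (fun x => χ x * edgeSol A e E p d x) (cutDeriv A e E p d χ χ')
      (cutDeriv2 A e E p d χ χ' χ'') := by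
  have c0 : Continuous χ := continuous_iff_continuousAt.2 fun x => (hχ x).continuousAt
  have c1 : Continuous χ' := continuous_iff_continuousAt.2 fun x => (hχ' x).continuousAt
  have s0 := continuous_edgeSol (A := A) (e := e) (E := E) (p := p) (d := d)
  have s1 := continuous_edgeSolQuasi (A := A) (e := e) (E := E) (p := p) (d := d)
  refine IsH2.of_hasDerivAt (fun x => (hχ x).mul (hasDerivAt_edgeSol x)) (fun x => ?_) ?_
  · have := ((hχ' x).mul (hasDerivAt_edgeSol (A := A) (e := e) (E := E) (p := p) (d := d) x)).add
      ((hχ x).mul ((hasDerivAt_edgeSolQuasi (A := A) (e := e) (E := E) (p := p) (d := d) x).sub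
        ((hasDerivAt_edgeSol (A := A) (e := e) (E := E) (p := p) (d := d) x).const_mul
          (Complex.I * potential A e))))
    refine this.congr_deriv ?_
    simp only [cutDeriv2, Pi.sub_apply]
    linear_combination χ x * edgeSol A e E p d x * potential A e ^ 2 * Complex.I_sq
  · unfold cutDeriv2; fun_prop

/-- The error is the commutator with the cutoff, hence vanishes wherever the cutoff is locally
constant. -/
theorem edgeAction_cut (x : ℝ) : edgeAction A e (fun x => χ x * edgeSol A e E p d x)
    (cutDeriv A e E p d χ χ') (cutDeriv2 A e E p d χ χ' χ'') x =
      E * (χ x * edgeSol A e E p d x) - (2 * χ' x * edgeSolQuasi A e E p d x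
        + χ'' x * edgeSol A e E p d x) := by
  simp only [edgeAction, cutDeriv, cutDeriv2]
  linear_combination 2 * χ x * edgeSol A e E p d x * potential A e ^ 2 * Complex.I_sq

theorem quasiDeriv_cut (x : ℝ) : quasiDeriv A e (fun x => χ x * edgeSol A e E p d x)
    (cutDeriv A e E p d χ χ') x =
      χ x * edgeSolQuasi A e E p d x + χ' x * edgeSol A e E p d x := by
  simp only [quasiDeriv, cutDeriv]; ring

end cut

/-! ### Eigenfunctions and the equation for the vertex values -/

/-- For an eigenfunction `v - E u = 0`, so each estimate of `IsVertexData` loses its error term and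
the recursion holds exactly. -/
theorem ActsTo.vertexData_of_eigen {α A : ℤ → ℝ} {E : ℝ} (hs : sn E Real.pi ≠ 0) {u : L2Chain}
    (h : ActsTo α A u ((E : ℂ) • u)) : ∃ U : ℤ → ℂ, (∀ j, IsLeftValue (u (j, true)) (U j)) ∧
      (Summable fun j => ‖U j‖ ^ 2) ∧ (∀ j, vertexDefect α A E U j = 0) ∧ (U = 0 → u = 0) := by
  obtain ⟨M, hM0, hM⟩ := exists_vertexData hs
  obtain ⟨U, hU⟩ := hM α A u _ h
  have hz : ∀ e, ‖((E : ℂ) • u - (E : ℂ) • u : L2Chain) e‖ = 0 := by simp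
  refine ⟨U, hU.isLeftValue, ?_, fun j => ?_, fun h0 => ?_⟩
  · have h1 : Summable fun j : ℤ => ‖u (j, true)‖ ^ 2 :=
      (norm_sq_summable u).comp_injective (i := fun j : ℤ => ((j, true) : Edge))
        (fun a b hab => (Prod.ext_iff.1 hab).1)
    refine Summable.of_nonneg_of_le (fun j => by positivity) (fun j => ?_) (h1.mul_left (M ^ 2))
    have := hU.value_le j
    rw [hz, add_zero] at this
    rw [← mul_pow]
    gcongr
  · have := hU.defect j
    simp only [hz, add_zero, mul_zero] at this
    exact norm_le_zero_iff.1 this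
  · ext1
    funext e
    have := hU.norm_le e
    rw [hz, h0] at this
    simpa using this

/-- The vertex values determine the solution on each edge because `sn E π ≠ 0`, and the recursion is
the jump condition multiplied by `sn E π / 2`, up to sign. -/
theorem exists_eigenfunction {α A : ℤ → ℝ} {E : ℝ} (hs : sn E Real.pi ≠ 0) {U : ℤ → ℂ}
    (hU : Summable fun j => ‖U j‖ ^ 2) (h : ∀ j, vertexDefect α A E U j = 0) :
    ∃ u : L2Chain, ActsTo α A u ((E : ℂ) • u) ∧ ∀ j, IsLeftValue (u (j, true)) (U j) := by
  set s := sn E Real.pi with hsdef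
  set C := cs E Real.pi with hCdef
  obtain ⟨B, hB0, hB⟩ := exists_fundamental_bound E
  -- The initial quasiderivative that makes the solution starting at `U j` arrive at `U (j + 1)`.
  let d : Edge → ℂ := fun e => (gauge A e Real.pi * U (e.1 + 1) - C * U e.1) / s
  have hs' : (s : ℂ) ≠ 0 := by exact_mod_cast hs
  let f : Edge → ℝ → ℂ := fun e x => 1 * edgeSol A e E (U e.1) (d e) x
  have hf : ∀ e, IsH2 (f e) (cutDeriv A e E (U e.1) (d e) 1 0)
      (cutDeriv2 A e E (U e.1) (d e) 1 0 0) := fun e =>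
    isH2_cut (fun x => hasDerivAt_const x (1 : ℂ)) (fun x => hasDerivAt_const x (0 : ℂ))
      continuous_const
  have hfπ : ∀ e, f e Real.pi = U (e.1 + 1) := by
    intro e
    have := gauge_ne_zero A e Real.pi
    simp only [f, d, edgeSol, ← hsdef, ← hCdef, one_mul]
    field_simp
    ring
  have hf0 : ∀ e, f e 0 = U e.1 := by intro e; simp [f]
  let a : Edge → ℝ := fun e => B * (‖U e.1‖ + ‖d e‖)
  have ha : ∀ e, 0 ≤ a e := fun e => by positivity
  have hfa : ∀ e, ∀ x ∈ Set.Icc 0 Real.pi, ‖f e x‖ ≤ a e := by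
    intro e x hx
    simp only [f, edgeSol, one_mul]
    rw [norm_mul, norm_inv, norm_gauge, inv_one, one_mul]
    refine (norm_add_le _ _).trans ?_
    rw [norm_mul, norm_mul, Complex.norm_real, Complex.norm_real]
    simp only [a, mul_add]
    exact add_le_add (mul_le_mul_of_nonneg_right (hB x hx).1 (norm_nonneg _))
      (mul_le_mul_of_nonneg_right (hB x hx).2 (norm_nonneg _))
  have hsum : Summable fun e => a e ^ 2 := by
    have hU1 : Summable fun j : ℤ => ‖U (j + 1)‖ ^ 2 :=
      hU.comp_injective (i := fun j : ℤ => j + 1) (add_left_injective 1)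
    -- The initial data of an edge are controlled by its two end values, so square-summability
    -- passes from the vertices to the edges.
    have hb : ∀ e : Edge, a e ^ 2 ≤ (2 * B ^ 2 * (1 + 2 * (C / s) ^ 2)) * ‖U e.1‖ ^ 2 +
        (4 * B ^ 2 * (1 / s) ^ 2) * ‖U (e.1 + 1)‖ ^ 2 := by
      intro e
      have hd : ‖d e‖ ≤ |1 / s| * ‖U (e.1 + 1)‖ + |C / s| * ‖U e.1‖ := by
        simp only [d]
        rw [sub_div]
        refine (norm_sub_le _ _).trans (le_of_eq ?_)
        simp only [norm_div, norm_mul, norm_gauge, Complex.norm_real, Real.norm_eq_abs, abs_div,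
          abs_one]
        ring
      have h2 : ‖d e‖ ^ 2 ≤ 2 * (1 / s) ^ 2 * ‖U (e.1 + 1)‖ ^ 2 + 2 * (C / s) ^ 2 * ‖U e.1‖ ^ 2 := by
        have := pow_le_pow_left₀ (norm_nonneg _) hd 2
        have e1 := sq_abs (1 / s)
        have e2 := sq_abs (C / s)
        rw [← e1, ← e2]
        nlinarith [sq_nonneg (|1 / s| * ‖U (e.1 + 1)‖ - |C / s| * ‖U e.1‖)]
      simp only [a]
      have h3 : (‖U e.1‖ + ‖d e‖) ^ 2 ≤ 2 * ‖U e.1‖ ^ 2 + 2 * ‖d e‖ ^ 2 := by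
        nlinarith [sq_nonneg (‖U e.1‖ - ‖d e‖)]
      rw [mul_pow]
      have := mul_le_mul_of_nonneg_left (h3.trans (add_le_add le_rfl
        (mul_le_mul_of_nonneg_left h2 (by norm_num : (0:ℝ) ≤ 2)))) (sq_nonneg B)
      linarith
    refine Summable.of_nonneg_of_le (fun e => by positivity) hb ?_
    exact ((summable_edge (fun j => by positivity) hU).mul_left _).add
      ((summable_edge (fun j => by positivity) hU1).mul_left _)
  obtain ⟨u, hu, -⟩ := exists_L2Chain (fun e => (hf e).continuousOn) ha hfa hsum
  refine ⟨u, ⟨f, fun e => cutDeriv A e E (U e.1) (d e) 1 0, fun e => cutDeriv2 A e E (U e.1) (d e) 1 0 0,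
    hf, hu, fun e => ?_, fun j => ?_⟩, fun j => ⟨f (j, true), (hf _).continuousOn, hu _, hf0 _⟩⟩
  · have h1 : ((E : ℂ) • u : L2Chain) e = (E : ℂ) • u e := rfl
    rw [h1]
    filter_upwards [Lp.coeFn_smul (E : ℂ) (u e), hu e] with x h2 h3
    rw [h2, Pi.smul_apply, h3, smul_eq_mul]
    have := edgeAction_cut (A := A) (e := e) (E := E) (p := U e.1) (d := d e) (χ := 1) (χ' := 0)
      (χ'' := 0) x
    simp only [Pi.zero_apply, Pi.one_apply, mul_zero, zero_mul, add_zero, sub_zero] at this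
    exact this.symm
  · refine ⟨by rw [hf0, hf0], by rw [hf0, hfπ]; simp, by rw [hf0, hfπ]; simp, ?_⟩
    have q0 : ∀ e, quasiDeriv A e (f e) (cutDeriv A e E (U e.1) (d e) 1 0) 0 = d e := by
      intro e
      refine (quasiDeriv_cut (χ := 1) 0).trans ?_
      simp
    have qπ : ∀ e, quasiDeriv A e (f e) (cutDeriv A e E (U e.1) (d e) 1 0) Real.pi =
        (C * U (e.1 + 1) - (gauge A e Real.pi)⁻¹ * U e.1) / s := by
      intro e
      refine (quasiDeriv_cut (χ := 1) Real.pi).trans ?_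
      have hg := gauge_ne_zero A e Real.pi
      have hsq : (C : ℂ) ^ 2 + E * s ^ 2 = 1 := by exact_mod_cast cs_sq_add E Real.pi
      simp only [edgeSolQuasi, d, Pi.one_apply, Pi.zero_apply, ← hsdef, ← hCdef]
      field_simp
      linear_combination (-U e.1) * hsq
    rw [q0, q0, qπ, qπ, hf0]
    have g1 := gauge_true_add_gauge_false A j Real.pi
    have g2 := gauge_true_add_gauge_false A (j - 1) Real.pi
    have hj := h j
    simp only [vertexDefect, ← hsdef, ← hCdef] at hj
    simp only [d, gauge_false, sub_add_cancel, inv_inv] at g1 g2 ⊢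
    rw [← add_div, ← sub_div, ← sub_div, div_eq_iff hs']
    linear_combination U (j + 1) * g1 + U (j - 1) * g2 + 2 * hj

end

section


/-! ### Square-summable solutions of the difference equation -/

/-- A decaying solution of a three-term recursion on a half-line is geometric. -/
theorem halfline_geometric {c μ : ℂ} (hμ : μ ≠ 0) (hc : ‖c‖ ≤ ‖μ‖) {U : ℕ → ℂ}
    (hU : Tendsto U atTop (𝓝 0))
    (h : ∀ n, c * (U (n + 2) + U n) = (μ + c ^ 2 / μ) * U (n + 1)) (n : ℕ) :
    μ * U (n + 1) = c * U n := by
  -- `W` annihilates the solution with ratio `c / μ`. It satisfies `c W (n + 1) = μ W n`, so its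
  -- modulus never decreases when `‖c‖ ≤ ‖μ‖`; yet it tends to zero. The case `c = 0` needs no
  -- separate treatment.
  set W : ℕ → ℂ := fun n => μ * U (n + 1) - c * U n with hW
  have hstep : ∀ n, c * W (n + 1) = μ * W n := by
    intro n
    have := h n
    field_simp at this
    simp only [hW]
    rw [show n + 1 + 1 = n + 2 from rfl]
    linear_combination this
  have hmono : ∀ n, ‖W n‖ ≤ ‖W (n + 1)‖ := by
    intro n
    have h1 : ‖c‖ * ‖W (n + 1)‖ = ‖μ‖ * ‖W n‖ := by rw [← norm_mul, ← norm_mul, hstep]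
    have h2 : ‖μ‖ * ‖W n‖ ≤ ‖μ‖ * ‖W (n + 1)‖ := by
      rw [← h1]; exact mul_le_mul_of_nonneg_right hc (norm_nonneg _)
    exact le_of_mul_le_mul_left h2 (norm_pos_iff.2 hμ)
  have hlim : Tendsto (fun n => ‖W n‖) atTop (𝓝 0) := by
    have h1 := ((hU.comp (tendsto_add_atTop_nat 1)).const_mul μ).sub (hU.const_mul c)
    simpa using h1.norm
  have h0 : ‖W n‖ ≤ 0 := ge_of_tendsto hlim (by
    filter_upwards [eventually_ge_atTop n] with m hm
    exact monotone_nat_of_le_succ hmono hm)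
  have := norm_le_zero_iff.1 h0
  simpa [hW, sub_eq_zero] using this

theorem tendsto_zero_right {U : ℤ → ℂ} (hU : Summable fun j => ‖U j‖ ^ 2) (a : ℤ) :
    Tendsto (fun n : ℕ => U (a + n)) atTop (𝓝 0) := by
  have h1 : Summable fun n : ℕ => ‖U (a + n)‖ ^ 2 :=
    hU.comp_injective (i := fun n : ℕ => a + (n : ℤ)) (fun m n h => by simpa using h)
  have h2 := h1.tendsto_atTop_zero.sqrt
  simp only [Real.sqrt_sq (norm_nonneg _), Real.sqrt_zero] at h2
  exact tendsto_zero_iff_norm_tendsto_zero.2 h2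

theorem tendsto_zero_left {U : ℤ → ℂ} (hU : Summable fun j => ‖U j‖ ^ 2) (a : ℤ) :
    Tendsto (fun n : ℕ => U (a - n)) atTop (𝓝 0) := by
  have h1 : Summable fun n : ℕ => ‖U (a - n)‖ ^ 2 :=
    hU.comp_injective (i := fun n : ℕ => a - (n : ℤ)) (fun m n h => by simpa using h)
  have h2 := h1.tendsto_atTop_zero.sqrt
  simp only [Real.sqrt_sq (norm_nonneg _), Real.sqrt_zero] at h2
  exact tendsto_zero_iff_norm_tendsto_zero.2 h2

/-- The recursion for the vertex values of the perturbed chain; `c`, `c₁` are the weights of the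
unperturbed and the perturbed ring, `η` and `η + b` belong to the vertices. -/
structure PerturbedRecursion (c c₁ η b : ℂ) (U : ℤ → ℂ) : Prop where
  right : ∀ j : ℤ, 3 ≤ j → c * U (j + 1) + c * U (j - 1) = 2 * η * U j
  left : ∀ j : ℤ, j ≤ 0 → c * U (j + 1) + c * U (j - 1) = 2 * η * U j
  one : c₁ * U 2 + c * U 0 = (2 * η + b) * U 1
  two : c * U 3 + c₁ * U 1 = 2 * η * U 2

namespace PerturbedRecursion

variable {c c₁ η b μ : ℂ} {U : ℤ → ℂ}

/-- The perturbed ring joins the vertices 1 and 2, so the half-line argument applies to the right of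
2 and to the left of 1. -/
theorem geometric (h : PerturbedRecursion c c₁ η b U) (hμ : μ ≠ 0) (hc : ‖c‖ ≤ ‖μ‖)
    (hη : μ + c ^ 2 / μ = 2 * η) (hU : Summable fun j => ‖U j‖ ^ 2) :
    (∀ n : ℕ, μ * U (2 + (n + 1)) = c * U (2 + n)) ∧
    ∀ n : ℕ, μ * U (1 - (n + 1)) = c * U (1 - n) := by
  constructor
  · intro n
    have := halfline_geometric hμ hc (tendsto_zero_right hU 2) (fun n => by
      have := h.right (2 + (n + 1 : ℕ)) (by push_cast; omega)
      rw [hη, ← this]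
      push_cast
      rw [show (2 + ((n : ℤ) + 1) + 1) = 2 + (n + 2) by ring,
        show (2 + ((n : ℤ) + 1) - 1) = 2 + n by ring]
      ring) n
    exact_mod_cast this
  · intro n
    have := halfline_geometric hμ hc (tendsto_zero_left hU 1) (fun n => by
      have := h.left (1 - (n + 1 : ℕ)) (by push_cast; omega)
      rw [hη, ← this]
      push_cast
      rw [show (1 - ((n : ℤ) + 1) + 1) = 1 - n by ring,
        show (1 - ((n : ℤ) + 1) - 1) = 1 - (n + 2) by ring]
      ring) n
    exact_mod_cast this

theorem eq_zero_of (hr : ∀ n : ℕ, μ * U (2 + (n + 1)) = c * U (2 + n))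
    (hl : ∀ n : ℕ, μ * U (1 - (n + 1)) = c * U (1 - n)) (hμ : μ ≠ 0) (h1 : U 1 = 0) (h2 : U 2 = 0) :
    U = 0 := by
  have hr' : ∀ n : ℕ, U (2 + n) = 0 := by
    intro n
    induction n with
    | zero => simpa using h2
    | succ n ih =>
      have := hr n
      rw [ih, mul_zero, mul_eq_zero] at this
      push_cast
      exact this.resolve_left hμ
  have hl' : ∀ n : ℕ, U (1 - n) = 0 := by
    intro n
    induction n with
    | zero => simpa using h1
    | succ n ih =>
      have := hl n
      rw [ih, mul_zero, mul_eq_zero] at this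
      push_cast
      exact this.resolve_left hμ
  funext j
  rcases le_or_gt j 1 with hj | hj
  · obtain ⟨n, hn⟩ := Int.eq_ofNat_of_zero_le (show 0 ≤ 1 - j by omega)
    have := hl' n
    rwa [show (1 : ℤ) - n = j by omega] at this
  · obtain ⟨n, hn⟩ := Int.eq_ofNat_of_zero_le (show 0 ≤ j - 2 by omega)
    have := hr' n
    rwa [show (2 : ℤ) + n = j by omega] at this

/-- Decay expresses `U 3` and `U 0` through `U 2` and `U 1`; the equations at the two defect
vertices become a homogeneous two-by-two system, whose determinant gives the eigenvalue condition.
-/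
theorem two_eq (h : PerturbedRecursion c c₁ η b U) (hμ : μ ≠ 0) (hc : ‖c‖ ≤ ‖μ‖)
    (hη : μ + c ^ 2 / μ = 2 * η) (hU : Summable fun j => ‖U j‖ ^ 2) :
    c₁ * U 1 = μ * U 2 ∧ c₁ * U 2 = (μ + b) * U 1 := by
  obtain ⟨hr, hl⟩ := h.geometric hμ hc hη hU
  have r := hr 0
  have l := hl 0
  have h1 := h.one
  have h2 := h.two
  norm_num at r l
  rw [← hη] at h1 h2
  field_simp at h1 h2
  constructor
  · apply mul_left_cancel₀ hμ
    linear_combination h2 - c * r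
  · apply mul_left_cancel₀ hμ
    linear_combination h1 - c * l

/-- In a gap, a square-summable solution exists only if `μ (μ + b) = c₁²`. -/
theorem condition (h : PerturbedRecursion c c₁ η b U) (hμ : μ ≠ 0) (hc : ‖c‖ ≤ ‖μ‖)
    (hη : μ + c ^ 2 / μ = 2 * η) (hU : Summable fun j => ‖U j‖ ^ 2) (h0 : U ≠ 0) :
    U 1 ≠ 0 ∧ μ * (μ + b) = c₁ ^ 2 := by
  obtain ⟨hr, hl⟩ := h.geometric hμ hc hη hU
  obtain ⟨e1, e2⟩ := h.two_eq hμ hc hη hU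
  have h1 : U 1 ≠ 0 := by
    intro h1
    rw [h1, mul_zero, eq_comm, mul_eq_zero] at e1
    exact h0 (eq_zero_of hr hl hμ h1 (e1.resolve_left hμ))
  refine ⟨h1, mul_right_cancel₀ h1 ?_⟩
  linear_combination (-μ) * e2 - c₁ * e1

/-- In a band there is no square-summable solution. -/
theorem eq_zero_of_norm_eq (h : PerturbedRecursion c c₁ η b U) (hμ : μ ≠ 0) (hc : ‖c‖ = ‖μ‖)
    (hη : μ + c ^ 2 / μ = 2 * η) (hU : Summable fun j => ‖U j‖ ^ 2) : U = 0 := by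
  obtain ⟨hr, hl⟩ := h.geometric hμ hc.le hη hU
  -- The ratio now has modulus one, so the moduli are constant along each half-line and can tend to
  -- zero only if they vanish.
  have aux : ∀ V : ℕ → ℂ, (∀ n, μ * V (n + 1) = c * V n) → Tendsto V atTop (𝓝 0) → V 0 = 0 := by
    intro V hV hlim
    have hn : ∀ n, ‖V n‖ = ‖V 0‖ := by
      intro n
      induction n with
      | zero => rfl
      | succ n ih =>
        have := congrArg norm (hV n)
        rw [norm_mul, norm_mul, hc] at this
        rw [← ih]
        exact mul_left_cancel₀ (norm_ne_zero_iff.2 hμ) this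
    have := hlim.norm
    simp only [hn, norm_zero] at this
    exact norm_eq_zero.1 (tendsto_nhds_unique tendsto_const_nhds this)
  have u2 := aux (fun n => U (2 + n)) (fun n => by exact_mod_cast hr n) (tendsto_zero_right hU 2)
  have u1 := aux (fun n => U (1 - n)) (fun n => by exact_mod_cast hl n) (tendsto_zero_left hU 1)
  exact eq_zero_of hr hl hμ (by simpa using u1) (by simpa using u2)

/-- The decaying solution. -/
def decaying (c c₁ μ : ℂ) (j : ℤ) : ℂ :=
  if j ≤ 1 then (c / μ) ^ (1 - j).toNat else c₁ / μ * (c / μ) ^ (j - 2).toNat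

theorem decaying_left (c c₁ μ : ℂ) (n : ℕ) : decaying c c₁ μ (1 - n) = (c / μ) ^ n := by
  simp [decaying]

theorem decaying_right (c c₁ μ : ℂ) (n : ℕ) :
    decaying c c₁ μ (2 + n) = c₁ / μ * (c / μ) ^ n := by
  have : ¬ (2 + (n : ℤ) ≤ 1) := by omega
  simp [decaying, this]

theorem decaying_one (c c₁ μ : ℂ) : decaying c c₁ μ 1 = 1 := by simp [decaying]

theorem summable_decaying (hc : ‖c‖ < ‖μ‖) : Summable fun j => ‖decaying c c₁ μ j‖ ^ 2 := by
  have hr : ‖c / μ‖ ^ 2 < 1 := by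
    rw [norm_div, sq_lt_one_iff₀ (by positivity), div_lt_one ((norm_nonneg _).trans_lt hc)]
    exact hc
  have hg := summable_geometric_of_lt_one (sq_nonneg _) hr
  have hs : Summable fun j => ‖decaying c c₁ μ (j + 1)‖ ^ 2 := by
    refine Summable.of_nat_of_neg ?_ ?_
    · refine (summable_nat_add_iff 1).1 ?_
      refine (hg.mul_left (‖c₁ / μ‖ ^ 2)).congr fun n => ?_
      rw [show (((n + 1 : ℕ) : ℤ) + 1) = 2 + n by push_cast; ring, decaying_right, norm_mul, norm_pow]
      ring
    · refine hg.congr fun n => ?_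
      rw [show (-(n : ℤ) + 1) = 1 - n by ring, decaying_left, norm_pow]
      ring
  exact (Equiv.addRight (1 : ℤ)).summable_iff.1 hs

/-- The factor `c₁ / μ` in `decaying` already satisfies the equation at vertex 2; the eigenvalue
condition is needed at vertex 1 only. -/
theorem perturbedRecursion_decaying (hμ : μ ≠ 0) (hη : μ + c ^ 2 / μ = 2 * η)
    (h : μ * (μ + b) = c₁ ^ 2) : PerturbedRecursion c c₁ η b (decaying c c₁ μ) := by
  have e0 : decaying c c₁ μ 0 = c / μ := by simpa using decaying_left c c₁ μ 1
  have e2 : decaying c c₁ μ 2 = c₁ / μ := by simpa using decaying_right c c₁ μ 0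
  have e3 : decaying c c₁ μ 3 = c₁ / μ * (c / μ) := by simpa using decaying_right c c₁ μ 1
  have hq : c = μ * (c / μ) := by field_simp
  have hq2 : c ^ 2 / μ = μ * (c / μ) ^ 2 := by field_simp
  refine ⟨fun j hj => ?_, fun j hj => ?_, ?_, ?_⟩
  · obtain ⟨n, hn⟩ := Int.eq_ofNat_of_zero_le (show 0 ≤ j - 3 by omega)
    have a1 := decaying_right c c₁ μ (n + 2)
    have a2 := decaying_right c c₁ μ (n + 1)
    have a3 := decaying_right c c₁ μ n
    push_cast at a1 a2
    rw [show j + 1 = 2 + ((n : ℤ) + 2) by omega, show j - 1 = 2 + (n : ℤ) by omega,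
      show j = 2 + ((n : ℤ) + 1) by omega, a1, a2, a3, ← hη, hq2]
    generalize c / μ = q at *
    linear_combination (c₁ / μ * q ^ (n + 2) + c₁ / μ * q ^ n) * hq
  · obtain ⟨n, hn⟩ := Int.eq_ofNat_of_zero_le (show 0 ≤ -j by omega)
    have a1 := decaying_left c c₁ μ (n + 2)
    have a2 := decaying_left c c₁ μ (n + 1)
    have a3 := decaying_left c c₁ μ n
    push_cast at a1 a2
    rw [show j + 1 = 1 - (n : ℤ) by omega, show j - 1 = 1 - ((n : ℤ) + 2) by omega,
      show j = 1 - ((n : ℤ) + 1) by omega, a1, a2, a3, ← hη, hq2]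
    generalize c / μ = q at *
    linear_combination (q ^ (n + 2) + q ^ n) * hq
  · rw [e0, e2, decaying_one, ← hη]
    field_simp
    linear_combination -h
  · rw [e2, e3, decaying_one, ← hη]
    field_simp
    ring

end PerturbedRecursion

/-! ### Eigenvalues away from the Dirichlet eigenvalues -/

/-- Ring 1 starts at vertex 1 and ends at vertex 2: its field changes the equations at both
vertices, its coupling constant only the one at vertex 1. -/
theorem perturbedRecursion_iff {α A α₁ A₁ E : ℝ} {U : ℤ → ℂ} :
    (∀ j, vertexDefect (fun j => if j = 1 then α₁ else α) (fun j => if j = 1 then A₁ else A) E U j = 0) ↔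
    PerturbedRecursion (Real.cos (A * Real.pi)) (Real.cos (A₁ * Real.pi))
      ((cs E Real.pi + α * sn E Real.pi / 4 : ℝ)) (((α₁ - α) / 2 * sn E Real.pi : ℝ)) U := by
  constructor
  · intro h
    refine ⟨fun j hj => ?_, fun j hj => ?_, ?_, ?_⟩
    · have := h j
      simp only [vertexDefect, if_neg (show j ≠ 1 by omega), if_neg (show j - 1 ≠ 1 by omega)] at this
      push_cast at this ⊢; linear_combination this
    · have := h j
      simp only [vertexDefect, if_neg (show j ≠ 1 by omega), if_neg (show j - 1 ≠ 1 by omega)] at this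
      push_cast at this ⊢; linear_combination this
    · have := h 1
      norm_num [vertexDefect] at this
      push_cast at this ⊢; linear_combination this
    · have := h 2
      norm_num [vertexDefect] at this
      push_cast at this ⊢; linear_combination this
  · intro h j
    rcases lt_trichotomy j 1 with hj | rfl | hj
    · have := h.left j (by omega)
      simp only [vertexDefect, if_neg (show j ≠ 1 by omega), if_neg (show j - 1 ≠ 1 by omega)]
      push_cast at this ⊢; linear_combination this
    · have := h.one
      norm_num [vertexDefect]
      push_cast at this ⊢; linear_combination this
    · rcases eq_or_ne j 2 with rfl | hj2
      · have := h.two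
        norm_num [vertexDefect]
        push_cast at this ⊢; linear_combination this
      · have := h.right j (by omega)
        simp only [vertexDefect, if_neg (show j ≠ 1 by omega), if_neg (show j - 1 ≠ 1 by omega)]
        push_cast at this ⊢; linear_combination this

section eigenvalues

variable {α A α₁ A₁ E : ℝ}

/-- The eigenvalue condition in a gap. -/
theorem eigenvalue_condition (hs : sn E Real.pi ≠ 0) {μ : ℝ} (hμ : μ ≠ 0)
    (hc : |Real.cos (A * Real.pi)| < |μ|)
    (hη : μ + Real.cos (A * Real.pi) ^ 2 / μ = 2 * (cs E Real.pi + α * sn E Real.pi / 4)) :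
    (HasEigenvalue (perturbedHamiltonian α A α₁ A₁) E →
      μ * (μ + (α₁ - α) / 2 * sn E Real.pi) = Real.cos (A₁ * Real.pi) ^ 2) ∧
    (μ * (μ + (α₁ - α) / 2 * sn E Real.pi) = Real.cos (A₁ * Real.pi) ^ 2 →
      HasSimpleEigenvalue (perturbedHamiltonian α A α₁ A₁) E) := by
  have hμ' : (μ : ℂ) ≠ 0 := by exact_mod_cast hμ
  have hc' : ‖(Real.cos (A * Real.pi) : ℂ)‖ < ‖(μ : ℂ)‖ := by
    simpa only [Complex.norm_real, Real.norm_eq_abs] using hc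
  have hη' : (μ : ℂ) + (Real.cos (A * Real.pi) : ℂ) ^ 2 / μ =
      2 * ((cs E Real.pi + α * sn E Real.pi / 4 : ℝ) : ℂ) := by exact_mod_cast hη
  constructor
  · intro h
    obtain ⟨u, hu0, hu⟩ := hasEigenvalue_iff.1 h
    obtain ⟨U, -, h2, h3, h4⟩ := hu.vertexData_of_eigen hs
    have := ((perturbedRecursion_iff.1 h3).condition hμ' hc'.le hη' h2 (fun h => hu0 (h4 h))).2
    exact_mod_cast this
  · intro h
    have hr := PerturbedRecursion.perturbedRecursion_decaying (c := (Real.cos (A * Real.pi) : ℂ))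
      (c₁ := (Real.cos (A₁ * Real.pi) : ℂ)) (b := ((α₁ - α) / 2 * sn E Real.pi : ℝ)) hμ' hη'
      (by exact_mod_cast h)
    obtain ⟨u, hu, hL⟩ := exists_eigenfunction hs
      (PerturbedRecursion.summable_decaying (c₁ := (Real.cos (A₁ * Real.pi) : ℂ)) hc')
      (perturbedRecursion_iff.2 hr)
    have hL1 := hL 1
    rw [PerturbedRecursion.decaying_one] at hL1
    refine hasSimpleEigenvalue_of (u := u) ?_ hu fun w hw => ?_
    · rintro rfl
      have : IsLeftValue ((0 : L2Chain) (1, true)) 0 :=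
        ⟨0, continuousOn_const, Lp.coeFn_zero _ _ _, rfl⟩
      exact one_ne_zero (hL1.unique this)
    · obtain ⟨W, hW, -, -, -⟩ := hw.vertexData_of_eigen hs
      refine ⟨W 1, sub_eq_zero.1 ?_⟩
      -- The difference is an eigenfunction vanishing at vertex 1, which `condition` allows only for
      -- the zero function.
      have hd := hw.sub (hu.smul (W 1))
      rw [smul_comm, ← smul_sub] at hd
      obtain ⟨V, hV, v2, v3, v4⟩ := hd.vertexData_of_eigen hs
      apply v4
      by_contra hV0
      refine ((perturbedRecursion_iff.1 v3).condition hμ' hc'.le hη' v2 hV0).1 ?_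
      have := (hV 1).unique ((hW 1).sub (hL1.smul (W 1)))
      simpa using this

/-- There are no eigenvalues in the bands. -/
theorem no_eigenvalue_in_band (hs : sn E Real.pi ≠ 0) (hc0 : Real.cos (A * Real.pi) ≠ 0)
    (h : |cs E Real.pi + α * sn E Real.pi / 4| ≤ |Real.cos (A * Real.pi)|) :
    ¬ HasEigenvalue (perturbedHamiltonian α A α₁ A₁) E := by
  intro hE
  obtain ⟨u, hu0, hu⟩ := hasEigenvalue_iff.1 hE
  obtain ⟨U, -, h2, h3, h4⟩ := hu.vertexData_of_eigen hs
  set η := cs E Real.pi + α * sn E Real.pi / 4 with hη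
  set c := Real.cos (A * Real.pi) with hc
  have hsq : 0 ≤ c ^ 2 - η ^ 2 := by have := sq_le_sq.2 h; linarith
  set r := √(c ^ 2 - η ^ 2) with hr
  have hr2 : r ^ 2 = c ^ 2 - η ^ 2 := Real.sq_sqrt hsq
  have hr2' : (r : ℂ) ^ 2 = (c : ℂ) ^ 2 - η ^ 2 := by exact_mod_cast hr2
  -- In a band the two roots are complex conjugates with product `c²`, hence of modulus `|c|`.
  set μ : ℂ := η + r * Complex.I with hμ
  have hprod : μ * (η - r * Complex.I) = (c : ℂ) ^ 2 := by
    rw [hμ]; linear_combination hr2' - (r : ℂ) ^ 2 * Complex.I_sq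
  have hc' : (c : ℂ) ≠ 0 := by exact_mod_cast hc0
  have hμ0 : μ ≠ 0 := by
    rintro h
    rw [h, zero_mul] at hprod
    exact pow_ne_zero 2 hc' hprod.symm
  have hnorm : ‖(c : ℂ)‖ = ‖μ‖ := by
    rw [← sq_eq_sq₀ (norm_nonneg _) (norm_nonneg _), Complex.sq_norm μ, Complex.norm_real,
      Real.norm_eq_abs, sq_abs, hμ, Complex.normSq_add_mul_I]
    linarith
  have hη' : μ + (c : ℂ) ^ 2 / μ = 2 * η := by
    rw [← hprod]; field_simp; rw [hμ]; ring
  exact hu0 (h4 ((perturbedRecursion_iff.1 h3).eq_zero_of_norm_eq hμ0 hnorm hη' h2))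

end eigenvalues

end

section


/-! ### Energies outside the essential spectrum -/

theorem hasSum_shift {g : ℤ → ℝ} {X : ℝ} (h : HasSum g X) (a : ℤ) :
    HasSum (fun j => g (j + a)) X :=
  (Equiv.addRight a).hasSum_iff.2 h

/-- Coercivity of the discrete operator `U ↦ c (U (j + 1) + U (j - 1)) - 2 η U j`. -/
theorem discrete_coercive {c η : ℝ} (h : |c| < |η|) {U : ℤ → ℂ} {q : ℤ → ℝ} {X Q : ℝ}
    (hX : HasSum (fun j => ‖U j‖ ^ 2) X) (hQ : HasSum q Q)
    (hq : ∀ j, ‖(c : ℂ) * U (j + 1) + c * U (j - 1) - 2 * η * U j‖ ^ 2 ≤ q j) :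
    X ≤ Q / (4 * (|η| - |c|) ^ 2) := by
  set d := |η| - |c| with hd
  have hd0 : 0 < d := by linarith
  have h1 := hasSum_shift hX 1
  have h2 := hasSum_shift hX (-1)
  -- The triangle inequality is multiplied by `‖U j‖`, the neighbour terms are split symmetrically,
  -- and half of the available `2 d ‖U j‖²` absorbs the defect. On summation the shifted `|c|` terms
  -- cancel.
  have key : ∀ j, d * ‖U j‖ ^ 2 + |c| * ‖U j‖ ^ 2 ≤
      |c| / 2 * ‖U (j + 1)‖ ^ 2 + |c| / 2 * ‖U (j + -1)‖ ^ 2 + 1 / (4 * d) * q j := by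
    intro j
    have n1 : 2 * |η| * ‖U j‖ ≤ |c| * ‖U (j + 1)‖ + |c| * ‖U (j - 1)‖ +
        ‖(c : ℂ) * U (j + 1) + c * U (j - 1) - 2 * η * U j‖ := by
      have e : 2 * |η| * ‖U j‖ = ‖(2 * η * U j : ℂ)‖ := by simp
      have e1 : |c| * ‖U (j + 1)‖ = ‖(c * U (j + 1) : ℂ)‖ := by simp
      have e2 : |c| * ‖U (j - 1)‖ = ‖(c * U (j - 1) : ℂ)‖ := by simp
      rw [e, e1, e2]
      have := norm_sub_le ((c : ℂ) * U (j + 1) + c * U (j - 1))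
        ((c : ℂ) * U (j + 1) + c * U (j - 1) - 2 * η * U j)
      rw [sub_sub_cancel] at this
      linarith [norm_add_le ((c : ℂ) * U (j + 1)) (c * U (j - 1))]
    have hqj := hq j
    set r := ‖(c : ℂ) * U (j + 1) + c * U (j - 1) - 2 * η * U j‖
    rw [← sub_eq_add_neg]
    set x := ‖U j‖
    set y := ‖U (j + 1)‖
    set y' := ‖U (j - 1)‖
    have hx : 0 ≤ x := norm_nonneg _
    have m1 := mul_le_mul_of_nonneg_right n1 hx
    have m2 : |c| * (y * x) ≤ |c| * ((y ^ 2 + x ^ 2) / 2) :=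
      mul_le_mul_of_nonneg_left (by nlinarith [sq_nonneg (y - x)]) (abs_nonneg _)
    have m3 : |c| * (y' * x) ≤ |c| * ((y' ^ 2 + x ^ 2) / 2) :=
      mul_le_mul_of_nonneg_left (by nlinarith [sq_nonneg (y' - x)]) (abs_nonneg _)
    have m4 : r * x ≤ 1 / (4 * d) * q j + d * x ^ 2 := by
      have : r * x ≤ 1 / (4 * d) * r ^ 2 + d * x ^ 2 := by
        have e : 1 / (4 * d) * r ^ 2 + d * x ^ 2 - r * x = d * (x - r / (2 * d)) ^ 2 := by
          field_simp; ring
        have : 0 ≤ d * (x - r / (2 * d)) ^ 2 := by positivity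
        linarith
      have h4 : 1 / (4 * d) * r ^ 2 ≤ 1 / (4 * d) * q j :=
        mul_le_mul_of_nonneg_left hqj (by positivity)
      linarith
    have e3 : |η| = d + |c| := by rw [hd]; ring
    rw [e3] at m1
    nlinarith
  have := hasSum_le key ((hX.mul_left d).add (hX.mul_left |c|))
    (((h1.mul_left (|c| / 2)).add (h2.mul_left (|c| / 2))).add (hQ.mul_left (1 / (4 * d))))
  have h3 : d * X ≤ 1 / (4 * d) * Q := by linarith
  rw [le_div_iff₀ (by positivity)]
  have := mul_le_mul_of_nonneg_left h3 (by positivity : 0 ≤ 4 * d)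
  have e : 4 * d * (1 / (4 * d) * Q) = Q := by field_simp
  nlinarith

theorem hasSum_edge (w : L2Chain) :
    HasSum (fun j : ℤ => ‖w (j, true)‖ ^ 2 + ‖w (j, false)‖ ^ 2) (‖w‖ ^ 2) := by
  have h := (norm_sq_summable w).hasSum
  rw [← norm_sq_eq_tsum] at h
  have := h.prod_fiberwise (fun j => hasSum_fintype _)
  simpa using this

section

variable {α A α₁ A₁ E : ℝ}

/-- Outside the bands, the graph norm is controlled up to two vertex values. -/
theorem exists_norm_sq_le (hη : |Real.cos (A * Real.pi)| < |cs E Real.pi + α * sn E Real.pi / 4|) {M : ℝ} :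
    ∃ K : ℝ, 0 ≤ K ∧ ∀ (u v : L2Chain) (U : ℤ → ℂ),
      IsVertexData (fun j => if j = 1 then α₁ else α) (fun j => if j = 1 then A₁ else A) E M u v U →
      ‖u‖ ^ 2 ≤ K * (‖v - (E : ℂ) • u‖ ^ 2 + (‖U 1‖ + ‖U 2‖) ^ 2) := by
  set c := Real.cos (A * Real.pi) with hc
  set c₁ := Real.cos (A₁ * Real.pi) with hc₁
  set η := cs E Real.pi + α * sn E Real.pi / 4 with hηd
  set b := (α₁ - α) / 2 * sn E Real.pi with hb
  -- `L` bounds the coefficients in which the perturbed recursion differs from the constant one;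
  -- they occur at the vertices 1 and 2 only.
  set L := |c - c₁| + |b| with hL
  set D := 4 * (|η| - |c|) ^ 2 with hD
  have hD0 : 0 < D := by have : 0 < |η| - |c| := by linarith
                         positivity
  have hL0 : 0 ≤ L := by positivity
  refine ⟨3 * M ^ 2 * (1 + 4 * ((16 * M ^ 2 + 4 * L ^ 2) / D)), by positivity, fun u v U hU => ?_⟩
  set w := v - (E : ℂ) • u with hw
  set T := ‖U 1‖ + ‖U 2‖ with hT
  have hsq := hasSum_edge w
  set h : ℤ → ℝ := fun j => ‖w (j, true)‖ ^ 2 + ‖w (j, false)‖ ^ 2 with hh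
  -- the defect of the unperturbed recursion
  have hρ : ∀ j, ‖(c : ℂ) * U (j + 1) + c * U (j - 1) - 2 * η * U j‖ ^ 2 ≤
      8 * M ^ 2 * (h j + h (j + -1)) + 2 * L ^ 2 * T ^ 2 * (if j ∈ ({1, 2} : Finset ℤ) then 1 else 0) := by
    intro j
    have h1 := hU.defect j
    set δ := vertexDefect (fun j => if j = 1 then α₁ else α) (fun j => if j = 1 then A₁ else A) E U j
      with hδ
    have n1 : ‖δ‖ ^ 2 ≤ 4 * M ^ 2 * (h j + h (j + -1)) := by
      have := pow_le_pow_left₀ (norm_nonneg _) h1 2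
      refine this.trans ?_
      rw [mul_pow, show 4 * M ^ 2 * (h j + h (j + -1)) = M ^ 2 * (4 * (h j + h (j + -1))) by ring]
      refine mul_le_mul_of_nonneg_left ?_ (sq_nonneg _)
      simp only [hh, ← sub_eq_add_neg]
      have : ∀ a b c d : ℝ, (a + b + c + d) ^ 2 ≤ 4 * (a ^ 2 + b ^ 2 + (c ^ 2 + d ^ 2)) := by
        intro a b c d
        nlinarith [sq_nonneg (a - b), sq_nonneg (a - c), sq_nonneg (a - d), sq_nonneg (b - c),
          sq_nonneg (b - d), sq_nonneg (c - d)]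
      exact this _ _ _ _
    have n2 : ‖((c : ℂ) * U (j + 1) + c * U (j - 1) - 2 * η * U j) - δ‖ ≤
        L * T * (if j ∈ ({1, 2} : Finset ℤ) then 1 else 0) := by
      have hU1 := norm_nonneg (U 1)
      have hU2 := norm_nonneg (U 2)
      by_cases j1 : j = 1
      · subst j1
        have : ((c : ℂ) * U (1 + 1) + c * U (1 - 1) - 2 * η * U 1) - δ = (c - c₁ : ℝ) * U 2 + b * U 1 := by
          rw [hδ, hηd, hb, hc, hc₁]; norm_num [vertexDefect]; ring
        rw [this]
        refine (norm_add_le _ _).trans ?_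
        rw [norm_mul, norm_mul, Complex.norm_real, Complex.norm_real, Real.norm_eq_abs,
          Real.norm_eq_abs]
        have := mul_nonneg (abs_nonneg (c - c₁)) hU1
        have := mul_nonneg (abs_nonneg b) hU2
        simp only [Finset.mem_insert, true_or, if_true, hL, hT]
        linarith
      · by_cases j2 : j = 2
        · subst j2
          have : ((c : ℂ) * U (2 + 1) + c * U (2 - 1) - 2 * η * U 2) - δ = (c - c₁ : ℝ) * U 1 := by
            rw [hδ, hηd, hc, hc₁]; norm_num [vertexDefect]; ring
          rw [this, norm_mul, Complex.norm_real, Real.norm_eq_abs]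
          have := mul_nonneg (abs_nonneg (c - c₁)) hU2
          have := mul_nonneg (abs_nonneg b) (add_nonneg hU1 hU2)
          simp only [Finset.mem_insert, Finset.mem_singleton, or_true, if_true, hL, hT]
          linarith
        · have : ((c : ℂ) * U (j + 1) + c * U (j - 1) - 2 * η * U j) - δ = 0 := by
            rw [hδ, hηd, hc]
            simp only [vertexDefect, if_neg j1, if_neg (show j - 1 ≠ 1 by omega)]
            push_cast; ring
          rw [this]
          simp [j1, j2]
    have n3 := norm_le_norm_add_norm_sub' ((c : ℂ) * U (j + 1) + c * U (j - 1) - 2 * η * U j) δ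
    set R := (c : ℂ) * U (j + 1) + c * U (j - 1) - 2 * η * U j
    have n4 : ‖R‖ ^ 2 ≤ 2 * ‖δ‖ ^ 2 + 2 * ‖R - δ‖ ^ 2 := by
      nlinarith [sq_nonneg (‖δ‖ - ‖R - δ‖), norm_nonneg R, norm_nonneg δ, norm_nonneg (R - δ)]
    have n5 : ‖R - δ‖ ^ 2 ≤ L ^ 2 * T ^ 2 * (if j ∈ ({1, 2} : Finset ℤ) then 1 else 0) := by
      refine (pow_le_pow_left₀ (norm_nonneg _) n2 2).trans (le_of_eq ?_)
      split_ifs <;> ring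
    linarith
  have hchar : HasSum (fun j : ℤ => if j ∈ ({1, 2} : Finset ℤ) then (1 : ℝ) else 0) 2 := by
    have : HasSum (fun j : ℤ => if j ∈ ({1, 2} : Finset ℤ) then (1 : ℝ) else 0)
        (∑ j ∈ ({1, 2} : Finset ℤ), if j ∈ ({1, 2} : Finset ℤ) then (1 : ℝ) else 0) :=
      hasSum_sum_of_ne_finset_zero fun j hj => if_neg hj
    rw [Finset.sum_ite_mem, Finset.inter_self, Finset.sum_const,
      Finset.card_pair (by norm_num), nsmul_eq_mul, mul_one] at this
    exact_mod_cast this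
  have hQ := ((hsq.add (hasSum_shift hsq (-1))).mul_left (8 * M ^ 2)).add (hchar.mul_left (2 * L ^ 2 * T ^ 2))
  have hUs : Summable fun j => ‖U j‖ ^ 2 := by
    have e1 : ∀ x : L2Chain, Summable fun j : ℤ => ‖x (j, true)‖ ^ 2 := fun x =>
      (norm_sq_summable x).comp_injective (i := fun j : ℤ => ((j, true) : Edge))
        (fun a b hab => (Prod.ext_iff.1 hab).1)
    refine Summable.of_nonneg_of_le (fun j => by positivity) (fun j => ?_)
      (((e1 u).add (e1 w)).mul_left (2 * M ^ 2))
    refine (pow_le_pow_left₀ (norm_nonneg _) (hU.value_le j) 2).trans ?_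
    rw [mul_pow, mul_comm 2, mul_assoc]
    refine mul_le_mul_of_nonneg_left ?_ (sq_nonneg _)
    nlinarith [sq_nonneg (‖u (j, true)‖ - ‖w (j, true)‖)]
  have hX := hUs.hasSum
  set X := ∑' j, ‖U j‖ ^ 2
  have hXle := discrete_coercive hη hX hQ hρ
  have hu := hasSum_edge u
  have hle : ∀ j, ‖u (j, true)‖ ^ 2 + ‖u (j, false)‖ ^ 2 ≤
      3 * M ^ 2 * (2 * ‖U j‖ ^ 2 + 2 * ‖U (j + 1)‖ ^ 2 + h j) := by
    intro j
    have hb : ∀ b, ‖u (j, b)‖ ^ 2 ≤ 3 * M ^ 2 * (‖U j‖ ^ 2 + ‖U (j + 1)‖ ^ 2 + ‖w (j, b)‖ ^ 2) := by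
      intro b
      refine (pow_le_pow_left₀ (norm_nonneg _) (hU.norm_le (j, b)) 2).trans ?_
      rw [mul_pow, mul_comm 3, mul_assoc]
      refine mul_le_mul_of_nonneg_left ?_ (sq_nonneg _)
      have : ∀ a b c : ℝ, (a + b + c) ^ 2 ≤ 3 * (a ^ 2 + b ^ 2 + c ^ 2) := by
        intro a b c
        nlinarith [sq_nonneg (a - b), sq_nonneg (a - c), sq_nonneg (b - c)]
      exact this _ _ _
    have := hb true
    have := hb false
    simp only [hh]
    linarith
  have := hasSum_le hle hu ((((hX.mul_left 2).add ((hasSum_shift hX 1).mul_left 2)).add hsq).mul_left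
    (3 * M ^ 2))
  refine this.trans ?_
  rw [mul_assoc (3 * M ^ 2)]
  refine mul_le_mul_of_nonneg_left ?_ (by positivity)
  have hW0 : 0 ≤ ‖w‖ ^ 2 := sq_nonneg _
  have hT0 : 0 ≤ T ^ 2 := sq_nonneg _
  have hX2 : X ≤ (16 * M ^ 2 + 4 * L ^ 2) / D * (‖w‖ ^ 2 + T ^ 2) := by
    refine hXle.trans ?_
    rw [div_mul_eq_mul_div]
    refine div_le_div_of_nonneg_right ?_ hD0.le
    have : 0 ≤ 16 * M ^ 2 * T ^ 2 + 4 * L ^ 2 * ‖w‖ ^ 2 := by positivity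
    linarith
  linarith

/-- A compactness argument: along a subsequence of a singular sequence the vertex values at 1 and 2
converge. Differences of consecutive members then have vanishing defect and vanishing values at both
vertices, so `exists_norm_sq_le` forces them to zero, although orthonormality gives them squared
norm `2`. -/
theorem notMem_essentialSpectrum (hs : sn E Real.pi ≠ 0)
    (hη : |Real.cos (A * Real.pi)| < |cs E Real.pi + α * sn E Real.pi / 4|) :
    E ∉ essentialSpectrum (perturbedHamiltonian α A α₁ A₁) := by
  rintro ⟨x, hx, hlim⟩
  obtain ⟨M, hM0, hM⟩ := exists_vertexData hs
  obtain ⟨K, hK0, hK⟩ := exists_norm_sq_le (α := α) (A := A) (α₁ := α₁) (A₁ := A₁) (M := M) hη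
  let T := perturbedHamiltonian α A α₁ A₁
  change Tendsto (fun n => T (x n) - (E : ℂ) • (x n : L2Chain)) atTop (𝓝 0) at hlim
  have hact : ∀ n, ActsTo (fun j => if j = 1 then α₁ else α) (fun j => if j = 1 then A₁ else A)
    (x n : L2Chain) (T (x n)) := fun n => actsTo_domain (x n)
  choose U hU using fun n => hM _ _ _ _ (hact n)
  obtain ⟨R, hR⟩ := (Metric.isBounded_range_of_tendsto _ hlim).exists_norm_le
  have hR' : ∀ n, ‖T (x n) - (E : ℂ) • (x n : L2Chain)‖ ≤ R := fun n => hR _ ⟨n, rfl⟩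
  have hbd : ∀ n j, ‖U n j‖ ≤ M * (1 + R) := by
    intro n j
    refine ((hU n).value_le j).trans (mul_le_mul_of_nonneg_left (add_le_add ?_ ?_) hM0.le)
    · exact (lp.norm_apply_le_norm (by norm_num) _ _).trans (hx.1 n).le
    · exact (lp.norm_apply_le_norm (by norm_num) _ _).trans (hR' n)
  obtain ⟨⟨a, b⟩, -, φ, hφ, hφlim⟩ := tendsto_subseq_of_bounded
    (s := Metric.closedBall (0 : ℂ × ℂ) (M * (1 + R))) Metric.isBounded_closedBall
    (x := fun n => (U n 1, U n 2)) (fun n => by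
      rw [mem_closedBall_zero_iff, Prod.norm_def]
      exact max_le (hbd n 1) (hbd n 2))
  have ha : Tendsto (fun k => U (φ k) 1) atTop (𝓝 a) := (continuous_fst.tendsto _).comp hφlim
  have hb : Tendsto (fun k => U (φ k) 2) atTop (𝓝 b) := (continuous_snd.tendsto _).comp hφlim
  have hw : Tendsto (fun k => T (x (φ k)) - (E : ℂ) • (x (φ k) : L2Chain)) atTop (𝓝 0) :=
    hlim.comp hφ.tendsto_atTop
  have hs1 := tendsto_add_atTop_nat 1
  have ha' := ((ha.comp hs1).sub ha).norm
  have hb' := ((hb.comp hs1).sub hb).norm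
  have hw' := ((hw.comp hs1).sub hw).norm
  simp only [sub_self, norm_zero, Function.comp_def] at ha' hb' hw'
  have hfin := (((hw'.pow 2).add ((ha'.add hb').pow 2)).const_mul K)
  norm_num at hfin
  have hge : ∀ k, (2 : ℝ) ≤ K * (‖T (x (φ (k + 1))) - (E : ℂ) • (x (φ (k + 1)) : L2Chain) -
      (T (x (φ k)) - (E : ℂ) • (x (φ k) : L2Chain))‖ ^ 2 +
      (‖U (φ (k + 1)) 1 - U (φ k) 1‖ + ‖U (φ (k + 1)) 2 - U (φ k) 2‖) ^ 2) := by
    intro k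
    obtain ⟨V, hV⟩ := hM _ _ _ _ ((hact (φ (k + 1))).sub (hact (φ k)))
    have hVU : ∀ j, V j = U (φ (k + 1)) j - U (φ k) j := fun j =>
      (hV.isLeftValue j).unique (((hU _).isLeftValue j).sub ((hU _).isLeftValue j))
    have h1 := hK _ _ _ hV
    have h2 : ‖(x (φ (k + 1)) : L2Chain) - x (φ k)‖ ^ 2 = 2 := by
      have hne : φ (k + 1) ≠ φ k := (hφ (Nat.lt_succ_self k)).ne'
      rw [@norm_sub_sq ℂ, hx.1, hx.1, hx.2 hne]
      norm_num
    rw [h2, hVU, hVU] at h1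
    refine h1.trans (le_of_eq ?_)
    congr 4
    rw [smul_sub]; abel
  have := ge_of_tendsto' hfin hge
  norm_num at this

end

end

section


/-! ### Weyl sequences from Bloch solutions -/

/-- The data at energy `E` of a Bloch solution with multiplier `z` of the chain with constant
coefficients: the vertex value `p` and the quasiderivatives `d true`, `d false`. -/
structure IsBloch (α : ℝ) (A : ℝ) (E : ℝ) (z p : ℂ) (d : Bool → ℂ) : Prop where
  norm_z : ‖z‖ = 1
  right : ∀ b, edgeSol (fun _ => A) (0, b) E p (d b) Real.pi = z * p
  jump : z * (d true + d false) - edgeSolQuasi (fun _ => A) (0, true) E p (d true) Real.pi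
    - edgeSolQuasi (fun _ => A) (0, false) E p (d false) Real.pi = α * (z * p)
  ne_zero : p ≠ 0 ∨ ∃ b, d b ≠ 0

/-- A smooth transition function from `a` to `b` on `[0, π]`. -/
def ramp (a b : ℂ) (x : ℝ) : ℂ := a + (b - a) * ((1 - Real.cos x) / 2 : ℝ)

/-- The derivative of `ramp`. -/
def rampDeriv (a b : ℂ) (x : ℝ) : ℂ := (b - a) * (Real.sin x / 2 : ℝ)

/-- The second derivative of `ramp`. -/
def rampDeriv2 (a b : ℂ) (x : ℝ) : ℂ := (b - a) * (Real.cos x / 2 : ℝ)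

theorem hasDerivAt_ramp (a b : ℂ) (x : ℝ) : HasDerivAt (ramp a b) (rampDeriv a b x) x := by
  have := ((((Real.hasDerivAt_cos x).const_sub 1).div_const 2).ofReal_comp.const_mul (b - a)).const_add a
  refine this.congr_deriv ?_
  simp [rampDeriv]

theorem hasDerivAt_rampDeriv (a b : ℂ) (x : ℝ) :
    HasDerivAt (rampDeriv a b) (rampDeriv2 a b x) x :=
  ((Real.hasDerivAt_sin x).div_const 2).ofReal_comp.const_mul (b - a)

theorem continuous_rampDeriv2 (a b : ℂ) : Continuous (rampDeriv2 a b) := by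
  unfold rampDeriv2; fun_prop

@[simp] theorem ramp_self (a : ℂ) (x : ℝ) : ramp a a x = a := by simp [ramp]
@[simp] theorem rampDeriv_self (a : ℂ) (x : ℝ) : rampDeriv a a x = 0 := by simp [rampDeriv]
@[simp] theorem rampDeriv2_self (a : ℂ) (x : ℝ) : rampDeriv2 a a x = 0 := by simp [rampDeriv2]
@[simp] theorem ramp_zero (a b : ℂ) : ramp a b 0 = a := by simp [ramp]
@[simp] theorem ramp_pi (a b : ℂ) : ramp a b Real.pi = b := by simp [ramp]
@[simp] theorem rampDeriv_zero (a b : ℂ) : rampDeriv a b 0 = 0 := by simp [rampDeriv]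
@[simp] theorem rampDeriv_pi (a b : ℂ) : rampDeriv a b Real.pi = 0 := by simp [rampDeriv]

theorem norm_ramp_le {a b : ℂ} (ha : ‖a‖ ≤ 1) (hb : ‖b‖ ≤ 1) (x : ℝ) : ‖ramp a b x‖ ≤ 1 := by
  set t := (1 - Real.cos x) / 2 with ht
  have h0 : 0 ≤ t := by rw [ht]; linarith [Real.cos_le_one x]
  have h1 : 0 ≤ 1 - t := by rw [ht]; linarith [Real.neg_one_le_cos x]
  have e : ramp a b x = (1 - t : ℝ) * a + (t : ℝ) * b := by
    simp only [ramp, ← ht]; push_cast; ring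
  rw [e]
  refine (norm_add_le _ _).trans ?_
  rw [norm_mul, norm_mul, Complex.norm_real, Complex.norm_real, Real.norm_of_nonneg h0,
    Real.norm_of_nonneg h1]
  nlinarith

theorem norm_rampDeriv_le {a b : ℂ} (ha : ‖a‖ ≤ 1) (hb : ‖b‖ ≤ 1) (x : ℝ) :
    ‖rampDeriv a b x‖ ≤ 1 := by
  have h1 := norm_sub_le b a
  have h2 := Real.abs_sin_le_one x
  rw [rampDeriv, norm_mul, Complex.norm_real, Real.norm_eq_abs, abs_div, abs_two]
  have := mul_le_mul (show ‖b - a‖ ≤ 2 by linarith) (show |Real.sin x| / 2 ≤ 1 / 2 by linarith)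
    (by positivity) (by norm_num)
  linarith

theorem norm_rampDeriv2_le {a b : ℂ} (ha : ‖a‖ ≤ 1) (hb : ‖b‖ ≤ 1) (x : ℝ) :
    ‖rampDeriv2 a b x‖ ≤ 1 := by
  have h1 := norm_sub_le b a
  have h2 := Real.abs_cos_le_one x
  rw [rampDeriv2, norm_mul, Complex.norm_real, Real.norm_eq_abs, abs_div, abs_two]
  have := mul_le_mul (show ‖b - a‖ ≤ 2 by linarith) (show |Real.cos x| / 2 ≤ 1 / 2 by linarith)
    (by positivity) (by norm_num)
  linarith

theorem edgeSol_smul (A : ℤ → ℝ) (e : Edge) (E : ℝ) (c p d : ℂ) (x : ℝ) :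
    edgeSol A e E (c * p) (c * d) x = c * edgeSol A e E p d x := by
  simp only [edgeSol]; ring

theorem edgeSolQuasi_smul (A : ℤ → ℝ) (e : Edge) (E : ℝ) (c p d : ℂ) (x : ℝ) :
    edgeSolQuasi A e E (c * p) (c * d) x = c * edgeSolQuasi A e E p d x := by
  simp only [edgeSolQuasi]; ring

theorem gauge_congr {A A' : ℤ → ℝ} {j j' : ℤ} (h : A j = A' j') (b : Bool) (x : ℝ) :
    gauge A (j, b) x = gauge A' (j', b) x := by
  simp only [gauge, potential, h]

theorem edgeSol_congr {A A' : ℤ → ℝ} {j j' : ℤ} (h : A j = A' j') (b : Bool) (E : ℝ) (p d : ℂ)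
    (x : ℝ) : edgeSol A (j, b) E p d x = edgeSol A' (j', b) E p d x := by
  simp only [edgeSol, gauge_congr h]

theorem edgeSolQuasi_congr {A A' : ℤ → ℝ} {j j' : ℤ} (h : A j = A' j') (b : Bool) (E : ℝ) (p d : ℂ)
    (x : ℝ) : edgeSolQuasi A (j, b) E p d x = edgeSolQuasi A' (j', b) E p d x := by
  simp only [edgeSolQuasi, gauge_congr h]

/-- The indicator of the window of vertices `N + 1, …, N + L`. -/
def window (N : ℤ) (L : ℕ) (j : ℤ) : ℂ := if N + 1 ≤ j ∧ j ≤ N + L then 1 else 0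

theorem norm_window_le (N : ℤ) (L : ℕ) (j : ℤ) : ‖window N L j‖ ≤ 1 := by
  unfold window; split_ifs <;> simp

variable {α A α₁ A₁ E : ℝ} {z p : ℂ} {d : Bool → ℂ}

/-- A solution which does not vanish identically has positive norm. -/
theorem IsBloch.norm_pos (h : IsBloch α A E z p d) :
    0 < ∑ b, ‖(memLp_edge (continuous_edgeSol (A := fun _ => A) (e := (0, b)) (E := E) (p := p)
      (d := d b)).continuousOn).toLp‖ ^ 2 := by
  have hz : ∀ b, ‖(memLp_edge (continuous_edgeSol (A := fun _ => A) (e := (0, b)) (E := E) (p := p)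
      (d := d b)).continuousOn).toLp‖ = 0 → p = 0 ∧ d b = 0 := by
    intro b hb
    have h0 : edgeSol (fun _ => A) (0, b) E p (d b) =ᵐ[edgeMeasure] 0 := by
      have := (memLp_edge (continuous_edgeSol (A := fun _ => A) (e := (0, b)) (E := E) (p := p)
        (d := d b)).continuousOn).coeFn_toLp
      rw [norm_eq_zero.1 hb] at this
      exact this.symm.trans (Lp.coeFn_zero _ _ _)
    have hH := isH2_cut (A := fun _ => A) (e := (0, b)) (E := E) (p := p) (d := d b) (χ := 1)
      (χ' := 0) (χ'' := 0) (fun x => hasDerivAt_const x (1 : ℂ)) (fun x => hasDerivAt_const x (0 : ℂ))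
      continuous_const
    simp only [Pi.one_apply, one_mul] at hH
    have h1 := eqOn_zero_of_ae hH.continuousOn h0 ⟨le_rfl, Real.pi_pos.le⟩
    have h2 := eqOn_zero_of_ae hH.continuousOn_deriv (hH.ae_zero h0).1 ⟨le_rfl, Real.pi_pos.le⟩
    simp only [edgeSol_zero, Pi.zero_apply] at h1
    simp only [cutDeriv, edgeSol_zero, edgeSolQuasi_zero, Pi.zero_apply, Pi.one_apply, h1] at h2
    exact ⟨h1, by simpa using h2⟩
  have hnn : ∀ b, 0 ≤ ‖(memLp_edge (continuous_edgeSol (A := fun _ => A) (e := (0, b)) (E := E) (p := p)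
      (d := d b)).continuousOn).toLp‖ ^ 2 := fun b => sq_nonneg _
  rcases h.ne_zero with hp | ⟨b, hb⟩
  · refine Finset.sum_pos' (fun b _ => hnn b) ⟨true, Finset.mem_univ _, ?_⟩
    exact pow_pos (lt_of_le_of_ne (norm_nonneg _) fun h => hp (hz true h.symm).1) 2
  · refine Finset.sum_pos' (fun b _ => hnn b) ⟨b, Finset.mem_univ _, ?_⟩
    exact pow_pos (lt_of_le_of_ne (norm_nonneg _) fun h => hb (hz b h.symm).2) 2

/-- A Bloch solution cut off to a window of rings. -/
theorem IsBloch.exists_window (h : IsBloch α A E z p d) : ∃ B κ : ℝ, 0 < κ ∧ 0 ≤ B ∧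
    ∀ (N : ℤ) (L : ℕ), 2 ≤ N → 1 ≤ L → ∃ u v : L2Chain,
      ActsTo (fun j => if j = 1 then α₁ else α) (fun j => if j = 1 then A₁ else A) u v ∧
      ‖v - (E : ℂ) • u‖ ≤ B ∧ κ * (L - 1) ≤ ‖u‖ ^ 2 ∧
      ∀ e : Edge, (e.1 < N ∨ N + L < e.1) → u e = 0 := by
  set base : Bool → ℝ → ℂ := fun b => edgeSol (fun _ => A) (0, b) E p (d b) with hbase
  set baseQ : Bool → ℝ → ℂ := fun b => edgeSolQuasi (fun _ => A) (0, b) E p (d b) with hbaseQ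
  have hbc : ∀ b, Continuous (base b) := fun b => continuous_edgeSol
  have hQc : ∀ b, Continuous (baseQ b) := fun b => continuous_edgeSolQuasi
  obtain ⟨B1, hB1⟩ : ∃ B1 : ℝ, ∀ b, ∀ x ∈ Set.Icc 0 Real.pi, ‖base b x‖ ≤ B1 ∧ ‖baseQ b x‖ ≤ B1 := by
    have : ∀ b, ∃ B : ℝ, ∀ x ∈ Set.Icc 0 Real.pi, ‖base b x‖ ≤ B ∧ ‖baseQ b x‖ ≤ B := by
      intro b
      obtain ⟨r1, h1⟩ := isCompact_Icc.exists_bound_of_continuousOn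
        ((hbc b).continuousOn (s := Set.Icc 0 Real.pi))
      obtain ⟨r2, h2⟩ := isCompact_Icc.exists_bound_of_continuousOn
        ((hQc b).continuousOn (s := Set.Icc 0 Real.pi))
      exact ⟨max r1 r2, fun x hx => ⟨(h1 x hx).trans (le_max_left _ _),
        (h2 x hx).trans (le_max_right _ _)⟩⟩
    choose B hB using this
    refine ⟨max (B true) (B false), fun b x hx => ?_⟩
    cases b
    · exact ⟨(hB _ x hx).1.trans (le_max_right _ _), (hB _ x hx).2.trans (le_max_right _ _)⟩
    · exact ⟨(hB _ x hx).1.trans (le_max_left _ _), (hB _ x hx).2.trans (le_max_left _ _)⟩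
  have hB10 : 0 ≤ B1 := (norm_nonneg _).trans (hB1 true 0 ⟨le_rfl, Real.pi_pos.le⟩).1
  -- The commutator is at most `3 * B1` pointwise. One factor `2` bounds `√π`, the other is `√4` for
  -- the four edges of the two transition rings. For `κ` the squared norm over one ring is taken.
  refine ⟨2 * (2 * (3 * B1)), _, h.norm_pos, by positivity, fun N L hN hL => ?_⟩
  set α' : ℤ → ℝ := fun j => if j = 1 then α₁ else α
  set A' : ℤ → ℝ := fun j => if j = 1 then A₁ else A
  -- The window starts at ring `N ≥ 2`, hence lies to the right of the defect, where the
  -- coefficients are constant.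
  have hA' : ∀ j : ℤ, 2 ≤ j → A' j = A := fun j hj => if_neg (by omega)
  have hα' : ∀ j : ℤ, 2 ≤ j → α' j = α := fun j hj => if_neg (by omega)
  have hz0 : z ≠ 0 := fun h0 => by have := h.norm_z; simp [h0] at this
  have hzn : ∀ j : ℤ, ‖z ^ j‖ = 1 := fun j => by rw [norm_zpow, h.norm_z, one_zpow]
  let χ : Edge → ℝ → ℂ := fun e => ramp (window N L e.1) (window N L (e.1 + 1))
  let χ' : Edge → ℝ → ℂ := fun e => rampDeriv (window N L e.1) (window N L (e.1 + 1))
  let χ'' : Edge → ℝ → ℂ := fun e => rampDeriv2 (window N L e.1) (window N L (e.1 + 1))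
  let P : Edge → ℂ := fun e => z ^ e.1 * p
  let D : Edge → ℂ := fun e => z ^ e.1 * d e.2
  let f : Edge → ℝ → ℂ := fun e x => χ e x * edgeSol A' e E (P e) (D e) x
  let f' : Edge → ℝ → ℂ := fun e => cutDeriv A' e E (P e) (D e) (χ e) (χ' e)
  let f'' : Edge → ℝ → ℂ := fun e => cutDeriv2 A' e E (P e) (D e) (χ e) (χ' e) (χ'' e)
  have hf : ∀ e, IsH2 (f e) (f' e) (f'' e) := fun e =>
    isH2_cut (hasDerivAt_ramp _ _) (hasDerivAt_rampDeriv _ _) (continuous_rampDeriv2 _ _)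
  let g : Edge → ℝ → ℂ := fun e x =>
    -(2 * χ' e x * edgeSolQuasi A' e E (P e) (D e) x + χ'' e x * edgeSol A' e E (P e) (D e) x)
  have hgc : ∀ e, Continuous (g e) := by
    intro e
    have c1 : Continuous (χ' e) :=
      continuous_iff_continuousAt.2 fun x => (hasDerivAt_rampDeriv _ _ x).continuousAt
    have c2 : Continuous (χ'' e) := continuous_rampDeriv2 _ _
    have c3 := continuous_edgeSol (A := A') (e := e) (E := E) (p := P e) (d := D e)
    have c4 := continuous_edgeSolQuasi (A := A') (e := e) (E := E) (p := P e) (d := D e)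
    fun_prop
  have hact : ∀ e x, edgeAction A' e (f e) (f' e) (f'' e) x = E * f e x + g e x := by
    intro e x
    refine (edgeAction_cut x).trans ?_
    simp only [f, g]; ring
  -- values of the solutions on the rings in question
  have hsol : ∀ (j : ℤ) (b : Bool) (x : ℝ), 2 ≤ j →
      edgeSol A' (j, b) E (P (j, b)) (D (j, b)) x = z ^ j * base b x := by
    intro j b x hj
    simp only [P, D, edgeSol_smul]
    rw [edgeSol_congr (A' := fun _ => A) (j' := 0) (hA' j hj)]
  have hsolQ : ∀ (j : ℤ) (b : Bool) (x : ℝ), 2 ≤ j →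
      edgeSolQuasi A' (j, b) E (P (j, b)) (D (j, b)) x = z ^ j * baseQ b x := by
    intro j b x hj
    simp only [P, D, edgeSolQuasi_smul]
    rw [edgeSolQuasi_congr (A' := fun _ => A) (j' := 0) (hA' j hj)]
  have hwin0 : ∀ j : ℤ, (j < N + 1 ∨ N + L < j) → window N L j = 0 := by
    intro j hj; unfold window; rw [if_neg (by omega)]
  have hwin1 : ∀ j : ℤ, N + 1 ≤ j → j ≤ N + L → window N L j = 1 := by
    intro j hj hj'; unfold window; rw [if_pos ⟨hj, hj'⟩]
  have hf_out : ∀ e : Edge, (e.1 < N ∨ N + L < e.1) → f e = 0 := by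
    intro e he
    funext x
    simp only [f, χ, hwin0 e.1 (by omega), hwin0 (e.1 + 1) (by omega), ramp_self, zero_mul,
      Pi.zero_apply]
  -- The cutoff rises on ring `N` and falls on ring `N + L`; on every other ring both end values
  -- agree and the error vanishes.
  have hg_out : ∀ e : Edge, (e.1 ≠ N ∧ e.1 ≠ N + L) → g e = 0 := by
    intro e he
    have : window N L e.1 = window N L (e.1 + 1) := by
      unfold window; congr 1; simp only [eq_iff_iff]; omega
    funext x
    simp only [g, χ', χ'', this, rampDeriv_self, rampDeriv2_self, zero_mul, mul_zero, add_zero,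
      neg_zero, Pi.zero_apply]
  have hχ : ∀ e x, ‖χ e x‖ ≤ 1 := fun e =>
    norm_ramp_le (norm_window_le _ _ _) (norm_window_le _ _ _)
  have hχ' : ∀ e x, ‖χ' e x‖ ≤ 1 := fun e =>
    norm_rampDeriv_le (norm_window_le _ _ _) (norm_window_le _ _ _)
  have hχ'' : ∀ e x, ‖χ'' e x‖ ≤ 1 := fun e =>
    norm_rampDeriv2_le (norm_window_le _ _ _) (norm_window_le _ _ _)
  have hfb : ∀ e, ∀ x ∈ Set.Icc 0 Real.pi, ‖f e x‖ ≤ B1 := by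
    rintro ⟨j, b⟩ x hx
    by_cases he : j < N ∨ N + L < j
    · rw [hf_out _ he]; simpa using hB10
    · simp only [f]
      rw [hsol j b x (by omega), norm_mul, norm_mul, hzn, one_mul]
      have := mul_le_mul (hχ (j, b) x) (hB1 b x hx).1 (norm_nonneg _) zero_le_one
      linarith
  have hgb : ∀ e, ∀ x ∈ Set.Icc 0 Real.pi, ‖g e x‖ ≤ 3 * B1 := by
    rintro ⟨j, b⟩ x hx
    by_cases he : j ≠ N ∧ j ≠ N + L
    · rw [hg_out _ he]; simpa using hB10
    · simp only [g]
      rw [hsol j b x (by omega), hsolQ j b x (by omega), norm_neg]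
      refine (norm_add_le _ _).trans ?_
      simp only [norm_mul, hzn, one_mul, Complex.norm_ofNat]
      have h1 := mul_le_mul (hχ' (j, b) x) (hB1 b x hx).2 (norm_nonneg _) zero_le_one
      have h2 := mul_le_mul (hχ'' (j, b) x) (hB1 b x hx).1 (norm_nonneg _) zero_le_one
      linarith
  have hfin : ∀ (s : Finset Edge) (b : ℝ), Summable fun e => (if e ∈ s then b else 0) ^ 2 := by
    intro s b
    refine summable_of_ne_finset_zero (s := s) fun e he => by simp [he]
  let s : Finset Edge := Finset.Icc N (N + L) ×ˢ Finset.univ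
  have hs : ∀ e : Edge, e ∉ s → f e = 0 ∧ g e = 0 := by
    intro e he
    have : e.1 < N ∨ N + L < e.1 := by
      by_contra hcon
      exact he (Finset.mem_product.2 ⟨Finset.mem_Icc.2 (by omega), Finset.mem_univ _⟩)
    exact ⟨hf_out e this, hg_out e (by omega)⟩
  obtain ⟨u, hu, -⟩ := exists_L2Chain (fun e => (hf e).continuousOn)
    (a := fun e => if e ∈ s then B1 else 0) (fun e => by positivity) (fun e x hx => by
      by_cases he : e ∈ s
      · simpa [he] using hfb e x hx
      · simp [he, (hs e he).1]) (hfin s B1)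
  obtain ⟨w, hw, hwn⟩ := exists_L2Chain (fun e => (hgc e).continuousOn)
    (a := fun e => if e ∈ s then (3 * B1) else 0) (fun e => by positivity) (fun e x hx => by
      by_cases he : e ∈ s
      · simpa [he] using hgb e x hx
      · simp [he, (hs e he).2]) (hfin s (3 * B1))
  refine ⟨u, (E : ℂ) • u + w, ⟨f, f', f'', hf, hu, fun e => ?_, fun j => ?_⟩, ?_, ?_, fun e he => ?_⟩
  · have h1 : ((E : ℂ) • u + w : L2Chain) e = (E : ℂ) • u e + w e := rfl
    rw [h1]
    filter_upwards [Lp.coeFn_add ((E : ℂ) • u e) (w e), Lp.coeFn_smul (E : ℂ) (u e), hu e, hw e]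
      with x h2 h3 h4 h5
    rw [h2, Pi.add_apply, h3, Pi.smul_apply, h4, h5, hact, smul_eq_mul]
  · have q0 : ∀ b, quasiDeriv A' (j, b) (f (j, b)) (f' (j, b)) 0 = window N L j * (z ^ j * d b) := by
      intro b
      refine (quasiDeriv_cut 0).trans ?_
      simp [χ, χ', D]
    have v0 : ∀ b, f (j, b) 0 = window N L j * (z ^ j * p) := by
      intro b; simp [f, χ, P]
    have hjj : (j - 1) + 1 = j := by ring
    by_cases hj : N + 1 ≤ j ∧ j ≤ N + L
    · have hzj : z ^ j = z ^ (j - 1) * z := by rw [← zpow_add_one₀ hz0, hjj]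
      have qπ : ∀ b, quasiDeriv A' (j - 1, b) (f (j - 1, b)) (f' (j - 1, b)) Real.pi =
          z ^ (j - 1) * baseQ b Real.pi := by
        intro b
        refine (quasiDeriv_cut Real.pi).trans ?_
        rw [hsolQ (j - 1) b Real.pi (by omega)]
        simp [χ, χ', hwin1 j hj.1 hj.2]
      have vπ : ∀ b, f (j - 1, b) Real.pi = z ^ j * p := by
        intro b
        simp only [f]
        rw [hsol (j - 1) b Real.pi (by omega), hzj]
        simp only [χ, ramp_pi, hjj, hwin1 j hj.1 hj.2, one_mul, hbase]
        rw [h.right b, mul_assoc]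
      refine ⟨by rw [v0, v0], ?_, ?_, ?_⟩
      · rw [v0, vπ, hwin1 j hj.1 hj.2, one_mul]
      · rw [v0, vπ, hwin1 j hj.1 hj.2, one_mul]
      · rw [q0, q0, qπ, qπ, v0, hwin1 j hj.1 hj.2, hα' j (by omega), hzj]
        linear_combination z ^ (j - 1) * h.jump
    · have hw0 : window N L j = 0 := hwin0 j (by omega)
      have qπ : ∀ b, quasiDeriv A' (j - 1, b) (f (j - 1, b)) (f' (j - 1, b)) Real.pi = 0 := by
        intro b
        refine (quasiDeriv_cut Real.pi).trans ?_
        simp [χ, χ', hw0]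
      have vπ : ∀ b, f (j - 1, b) Real.pi = 0 := by
        intro b; simp [f, χ, hw0]
      refine ⟨by rw [v0, v0], ?_, ?_, ?_⟩
      · rw [v0, vπ, hw0, zero_mul]
      · rw [v0, vπ, hw0, zero_mul]
      · rw [q0, q0, qπ, qπ, v0, hw0]; ring
  · rw [add_sub_cancel_left]
    have hw0 : ∀ e ∉ ({N, N + (L : ℤ)} : Finset ℤ) ×ˢ (Finset.univ : Finset Bool), ‖w e‖ ^ 2 = 0 := by
      intro e he
      have he' : e.1 ≠ N ∧ e.1 ≠ N + L := by
        simpa [Finset.mem_product] using he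
      have : w e = 0 := by
        refine Lp.ext ((hw e).trans ?_)
        rw [hg_out e he']
        exact (Lp.coeFn_zero _ _ _).symm
      rw [this]; simp
    have hle : ‖w‖ ^ 2 ≤ (2 * (2 * (3 * B1))) ^ 2 := by
      rw [norm_sq_eq_tsum, tsum_eq_sum hw0]
      have hcard : (({N, N + (L : ℤ)} : Finset ℤ) ×ˢ (Finset.univ : Finset Bool)).card ≤ 4 := by
        rw [Finset.card_product]
        have := Finset.card_le_two (a := N) (b := N + (L : ℤ))
        simp only [Finset.card_univ, Fintype.card_bool]
        omega
      refine (Finset.sum_le_card_nsmul _ _ ((2 * (3 * B1)) ^ 2) fun e _ => ?_).trans ?_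
      · refine pow_le_pow_left₀ (norm_nonneg _) ((hwn e).trans ?_) 2
        split_ifs <;> linarith
      · rw [nsmul_eq_mul]
        have : ((({N, N + (L : ℤ)} : Finset ℤ) ×ˢ (Finset.univ : Finset Bool)).card : ℝ) ≤ 4 := by
          exact_mod_cast hcard
        nlinarith [sq_nonneg (2 * (3 * B1))]
    exact le_of_sq_le_sq hle (by positivity)
  · rw [norm_sq_eq_tsum]
    -- The `L - 1` rings strictly between the two transition rings carry the full Bloch solution.
    have hnorm : ∀ j ∈ Finset.Icc (N + 1) (N + L - 1), ∀ b, ‖u (j, b)‖ =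
        ‖(memLp_edge (hbc b).continuousOn).toLp‖ := by
      intro j hj b
      rw [Finset.mem_Icc] at hj
      have : u (j, b) = z ^ j • (memLp_edge (hbc b).continuousOn).toLp := by
        refine Lp.ext ?_
        filter_upwards [hu (j, b), Lp.coeFn_smul (z ^ j) (memLp_edge (hbc b).continuousOn).toLp,
          (memLp_edge (hbc b).continuousOn).coeFn_toLp] with x h1 h2 h3
        rw [h1, h2, Pi.smul_apply, h3]
        simp only [f]
        rw [hsol j b x (by omega)]
        simp only [χ, hwin1 j (by omega) (by omega), hwin1 (j + 1) (by omega) (by omega), ramp_self,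
          one_mul, smul_eq_mul]
      rw [this, norm_smul, hzn, one_mul]
    have hcard : ((Finset.Icc (N + 1) (N + L - 1)).card : ℝ) = L - 1 := by
      rw [Int.card_Icc, show N + L - 1 + 1 - (N + 1) = ((L - 1 : ℕ) : ℤ) by omega, Int.toNat_natCast]
      push_cast [hL]; ring
    have := (norm_sq_summable u).sum_le_tsum
      (Finset.Icc (N + 1) (N + L - 1) ×ˢ (Finset.univ : Finset Bool)) (fun e _ => sq_nonneg _)
    refine le_trans (le_of_eq ?_) this
    rw [Finset.sum_product, Finset.sum_congr rfl fun j hj =>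
      Finset.sum_congr rfl fun b _ => by rw [hnorm j hj b], Finset.sum_const, nsmul_eq_mul, hcard,
      mul_comm]
  · refine Lp.ext ((hu e).trans ?_)
    rw [hf_out e he]
    exact (Lp.coeFn_zero _ _ _).symm

/-- The windows start at `(n + 2)²` and have length `n + 2`, so their supports are disjoint and the
truncations orthogonal. Their norms grow while the cutoff errors stay bounded; normalization gives a
singular Weyl sequence. -/
theorem IsBloch.mem_essentialSpectrum (h : IsBloch α A E z p d) :
    E ∈ essentialSpectrum (perturbedHamiltonian α A α₁ A₁) := by
  change E ∈ essentialSpectrum (hamiltonian (fun j => if j = 1 then α₁ else α)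
    fun j => if j = 1 then A₁ else A)
  obtain ⟨B, κ, hκ, hB, hW⟩ := h.exists_window (α₁ := α₁) (A₁ := A₁)
  let N : ℕ → ℤ := fun n => (n + 2) ^ 2
  have hN : ∀ n, 2 ≤ N n := fun n => by simp only [N]; nlinarith [Int.natCast_nonneg n]
  choose u v huv hv hu hz using fun n : ℕ => hW (N n) (n + 2) (hN n) (by omega)
  have hpos : ∀ n, 0 < ‖u n‖ := by
    intro n
    have h1 : 0 < κ * (((n + 2 : ℕ) : ℝ) - 1) := by
      refine mul_pos hκ ?_
      push_cast; linarith [(Nat.cast_nonneg n : (0 : ℝ) ≤ n)]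
    have h2 : 0 < ‖u n‖ ^ 2 := h1.trans_le (hu n)
    rcases (norm_nonneg (u n)).eq_or_lt with h | h
    · rw [← h] at h2; norm_num at h2
    · exact h
  have hort : ∀ m n, m < n → inner ℂ (u m) (u n) = 0 := by
    intro m n hmn
    rw [lp.inner_eq_tsum]
    have : ∀ e, inner ℂ (u m e) (u n e) = 0 := by
      intro e
      by_cases he : N m + (m + 2 : ℕ) < e.1
      · rw [hz m e (Or.inr he), inner_zero_left]
      · rw [hz n e (Or.inl ?_), inner_zero_right]
        have h1 : ((m : ℤ) + 1) ≤ n := by exact_mod_cast hmn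
        have h2 : (0 : ℤ) ≤ m := Int.natCast_nonneg m
        have h3 : N m + (m + 2 : ℕ) < N n := by
          simp only [N]; push_cast; nlinarith
        omega
    simp [this]
  have hort' : ∀ m n, m ≠ n → inner ℂ (u m) (u n) = 0 := by
    intro m n hmn
    rcases lt_or_gt_of_ne hmn with h | h
    · exact hort m n h
    · rw [← inner_conj_symm, hort n m h, map_zero]
  choose x hx hTx using fun n => ((huv n).smul ((‖u n‖⁻¹ : ℝ) : ℂ)).exists_domain
  refine ⟨x, ⟨fun n => ?_, fun m n hmn => ?_⟩, ?_⟩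
  · simp only [hx]
    rw [norm_smul, Complex.norm_real, norm_inv, norm_norm, inv_mul_cancel₀ (hpos n).ne']
  · simp only [hx]
    rw [inner_smul_left, inner_smul_right, hort' m n hmn, mul_zero, mul_zero]
  · have hnorm : ∀ n, ‖hamiltonian (fun j => if j = 1 then α₁ else α)
        (fun j => if j = 1 then A₁ else A) (x n) - (E : ℂ) • (x n : L2Chain)‖ ≤
        B * ‖u n‖⁻¹ := by
      intro n
      rw [hTx, hx, smul_comm, ← smul_sub, norm_smul, Complex.norm_real, norm_inv, norm_norm, mul_comm]
      exact mul_le_mul_of_nonneg_right (hv n) (by positivity)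
    refine squeeze_zero_norm hnorm ?_
    have hinf : Tendsto (fun n => ‖u n‖) atTop atTop := by
      have h1 : Tendsto (fun n : ℕ => √(κ * n)) atTop atTop :=
        Real.tendsto_sqrt_atTop.comp (tendsto_natCast_atTop_atTop.const_mul_atTop hκ)
      refine tendsto_atTop_mono (fun n => ?_) h1
      refine Real.sqrt_le_iff.2 ⟨norm_nonneg _, le_trans ?_ (hu n)⟩
      refine mul_le_mul_of_nonneg_left ?_ hκ.le
      push_cast; linarith
    simpa using hinf.inv_tendsto_atTop.const_mul B

/-- With vanishing vertex values only the jump remains, one linear equation for the two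
quasiderivatives of a ring. A nontrivial solution always exists, whatever `α` and `A` are. -/
theorem mem_essentialSpectrum_of_dirichlet (hs : sn E Real.pi = 0) :
    E ∈ essentialSpectrum (perturbedHamiltonian α A α₁ A₁) := by
  set C : ℂ := ((cs E Real.pi : ℝ) : ℂ)
  set g : Bool → ℂ := fun b => (gauge (fun _ => A) (0, b) Real.pi)⁻¹
  have key : ∃ d : Bool → ℂ, (∃ b, d b ≠ 0) ∧
      d true + d false - g true * (C * d true) - g false * (C * d false) = 0 := by
    by_cases h1 : 1 - C * g true = 0
    · exact ⟨fun b => if b then 1 else 0, ⟨true, by simp⟩, by simp; linear_combination h1⟩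
    · exact ⟨fun b => if b then 1 - C * g false else -(1 - C * g true), ⟨false, by
          simpa only [Bool.false_eq_true, if_false] using neg_ne_zero.2 h1⟩, by simp; ring⟩
  obtain ⟨d, hd0, hd⟩ := key
  refine IsBloch.mem_essentialSpectrum (z := 1) (p := 0) (d := d) ⟨by simp, fun b => ?_, ?_, .inr hd0⟩
  · simp [edgeSol, hs]
  · simp only [edgeSolQuasi, mul_zero, zero_add, one_mul]
    exact hd

/-- `z = exp (i θ)` is a Bloch multiplier as soon as `c cos θ = η`. If `c = 0`, the band condition
forces `η = 0` and any `θ` would do. -/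
theorem mem_essentialSpectrum_of_band (hs : sn E Real.pi ≠ 0)
    (h : |cs E Real.pi + α * sn E Real.pi / 4| ≤ |Real.cos (A * Real.pi)|) :
    E ∈ essentialSpectrum (perturbedHamiltonian α A α₁ A₁) := by
  set C := cs E Real.pi with hC
  set s := sn E Real.pi with hsd
  set c := Real.cos (A * Real.pi) with hc
  obtain ⟨θ, hθ⟩ : ∃ θ : ℝ, c * Real.cos θ = C + α * s / 4 := by
    by_cases hc0 : c = 0
    · rw [hc0, abs_zero] at h
      exact ⟨0, by rw [hc0, abs_nonpos_iff.1 h, zero_mul]⟩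
    · have : |(C + α * s / 4) / c| ≤ 1 := by
        rw [abs_div, div_le_one (abs_pos.2 hc0)]; exact h
      refine ⟨Real.arccos ((C + α * s / 4) / c), ?_⟩
      rw [Real.cos_arccos (abs_le.1 this).1 (abs_le.1 this).2]
      field_simp
  set z := Complex.exp (θ * Complex.I) with hz
  have hz0 : z ≠ 0 := Complex.exp_ne_zero _
  have hzc : z ^ 2 + 1 = 2 * z * Real.cos θ := by
    rw [Complex.ofReal_cos, mul_comm 2 z, mul_assoc, Complex.two_cos, hz, ← Complex.exp_nat_mul,
      mul_add, ← Complex.exp_add, ← Complex.exp_add]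
    congr 1
    · congr 1; push_cast; ring
    · rw [neg_mul, add_neg_cancel, Complex.exp_zero]
  have hs' : (s : ℂ) ≠ 0 := by exact_mod_cast hs
  have hsq : (C : ℂ) ^ 2 + E * s ^ 2 = 1 := by exact_mod_cast cs_sq_add E Real.pi
  refine IsBloch.mem_essentialSpectrum (z := z) (p := 1)
    (d := fun b => (gauge (fun _ => A) (0, b) Real.pi * z - C) / s)
    ⟨Complex.norm_exp_ofReal_mul_I θ, fun b => ?_, ?_, .inl one_ne_zero⟩
  · have := gauge_ne_zero (fun _ => A) (0, b) Real.pi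
    simp only [edgeSol, ← hC, ← hsd]
    field_simp
    ring
  · have g1 := gauge_true_add_gauge_false (fun _ => A) 0 Real.pi
    have hg := gauge_ne_zero (fun _ => A) (0, true) Real.pi
    have hθ' : (c : ℂ) * Real.cos θ = C + α * s / 4 := by exact_mod_cast hθ
    simp only [edgeSolQuasi, gauge_false, inv_inv, ← hC, ← hsd] at g1 ⊢
    rw [← hc] at g1
    set γ := gauge (fun _ => A) (0, true) Real.pi
    have e1 : z * ((γ * z - C) / s + (γ⁻¹ * z - C) / s) - γ⁻¹ * (-E * s * 1 + C * ((γ * z - C) / s)) -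
        γ * (-E * s * 1 + C * ((γ⁻¹ * z - C) / s)) = ((γ + γ⁻¹) * (z ^ 2 + 1) - 4 * C * z) / s := by
      field_simp
      linear_combination (γ ^ 2 + 1) * hsq
    rw [e1, g1, div_eq_iff hs']
    linear_combination (2 * c : ℂ) * hzc + 4 * z * hθ'

theorem mem_essentialSpectrum_iff : E ∈ essentialSpectrum (perturbedHamiltonian α A α₁ A₁) ↔
    sn E Real.pi = 0 ∨ |cs E Real.pi + α * sn E Real.pi / 4| ≤ |Real.cos (A * Real.pi)| := by
  constructor
  · intro h
    by_contra! hcon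
    exact notMem_essentialSpectrum hcon.1 hcon.2 h
  · intro h
    by_cases hs : sn E Real.pi = 0
    · exact mem_essentialSpectrum_of_dirichlet hs
    · exact mem_essentialSpectrum_of_band hs (h.resolve_left hs)

end

section


/-! ### Dependence of the fundamental solutions on the energy -/

theorem hasDerivAt_cs_energy {E : ℝ} (hE : E ≠ 0) :
    HasDerivAt (fun E => cs E Real.pi) (-(Real.pi / 2) * sn E Real.pi) E := by
  rcases lt_or_gt_of_ne hE with h | h
  · have hk : 0 < √(-E) := Real.sqrt_pos.2 (by linarith)
    have e1 : -√(-E) ^ 2 = E := by rw [Real.sq_sqrt (by linarith)]; ring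
    have d1 := ((hasDerivAt_neg E).sqrt (by linarith)).mul_const Real.pi |>.cosh
    have hev : (fun E => cs E Real.pi) =ᶠ[𝓝 E] fun E => Real.cosh (√(-E) * Real.pi) := by
      filter_upwards [gt_mem_nhds h] with F hF
      rw [← cs_neg_sq (Real.sqrt_nonneg _), Real.sq_sqrt (by linarith), neg_neg]
    refine (d1.congr_of_eventuallyEq hev).congr_deriv ?_
    have := sn_neg_sq hk Real.pi
    rw [e1] at this
    rw [this]
    field_simp
  · have hk : 0 < √E := Real.sqrt_pos.2 h
    have e1 : √E ^ 2 = E := Real.sq_sqrt h.le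
    have d1 := ((hasDerivAt_id E).sqrt h.ne').mul_const Real.pi |>.cos
    have hev : (fun E => cs E Real.pi) =ᶠ[𝓝 E] fun E => Real.cos (√E * Real.pi) := by
      filter_upwards [lt_mem_nhds h] with F hF
      rw [← cs_sq (Real.sqrt_nonneg _), Real.sq_sqrt (le_of_lt hF)]
    refine (d1.congr_of_eventuallyEq hev).congr_deriv ?_
    have := sn_sq hk Real.pi
    rw [e1] at this
    rw [this]
    simp only [id]
    field_simp

theorem hasDerivAt_sn_energy {E : ℝ} (hE : E ≠ 0) :
    HasDerivAt (fun E => sn E Real.pi) ((Real.pi * cs E Real.pi - sn E Real.pi) / (2 * E)) E := by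
  rcases lt_or_gt_of_ne hE with h | h
  · have hk : 0 < √(-E) := Real.sqrt_pos.2 (by linarith)
    have e1 : -√(-E) ^ 2 = E := by rw [Real.sq_sqrt (by linarith)]; ring
    have d0 := (hasDerivAt_neg E).sqrt (by linarith : -E ≠ 0)
    have d1 := (d0.mul_const Real.pi).sinh.div d0 hk.ne'
    have hev : (fun E => sn E Real.pi) =ᶠ[𝓝 E] fun E => Real.sinh (√(-E) * Real.pi) / √(-E) := by
      filter_upwards [gt_mem_nhds h] with F hF
      rw [← sn_neg_sq (Real.sqrt_pos.2 (by linarith)), Real.sq_sqrt (by linarith), neg_neg]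
    refine (d1.congr_of_eventuallyEq hev).congr_deriv ?_
    have h1 := sn_neg_sq hk Real.pi
    have h2 := cs_neg_sq hk.le Real.pi
    rw [e1] at h1 h2
    rw [h1, h2]
    set k := √(-E)
    rw [← e1]
    field_simp
    ring
  · have hk : 0 < √E := Real.sqrt_pos.2 h
    have e1 : √E ^ 2 = E := Real.sq_sqrt h.le
    have d0 := (hasDerivAt_id E).sqrt h.ne'
    have d1 := (d0.mul_const Real.pi).sin.div d0 hk.ne'
    have hev : (fun E => sn E Real.pi) =ᶠ[𝓝 E] fun E => Real.sin (√E * Real.pi) / √E := by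
      filter_upwards [lt_mem_nhds h] with F hF
      rw [← sn_sq (Real.sqrt_pos.2 hF), Real.sq_sqrt (le_of_lt hF)]
    refine (d1.congr_of_eventuallyEq hev).congr_deriv ?_
    have h1 := sn_sq hk Real.pi
    have h2 := cs_sq hk.le Real.pi
    rw [e1] at h1 h2
    rw [h1, h2]
    simp only [id]
    set k := √E
    rw [← e1]
    field_simp

/-- The Dirichlet-to-Neumann matrix is strictly monotone. -/
theorem abs_mul_cs_sub_sn_lt {E : ℝ} (hE : E ≠ 0) (hs : sn E Real.pi ≠ 0) :
    |(Real.pi * cs E Real.pi - sn E Real.pi) / E| <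
      (Real.pi - sn E Real.pi * cs E Real.pi) / E := by
  have hpi := Real.pi_pos
  -- The two factored inequalities are the two halves of the absolute value. For `E > 0` one has
  -- `|cs| < 1` and `|sn| < π`; for `E < 0` both `cs > 1` and `sn > π`, and dividing by the negative
  -- energy restores the sign.
  have key : 0 < (1 - cs E Real.pi) * (Real.pi + sn E Real.pi) / E ∧
      0 < (1 + cs E Real.pi) * (Real.pi - sn E Real.pi) / E := by
    rcases sq_cases E with ⟨k, hk, rfl⟩ | rfl | ⟨k, hk, rfl⟩
    · have hsq := cs_sq_add (k ^ 2) Real.pi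
      have h1 : cs (k ^ 2) Real.pi ^ 2 < 1 := by
        have : 0 < k ^ 2 * sn (k ^ 2) Real.pi ^ 2 := by positivity
        linarith
      have h2 := abs_lt.1 ((sq_lt_one_iff_abs_lt_one _).1 h1)
      have h3 : |sn (k ^ 2) Real.pi| < Real.pi := by
        rw [sn_sq hk, abs_div, abs_of_pos hk, div_lt_iff₀ hk, mul_comm Real.pi k]
        have := Real.abs_sin_lt_abs (x := k * Real.pi) (by positivity)
        rwa [abs_of_pos (by positivity : 0 < k * Real.pi)] at this
      have h4 := abs_lt.1 h3
      constructor
      · exact div_pos (mul_pos (by linarith) (by linarith)) (by positivity)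
      · exact div_pos (mul_pos (by linarith) (by linarith)) (by positivity)
    · exact absurd rfl hE
    · have h1 : 1 < cs (-k ^ 2) Real.pi := by
        rw [cs_neg_sq hk.le]; exact Real.one_lt_cosh.2 (by positivity)
      have h2 : Real.pi < sn (-k ^ 2) Real.pi := by
        rw [sn_neg_sq hk, lt_div_iff₀ hk, mul_comm]
        exact Real.self_lt_sinh_iff.2 (by positivity)
      have hk2 : -k ^ 2 < 0 := by have : 0 < k ^ 2 := by positivity
                                  linarith
      constructor
      · exact div_pos_of_neg_of_neg (mul_neg_of_neg_of_pos (by linarith) (by linarith)) hk2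
      · exact div_pos_of_neg_of_neg (mul_neg_of_pos_of_neg (by linarith) (by linarith)) hk2
  set C := cs E Real.pi
  set s := sn E Real.pi
  have e1 : (1 - C) * (Real.pi + s) / E = (Real.pi - s * C) / E - (Real.pi * C - s) / E := by ring
  have e2 : (1 + C) * (Real.pi - s) / E = (Real.pi - s * C) / E + (Real.pi * C - s) / E := by ring
  rw [abs_lt]
  constructor <;> linarith [key.1, key.2]

/-- The energy derivatives are written with a division by `E`. Continuity bridges `E = 0`:
monotonicity is proved on either side and glued there. -/
theorem strictMonoOn_of_hasDerivAt_pos {f f' : ℝ → ℝ} {I : Set ℝ} (hI : Convex ℝ I)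
    (hc : ContinuousOn f I) (hd : ∀ x ∈ interior I, x ≠ 0 → HasDerivAt f (f' x) x ∧ 0 < f' x) :
    StrictMonoOn f I := by
  have h1 : StrictMonoOn f (I ∩ Set.Iic 0) := by
    refine strictMonoOn_of_deriv_pos (hI.inter (convex_Iic 0)) (hc.mono Set.inter_subset_left) ?_
    intro x hx
    rw [interior_inter, interior_Iic] at hx
    obtain ⟨h1, h2⟩ := hd x hx.1 hx.2.ne
    rwa [h1.deriv]
  have h2 : StrictMonoOn f (I ∩ Set.Ici 0) := by
    refine strictMonoOn_of_deriv_pos (hI.inter (convex_Ici 0)) (hc.mono Set.inter_subset_left) ?_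
    intro x hx
    rw [interior_inter, interior_Ici] at hx
    obtain ⟨h1, h2⟩ := hd x hx.1 (ne_of_gt hx.2)
    rwa [h1.deriv]
  intro x hx y hy hxy
  rcases le_or_gt y 0 with h | h
  · exact h1 ⟨hx, (hxy.le.trans h)⟩ ⟨hy, h⟩ hxy
  · rcases le_or_gt 0 x with h' | h'
    · exact h2 ⟨hx, h'⟩ ⟨hy, h.le⟩ hxy
    · have h0 : (0 : ℝ) ∈ I := hI.ordConnected.out hx hy ⟨h'.le, h.le⟩
      exact (h1 ⟨hx, h'.le⟩ ⟨h0, Set.mem_Iic.2 le_rfl⟩ h').trans (h2 ⟨h0, Set.mem_Ici.2 le_rfl⟩ ⟨hy, h.le⟩ h)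

/-! ### The discriminant -/

/-- The discriminant of the chain: the bands are given by `|eta α E| ≤ |cos (A π)|`. -/
def eta (α E : ℝ) : ℝ := cs E Real.pi + α * sn E Real.pi / 4

theorem continuous_eta (α : ℝ) : Continuous (eta α) := by
  have := continuous_cs_left Real.pi
  have := continuous_sn_left Real.pi
  unfold eta; fun_prop

theorem hasDerivAt_eta {α E : ℝ} (hE : E ≠ 0) : HasDerivAt (eta α)
    (-(Real.pi / 2) * sn E Real.pi + α * ((Real.pi * cs E Real.pi - sn E Real.pi) / (2 * E)) / 4) E :=
  (hasDerivAt_cs_energy hE).add (((hasDerivAt_sn_energy hE).const_mul α).div_const 4)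

/-- Dividing by `sn` turns the `α` term into a constant. The rest of the derivative has a definite
sign by `abs_mul_cs_sub_sn_lt`, because `|x| ≤ 1`. -/
theorem strictAntiOn_eta_sub_div {α x : ℝ} (hx : |x| ≤ 1) {I : Set ℝ} (hI : Convex ℝ I)
    (hs : ∀ E ∈ I, sn E Real.pi ≠ 0) : StrictAntiOn (fun E => (eta α E - x) / sn E Real.pi) I := by
  have hsc := continuous_sn_left Real.pi
  have hec := continuous_eta α
  have : StrictMonoOn (fun E => -((eta α E - x) / sn E Real.pi)) I := by
    refine strictMonoOn_of_hasDerivAt_pos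
      (f' := fun E => ((Real.pi - sn E Real.pi * cs E Real.pi) / E -
        x * ((Real.pi * cs E Real.pi - sn E Real.pi) / E)) / (2 * sn E Real.pi ^ 2)) hI ?_ ?_
    · exact (((hec.sub continuous_const).continuousOn).div hsc.continuousOn hs).neg
    · intro E hEI hE
      have hsE := hs E (interior_subset hEI)
      constructor
      · refine ((((hasDerivAt_eta hE).sub_const x).div (hasDerivAt_sn_energy hE) hsE).neg).congr_deriv ?_
        have hsq := cs_sq_add E Real.pi
        simp only [eta]
        field_simp
        linear_combination 4 * Real.pi * hsq
      · refine div_pos ?_ (by positivity)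
        have h1 := abs_mul_cs_sub_sn_lt hE hsE
        set X := (Real.pi * cs E Real.pi - sn E Real.pi) / E
        have h2 : x * X ≤ |X| := by
          refine (le_abs_self _).trans ?_
          rw [abs_mul]
          nlinarith [abs_nonneg X]
        linarith
  intro E hE F hF hEF
  have := this hE hF hEF
  simp only at this
  simp only
  linarith

/-- The root of larger modulus of `μ + c² / μ = 2 η`, if `σ` is the sign of `η`. -/
def mu (α c σ E : ℝ) : ℝ := eta α E + σ * √(eta α E ^ 2 - c ^ 2)

theorem continuous_mu (α c σ : ℝ) : Continuous (mu α c σ) := by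
  have := continuous_eta α
  unfold mu; fun_prop

section

variable {α c σ E : ℝ}

theorem mu_quadratic (hσ : σ = 1 ∨ σ = -1) (h : |c| ≤ σ * eta α E) :
    mu α c σ E ^ 2 + c ^ 2 = 2 * eta α E * mu α c σ E := by
  have hσ2 : σ ^ 2 = 1 := by rcases hσ with rfl | rfl <;> norm_num
  have h0 : 0 ≤ eta α E ^ 2 - c ^ 2 := by
    have := pow_le_pow_left₀ (abs_nonneg c) h 2
    rw [sq_abs, mul_pow, hσ2] at this
    linarith
  have := Real.sq_sqrt h0
  rw [mu]
  linear_combination this * σ ^ 2 + (eta α E ^ 2 - c ^ 2) * hσ2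

theorem le_sigma_mul_mu (hσ : σ = 1 ∨ σ = -1) : σ * eta α E ≤ σ * mu α c σ E := by
  have hσ2 : σ ^ 2 = 1 := by rcases hσ with rfl | rfl <;> norm_num
  have : σ * mu α c σ E = σ * eta α E + √(eta α E ^ 2 - c ^ 2) := by
    rw [mu]; linear_combination √(eta α E ^ 2 - c ^ 2) * hσ2
  rw [this]
  linarith [Real.sqrt_nonneg (eta α E ^ 2 - c ^ 2)]

theorem abs_mu (hσ : σ = 1 ∨ σ = -1) (h : |c| ≤ σ * eta α E) : |mu α c σ E| = σ * mu α c σ E := by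
  have h1 : 0 ≤ σ * mu α c σ E := (abs_nonneg c).trans (h.trans (le_sigma_mul_mu hσ))
  rcases hσ with rfl | rfl
  · rw [one_mul] at h1 ⊢; exact abs_of_nonneg h1
  · rw [neg_one_mul] at h1 ⊢; exact abs_of_nonpos (by linarith)

/-- The quotient rule for `(t - m²) / (s m)`: `y` stands for the derivative of the discriminant, `X
/ 2` for that of `s`, and `y σ m / w` for that of `m`. Eliminating `η`, `w` and `y` leaves an
expression to which `abs_mul_cs_sub_sn_lt` applies. -/
theorem zeta_deriv_algebra {s m w η X Y y t : ℝ} (hs : s ≠ 0) (hm : m ≠ 0) (hmc : m ^ 2 - c ^ 2 ≠ 0)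
    (hy : s * y = (η * X - Y) / 2) (hw : w = σ * (m - η)) (hq : m ^ 2 + c ^ 2 = 2 * η * m)
    (hσ : σ = 1 ∨ σ = -1) :
    (-(2 * m * (y * σ * m / w)) * (s * m) - (t - m ^ 2) * (X / 2 * m + s * (y * σ * m / w))) /
      (s * m) ^ 2 = (Y * (m ^ 2 + t) - X * (m * (c ^ 2 + t))) / (2 * s ^ 2 * (σ * m * w)) := by
  have hη : η = (m ^ 2 + c ^ 2) / (2 * m) := by rw [hq]; field_simp
  have hw' : w = σ * ((m ^ 2 - c ^ 2) / (2 * m)) := by rw [hw, hη]; field_simp; ring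
  have hy' : y = (η * X - Y) / (2 * s) := by field_simp; linear_combination 2 * hy
  rw [hw', hy', hη]
  rcases hσ with rfl | rfl
  · field_simp
    ring
  · field_simp
    ring

/-- The eigenvalue condition as an equation for the strength of the perturbation. -/
theorem strictMonoOn_zeta {t : ℝ} (hσ : σ = 1 ∨ σ = -1) (hc : |c| < 1) (ht0 : 0 ≤ t) (ht1 : t ≤ 1)
    {I : Set ℝ} (hI : Convex ℝ I) (hs : ∀ E ∈ I, sn E Real.pi ≠ 0) (hμ : ∀ E ∈ I, mu α c σ E ≠ 0)
    (hη : ∀ E ∈ interior I, |c| < σ * eta α E) :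
    StrictMonoOn (fun E => (t - mu α c σ E ^ 2) / (sn E Real.pi * mu α c σ E)) I := by
  have hsc := continuous_sn_left Real.pi
  have hmc := continuous_mu α c σ
  have hσ2 : σ ^ 2 = 1 := by rcases hσ with rfl | rfl <;> norm_num
  refine strictMonoOn_of_hasDerivAt_pos
    (f' := fun E => ((Real.pi - sn E Real.pi * cs E Real.pi) / E * (mu α c σ E ^ 2 + t) -
      (Real.pi * cs E Real.pi - sn E Real.pi) / E * (mu α c σ E * (c ^ 2 + t))) /
      (2 * sn E Real.pi ^ 2 * (σ * mu α c σ E * √(eta α E ^ 2 - c ^ 2)))) hI ?_ ?_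
  · exact ((continuous_const.sub (hmc.pow 2)).continuousOn).div (hsc.mul hmc).continuousOn
      fun E hE => mul_ne_zero (hs E hE) (hμ E hE)
  · intro E hEI hE
    have hsE := hs E (interior_subset hEI)
    have hμE := hμ E (interior_subset hEI)
    have hηE := hη E hEI
    have h0 : 0 < eta α E ^ 2 - c ^ 2 := by
      have := pow_lt_pow_left₀ hηE (abs_nonneg c) two_ne_zero
      rw [sq_abs, mul_pow, hσ2] at this
      linarith
    have hq := mu_quadratic hσ hηE.le
    have habs := abs_mu hσ hηE.le
    have hlow : |c| < |mu α c σ E| := by rw [habs]; exact hηE.trans_le (le_sigma_mul_mu hσ)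
    have hw : 0 < √(eta α E ^ 2 - c ^ 2) := Real.sqrt_pos.2 h0
    have hmudef : mu α c σ E = eta α E + σ * √(eta α E ^ 2 - c ^ 2) := rfl
    have dη := hasDerivAt_eta (α := α) hE
    have dμ : HasDerivAt (mu α c σ) ((-(Real.pi / 2) * sn E Real.pi + α * ((Real.pi * cs E Real.pi -
        sn E Real.pi) / (2 * E)) / 4) * σ * mu α c σ E / √(eta α E ^ 2 - c ^ 2)) E := by
      refine (dη.add ((((dη.fun_pow 2).sub_const (c ^ 2)).sqrt h0.ne').const_mul σ)).congr_deriv ?_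
      rw [hmudef]
      generalize -(Real.pi / 2) * sn E Real.pi + α * ((Real.pi * cs E Real.pi -
        sn E Real.pi) / (2 * E)) / 4 = y
      set w := √(eta α E ^ 2 - c ^ 2)
      norm_num
      field_simp
      linear_combination (-(y * w)) * hσ2
    constructor
    · refine (((dμ.fun_pow 2).const_sub t).div ((hasDerivAt_sn_energy hE).mul dμ)
        (mul_ne_zero hsE hμE)).congr_deriv ?_
      have hsq := cs_sq_add E Real.pi
      have hC : cs E Real.pi = eta α E - α * sn E Real.pi / 4 := by rw [eta]; ring
      have hww : √(eta α E ^ 2 - c ^ 2) = σ * (mu α c σ E - eta α E) := by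
        rw [hmudef]; linear_combination (-√(eta α E ^ 2 - c ^ 2)) * hσ2
      have hne : mu α c σ E ^ 2 - c ^ 2 ≠ 0 := by
        have := sq_lt_sq.2 hlow
        linarith
      refine Eq.trans ?_ (zeta_deriv_algebra (y := -(Real.pi / 2) * sn E Real.pi + α * ((Real.pi *
        cs E Real.pi - sn E Real.pi) / (2 * E)) / 4) (c := c) (t := t) (w := √(eta α E ^ 2 - c ^ 2))
        (η := eta α E) hsE hμE hne ?_ hww hq hσ)
      · simp only [Pi.mul_apply, Nat.cast_ofNat, Nat.add_one_sub_one, pow_one]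
        ring
      · rw [eta]
        field_simp
        linear_combination (-4 * Real.pi) * hsq
    · refine div_pos ?_ (by rw [← habs]; positivity)
      have h1 := abs_mul_cs_sub_sn_lt hE hsE
      set X := (Real.pi * cs E Real.pi - sn E Real.pi) / E
      set Y := (Real.pi - sn E Real.pi * cs E Real.pi) / E
      set m := mu α c σ E
      have hm0 : 0 < |m| := abs_pos.2 hμE
      -- For `|m| ≥ 1` use `c² ≤ 1` and `t ≤ 1`; for `|m| < 1` use `c² ≤ m²`, which holds because
      -- `m` is the larger root.
      have h2 : |m| * (c ^ 2 + t) ≤ m ^ 2 + t := by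
        rw [← sq_abs m, ← sq_abs c]
        rcases le_or_gt 1 |m| with h | h
        · have : |c| ^ 2 ≤ 1 := by nlinarith [abs_nonneg c]
          nlinarith
        · have : |c| ^ 2 ≤ |m| ^ 2 := by nlinarith [abs_nonneg c]
          nlinarith
      have h3 : X * (m * (c ^ 2 + t)) ≤ |X| * (m ^ 2 + t) := by
        refine (le_abs_self _).trans ?_
        rw [abs_mul, abs_mul, abs_of_nonneg (by positivity : 0 ≤ c ^ 2 + t)]
        exact mul_le_mul_of_nonneg_left h2 (abs_nonneg _)
      have h4 : |X| * (m ^ 2 + t) < Y * (m ^ 2 + t) :=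
        mul_lt_mul_of_pos_right h1 (by positivity)
      linarith

end

end

section


/-! ### Band edges -/

/-- The interval between consecutive Dirichlet eigenvalues `n²` and `(n + 1)²`; the lowest one
extends to `-∞`. -/
def dirichletInterval (n : ℕ) : Set ℝ := {E | (n = 0 ∨ (n : ℝ) ^ 2 < E) ∧ E < ((n : ℝ) + 1) ^ 2}

theorem convex_dirichletInterval (n : ℕ) : Convex ℝ (dirichletInterval n) := by
  refine Set.OrdConnected.convex ⟨fun x hx y hy z hz => ⟨?_, hz.2.trans_lt hy.2⟩⟩
  exact hx.1.imp id fun h => h.trans_le hz.1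

theorem sn_sign {n : ℕ} {E : ℝ} (hE : E ∈ dirichletInterval n) : 0 < (-1) ^ n * sn E Real.pi := by
  have hpi := Real.pi_pos
  obtain ⟨h1, h2⟩ := hE
  rcases sq_cases E with ⟨k, hk, rfl⟩ | rfl | ⟨k, hk, rfl⟩
  · have hk2 : k < n + 1 := lt_of_pow_lt_pow_left₀ 2 (by positivity) h2
    have hk1 : (n : ℝ) < k := by
      rcases h1 with rfl | h1
      · simpa using hk
      · exact lt_of_pow_lt_pow_left₀ 2 hk.le h1
    rw [sn_sq hk, ← mul_div_assoc, ← Real.sin_sub_nat_mul_pi]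
    refine div_pos (Real.sin_pos_of_pos_of_lt_pi ?_ ?_) hk
    · nlinarith
    · nlinarith
  · rcases h1 with rfl | h1
    · simpa [sn_zero_left] using hpi
    · exact absurd h1 (not_lt.2 (sq_nonneg _))
  · rcases h1 with rfl | h1
    · rw [sn_neg_sq hk, pow_zero, one_mul]
      exact div_pos (Real.sinh_pos_iff.2 (by positivity)) hk
    · have : 0 < k ^ 2 := by positivity
      exact absurd h1 (not_lt.2 (by linarith [sq_nonneg (n : ℝ)]))

theorem sn_ne_zero {n : ℕ} {E : ℝ} (hE : E ∈ dirichletInterval n) : sn E Real.pi ≠ 0 := by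
  have := sn_sign hE
  intro h
  simp [h] at this

/-- The sine is at most one and `√E ≥ n`. This decay makes the exceptional sets of gaps finite. -/
theorem abs_sn_le {n : ℕ} (hn : 1 ≤ n) {E : ℝ} (hE : E ∈ dirichletInterval n) :
    |sn E Real.pi| ≤ 1 / n := by
  have hn' : (0 : ℝ) < n := by exact_mod_cast hn
  have h1 : (n : ℝ) ^ 2 < E := hE.1.resolve_left (by omega)
  have hE0 : 0 < E := (by positivity : (0 : ℝ) < n ^ 2).trans h1
  have hk : 0 < √E := Real.sqrt_pos.2 hE0
  have hnk : (n : ℝ) ≤ √E := Real.le_sqrt_of_sq_le h1.le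
  rw [← Real.sq_sqrt hE0.le, sn_sq hk, abs_div, abs_of_pos hk]
  exact div_le_div₀ zero_le_one (Real.abs_sin_le_one _) hn' hnk

theorem sn_nat_sq {n : ℕ} (hn : 1 ≤ n) : sn ((n : ℝ) ^ 2) Real.pi = 0 := by
  rw [sn_sq (by exact_mod_cast hn), Real.sin_nat_mul_pi, zero_div]

theorem cs_nat_sq (n : ℕ) : cs ((n : ℝ) ^ 2) Real.pi = (-1) ^ n := by
  rw [cs_sq (Nat.cast_nonneg n), Real.cos_nat_mul_pi]

theorem eta_nat_sq {n : ℕ} (hn : 1 ≤ n) (α : ℝ) : eta α ((n : ℝ) ^ 2) = (-1) ^ n := by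
  rw [eta, cs_nat_sq, sn_nat_sq hn]; ring

/-- Every energy which is not a Dirichlet eigenvalue lies in a Dirichlet interval. -/
theorem exists_dirichletInterval (E : ℝ) :
    (∃ n : ℕ, E ∈ dirichletInterval n) ∨ ∃ n : ℕ, 1 ≤ n ∧ E = (n : ℝ) ^ 2 := by
  rcases lt_or_ge E 1 with h | h
  · exact .inl ⟨0, .inl rfl, by simpa using h⟩
  · have h0 : 0 ≤ E := by linarith
    have hsq := Real.sq_sqrt h0
    have h1 : (⌊√E⌋₊ : ℝ) ≤ √E := Nat.floor_le (Real.sqrt_nonneg _)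
    have h2 : √E < ⌊√E⌋₊ + 1 := Nat.lt_floor_add_one _
    rcases h1.eq_or_lt with h3 | h3
    · refine .inr ⟨⌊√E⌋₊, ?_, by rw [h3, hsq]⟩
      exact Nat.le_floor (by simpa using Real.one_le_sqrt.2 h)
    · refine .inl ⟨⌊√E⌋₊, .inr ?_, ?_⟩
      · exact (pow_lt_pow_left₀ h3 (Nat.cast_nonneg _) two_ne_zero).trans_eq hsq
      · calc E = √E ^ 2 := hsq.symm
          _ < _ := pow_lt_pow_left₀ h2 (Real.sqrt_nonneg _) two_ne_zero

/-- For very negative energies the discriminant is large and dominates `sn`. -/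
theorem exists_eta_large (α b : ℝ) :
    ∃ E < 0, 2 ≤ eta α E ∧ 1 ≤ eta α E + b * sn E Real.pi := by
  set m := |α| / 4 + |b| with hm
  -- At energy `-k²` one has `k * sn ≤ cosh`, so `k ≥ 2 m` makes all terms with `sn` at most half of
  -- `cosh (k π)`. The summand `3` ensures `cosh (k π) ≥ 4`.
  set k := 2 * m + 3 with hk
  have hm0 : 0 ≤ m := by positivity
  have hk0 : 0 < k := by positivity
  have hpi := Real.pi_gt_three
  have hC : 4 ≤ Real.cosh (k * Real.pi) := by
    have h1 : 9 ≤ k * Real.pi := by nlinarith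
    have h2 := Real.add_one_le_exp (k * Real.pi)
    rw [Real.cosh_eq]
    linarith [Real.exp_pos (-(k * Real.pi))]
  have hs : k * sn (-k ^ 2) Real.pi ≤ Real.cosh (k * Real.pi) := by
    rw [sn_neg_sq hk0, mul_div_cancel₀ _ hk0.ne']
    exact (Real.sinh_lt_cosh _).le
  have hs0 : 0 ≤ sn (-k ^ 2) Real.pi := by
    rw [sn_neg_sq hk0]
    exact div_nonneg (Real.sinh_nonneg_iff.2 (by positivity)) hk0.le
  refine ⟨-k ^ 2, by have : 0 < k ^ 2 := by positivity
                     linarith, ?_, ?_⟩ <;>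
    rw [eta, cs_neg_sq hk0.le] <;> set C := Real.cosh (k * Real.pi) <;>
    set s := sn (-k ^ 2) Real.pi
  · have : -(m * s) ≤ α * s / 4 := by
      have := mul_le_mul_of_nonneg_right (neg_abs_le α) hs0
      have := mul_nonneg (abs_nonneg b) hs0
      rw [hm]; linarith
    have : m * s ≤ C / 2 := by rw [hk] at hs; nlinarith
    linarith
  · have : -(m * s) ≤ α * s / 4 + b * s := by
      have := mul_le_mul_of_nonneg_right (neg_abs_le α) hs0
      have := mul_le_mul_of_nonneg_right (neg_abs_le b) hs0
      rw [hm]; linarith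
    have : m * s ≤ C / 2 := by rw [hk] at hs; nlinarith
    linarith

/-- The sign of `(-1) ^ n * eta α E - x` is that of `(eta α E - (-1) ^ n * x) / sn E π`, which is
strictly decreasing on the interval; the intermediate value theorem provides its zero. The
discriminant itself need not be monotone there. -/
theorem exists_band_edge (α : ℝ) (n : ℕ) {x : ℝ} (hx : |x| < 1) : ∃ e ∈ dirichletInterval n,
    ∀ E ∈ dirichletInterval n, (x < (-1) ^ n * eta α E ↔ E < e) ∧ ((-1) ^ n * eta α E < x ↔ e < E) := by
  have hε : ((-1 : ℝ) ^ n) * (-1) ^ n = 1 := by rw [← mul_pow]; norm_num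
  have hcont : Continuous fun E => (-1) ^ n * eta α E := continuous_const.mul (continuous_eta α)
  obtain ⟨hx1, hx2⟩ := abs_lt.1 hx
  have hup : (-1 : ℝ) ^ n * eta α (((n + 1 : ℕ) : ℝ) ^ 2) = -1 := by
    rw [eta_nat_sq (by omega), pow_succ]; linear_combination -hε
  obtain ⟨E0, hE0, hE0'⟩ : ∃ E0 : ℝ, (n = 0 ∨ (n : ℝ) ^ 2 ≤ E0) ∧
      E0 < ((n + 1 : ℕ) : ℝ) ^ 2 ∧ x < (-1) ^ n * eta α E0 := by
    rcases Nat.eq_zero_or_pos n with rfl | hn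
    · obtain ⟨E0, h1, h2, -⟩ := exists_eta_large α 0
      exact ⟨E0, .inl rfl, by norm_num; linarith, by norm_num; linarith⟩
    · refine ⟨(n : ℝ) ^ 2, .inr le_rfl, ?_, ?_⟩
      · exact pow_lt_pow_left₀ (by push_cast; linarith) (Nat.cast_nonneg n) two_ne_zero
      · rw [eta_nat_sq hn, hε]; exact hx2
  obtain ⟨e, he, hex⟩ : ∃ e ∈ Set.Ioo E0 (((n + 1 : ℕ) : ℝ) ^ 2), (-1) ^ n * eta α e = x :=
    intermediate_value_Ioo' hE0'.1.le hcont.continuousOn ⟨by rw [hup]; exact hx1, hE0'.2⟩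
  have heJ : e ∈ dirichletInterval n :=
    ⟨hE0.imp id fun h => h.trans_lt he.1, by exact_mod_cast he.2⟩
  have hanti := strictAntiOn_eta_sub_div (α := α) (x := (-1) ^ n * x)
    (by rw [abs_mul, abs_pow, abs_neg, abs_one, one_pow, one_mul]; exact hx.le)
    (convex_dirichletInterval n) fun E hE => sn_ne_zero hE
  have hform : ∀ E ∈ dirichletInterval n, (eta α E - (-1) ^ n * x) / sn E Real.pi =
      ((-1) ^ n * eta α E - x) / ((-1) ^ n * sn E Real.pi) := by
    intro E hE
    have h1 := sn_ne_zero hE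
    have h2 : ((-1 : ℝ) ^ n) ≠ 0 := by positivity
    rw [div_eq_div_iff h1 (mul_ne_zero h2 h1)]
    linear_combination (-x * sn E Real.pi) * hε
  have hzero : (eta α e - (-1) ^ n * x) / sn e Real.pi = 0 := by
    rw [hform e heJ, hex, sub_self, zero_div]
  have hlt : ∀ E ∈ dirichletInterval n, E < e → x < (-1) ^ n * eta α E := by
    intro E hE h
    have := hanti hE heJ h
    simp only [hzero, hform E hE] at this
    have := (div_pos_iff_of_pos_right (sn_sign hE)).1 this
    linarith
  have hgt : ∀ E ∈ dirichletInterval n, e < E → (-1) ^ n * eta α E < x := by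
    intro E hE h
    have := hanti heJ hE h
    simp only [hzero, hform E hE] at this
    rw [div_lt_iff₀ (sn_sign hE), zero_mul] at this
    linarith
  refine ⟨e, heJ, fun E hE => ⟨⟨fun h => ?_, hlt E hE⟩, ⟨fun h => ?_, hgt E hE⟩⟩⟩
  · by_contra! hcon
    rcases hcon.eq_or_lt with rfl | hcon
    · exact h.ne' hex
    · exact (hgt E hE hcon).not_gt h
  · by_contra! hcon
    rcases hcon.eq_or_lt with rfl | hcon
    · exact h.ne hex
    · exact (hlt E hE hcon).not_gt h

/-! ### Eigenvalues in a gap -/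

/-- A gap `I` with band edge `e`: `σ` is the sign of the discriminant on `I`, and `τ = 1` if the
edge lies above, `τ = -1` if it lies below the gap. -/
structure GapData (α c σ τ e : ℝ) (I : Set ℝ) : Prop where
  sigma : σ = 1 ∨ σ = -1
  tau : τ = 1 ∨ τ = -1
  convex : Convex ℝ (insert e I)
  interior_subset : interior (insert e I) ⊆ I
  sign : ∀ E ∈ insert e I, 0 < τ * σ * sn E Real.pi
  gap : ∀ E ∈ I, |c| < σ * eta α E
  edge : σ * eta α e = |c|
  side : ∀ E ∈ I, 0 < τ * (e - E)
  far : ∀ b, ∃ E₀, 0 < τ * (e - E₀) ∧ (∀ E, 0 < τ * (e - E) → 0 < τ * (E - E₀) → E ∈ I) ∧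
    1 < mu α c σ E₀ * (mu α c σ E₀ + b * sn E₀ Real.pi)

namespace GapData

variable {α A α₁ A₁ σ τ e : ℝ} {I : Set ℝ}

theorem sn_ne_zero {c : ℝ} (h : GapData α c σ τ e I) {E : ℝ} (hE : E ∈ insert e I) :
    sn E Real.pi ≠ 0 := by
  intro h0
  have := h.sign E hE
  simp [h0] at this

theorem abs_lt_abs_mu {c : ℝ} (h : GapData α c σ τ e I) {E : ℝ} (hE : E ∈ I) :
    |c| < |mu α c σ E| := by
  rw [abs_mu h.sigma (h.gap E hE).le]
  exact (h.gap E hE).trans_le (le_sigma_mul_mu h.sigma)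

theorem mu_edge {c : ℝ} (h : GapData α c σ τ e I) : mu α c σ e = eta α e ∧ eta α e ^ 2 = c ^ 2 := by
  have hσ2 : σ ^ 2 = 1 := by rcases h.sigma with rfl | rfl <;> norm_num
  have h1 : eta α e ^ 2 = c ^ 2 := by
    rw [← sq_abs c, ← h.edge]; linear_combination -(eta α e ^ 2) * hσ2
  refine ⟨?_, h1⟩
  rw [mu, h1, sub_self, Real.sqrt_zero, mul_zero, add_zero]

/-- At the edge the square root in `mu` vanishes, and `sn` has the sign `τ σ`. The resulting factor
`τ` is what distinguishes odd from even gaps. -/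
theorem phi_edge {c : ℝ} (h : GapData α c σ τ e I) (b : ℝ) :
    mu α c σ e * (mu α c σ e + b * sn e Real.pi) = c ^ 2 + τ * b * |c| * |sn e Real.pi| := by
  obtain ⟨h1, h2⟩ := h.mu_edge
  have hσ2 : σ ^ 2 = 1 := by rcases h.sigma with rfl | rfl <;> norm_num
  have hτ2 : τ ^ 2 = 1 := by rcases h.tau with rfl | rfl <;> norm_num
  have h3 : |sn e Real.pi| = τ * σ * sn e Real.pi := by
    have := h.sign e (Set.mem_insert _ _)
    rw [← abs_of_pos this, abs_mul, abs_mul]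
    rcases h.sigma with rfl | rfl <;> rcases h.tau with rfl | rfl <;> simp
  rw [h1, h3, ← h.edge]
  linear_combination h2 - σ ^ 2 * b * eta α e * sn e Real.pi * hτ2 - b * eta α e * sn e Real.pi * hσ2

/-- The eigenvalues in a gap are the solutions of an equation, and they are simple. -/
theorem eigenvalue_iff (h : GapData α (Real.cos (A * Real.pi)) σ τ e I) {E : ℝ} (hE : E ∈ I) :
    (HasEigenvalue (perturbedHamiltonian α A α₁ A₁) E →
      mu α (Real.cos (A * Real.pi)) σ E * (mu α (Real.cos (A * Real.pi)) σ E +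
        (α₁ - α) / 2 * sn E Real.pi) = Real.cos (A₁ * Real.pi) ^ 2) ∧
    (mu α (Real.cos (A * Real.pi)) σ E * (mu α (Real.cos (A * Real.pi)) σ E +
        (α₁ - α) / 2 * sn E Real.pi) = Real.cos (A₁ * Real.pi) ^ 2 →
      HasSimpleEigenvalue (perturbedHamiltonian α A α₁ A₁) E) := by
  have hlt := h.abs_lt_abs_mu hE
  have hμ : mu α (Real.cos (A * Real.pi)) σ E ≠ 0 := abs_pos.1 ((abs_nonneg _).trans_lt hlt)
  refine eigenvalue_condition (h.sn_ne_zero (Set.mem_insert_of_mem _ hE)) hμ hlt ?_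
  have := mu_quadratic h.sigma (h.gap E hE).le
  change _ = 2 * eta α E
  field_simp
  linear_combination this

/-- Turns the eigenvalue condition into a level set of the function treated in `strictMonoOn_zeta`.
-/
theorem zeta_eq_iff {s m b t : ℝ} (hs : s ≠ 0) (hm : m ≠ 0) :
    m * (m + b * s) = t ↔ (t - m ^ 2) / (s * m) = b := by
  rw [div_eq_iff (mul_ne_zero hs hm)]
  constructor <;> intro h <;> linear_combination -h

/-- The left side of the eigenvalue condition is below `t` at the edge and above `1 ≥ t` at the
point given by `far`, so it takes the value `t` in between. Uniqueness is the injectivity of the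
monotone function. -/
theorem exactlyOne (h : GapData α (Real.cos (A * Real.pi)) σ τ e I)
    (hc : |Real.cos (A * Real.pi)| < 1)
    (hlt : Real.cos (A * Real.pi) ^ 2 + τ * ((α₁ - α) / 2) * |Real.cos (A * Real.pi)| *
      |sn e Real.pi| < Real.cos (A₁ * Real.pi) ^ 2) :
    HasExactlyOneSimpleEigenvalueIn (perturbedHamiltonian α A α₁ A₁) I := by
  set c := Real.cos (A * Real.pi) with hcd
  set t := Real.cos (A₁ * Real.pi) ^ 2 with ht
  set b := (α₁ - α) / 2 with hb
  have ht1 : t ≤ 1 := by rw [ht, sq_le_one_iff_abs_le_one]; exact Real.abs_cos_le_one _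
  have hcont : Continuous fun E => mu α c σ E * (mu α c σ E + b * sn E Real.pi) := by
    have h1 := continuous_mu α c σ
    have h2 := continuous_sn_left Real.pi
    fun_prop
  obtain ⟨E₀, h1, h2, h3⟩ := h.far b
  have hedge := h.phi_edge b
  obtain ⟨E, hE, hEt⟩ : ∃ E, (0 < τ * (e - E) ∧ 0 < τ * (E - E₀)) ∧
      mu α c σ E * (mu α c σ E + b * sn E Real.pi) = t := by
    rcases h.tau with rfl | rfl
    · obtain ⟨E, hE, hEt⟩ := intermediate_value_Ioo' (by linarith : E₀ ≤ e) hcont.continuousOn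
        (show t ∈ Set.Ioo _ _ from ⟨by rw [hedge]; exact hlt, ht1.trans_lt h3⟩)
      exact ⟨E, ⟨by linarith [hE.2], by linarith [hE.1]⟩, hEt⟩
    · obtain ⟨E, hE, hEt⟩ := intermediate_value_Ioo (by linarith : e ≤ E₀) hcont.continuousOn
        (show t ∈ Set.Ioo _ _ from ⟨by rw [hedge]; exact hlt, ht1.trans_lt h3⟩)
      exact ⟨E, ⟨by linarith [hE.1], by linarith [hE.2]⟩, hEt⟩
  have hEI := h2 E hE.1 hE.2
  refine ⟨E, hEI, (h.eigenvalue_iff hEI).2 hEt, fun E' hE' hev => ?_⟩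
  have hEt' := (h.eigenvalue_iff hE').1 hev
  have hmem : ∀ F ∈ I, sn F Real.pi ≠ 0 ∧ mu α c σ F ≠ 0 := fun F hF =>
    ⟨h.sn_ne_zero (Set.mem_insert_of_mem _ hF),
      abs_pos.1 ((abs_nonneg _).trans_lt (h.abs_lt_abs_mu hF))⟩
  -- Monotonicity is used without the edge, where `mu` may vanish when `cos (A π) = 0`.
  have hconv : Convex ℝ I := by
    have : I = insert e I ∩ {E | 0 < τ * (e - E)} := by
      ext F
      constructor
      · exact fun hF => ⟨Set.mem_insert_of_mem _ hF, h.side F hF⟩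
      · rintro ⟨hF | hF, hF2⟩
        · rw [hF] at hF2; simp at hF2
        · exact hF
    rw [this]
    refine h.convex.inter ?_
    rcases h.tau with rfl | rfl
    · rw [show {E | 0 < 1 * (e - E)} = Set.Iio e by ext F; simp]
      exact convex_Iio e
    · rw [show {E | 0 < -1 * (e - E)} = Set.Ioi e by ext F; simp]
      exact convex_Ioi e
  have hmono := strictMonoOn_zeta (t := t) h.sigma hc (sq_nonneg _) ht1 hconv (fun F hF => (hmem F hF).1)
    (fun F hF => (hmem F hF).2) fun F hF => h.gap F (_root_.interior_subset hF)
  refine hmono.injOn hE' hEI ?_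
  rw [(zeta_eq_iff (hmem E' hE').1 (hmem E' hE').2).1 hEt',
    (zeta_eq_iff (hmem E hEI).1 (hmem E hEI).2).1 hEt]

/-- With `c ≠ 0` the monotone function `(t - μ²) / (s μ)` extends to the edge, where `s μ` has the
sign `τ`. The hypothesis says that its edge value is at most `b` if `τ = 1` and at least `b` if `τ =
-1`. Strict monotonicity then keeps it away from `b` inside the gap, also in the case of equality.
-/
theorem no_eigenvalue (h : GapData α (Real.cos (A * Real.pi)) σ τ e I)
    (hc : |Real.cos (A * Real.pi)| < 1) (hc0 : Real.cos (A * Real.pi) ≠ 0)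
    (hle : Real.cos (A₁ * Real.pi) ^ 2 ≤ Real.cos (A * Real.pi) ^ 2 + τ * ((α₁ - α) / 2) *
      |Real.cos (A * Real.pi)| * |sn e Real.pi|) :
    ∀ E ∈ I, ¬ HasEigenvalue (perturbedHamiltonian α A α₁ A₁) E := by
  intro E hE hev
  have hEt := (h.eigenvalue_iff hE).1 hev
  set c := Real.cos (A * Real.pi) with hcd
  set t := Real.cos (A₁ * Real.pi) ^ 2 with ht
  set b := (α₁ - α) / 2 with hb
  have ht1 : t ≤ 1 := by rw [ht, sq_le_one_iff_abs_le_one]; exact Real.abs_cos_le_one _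
  obtain ⟨m1, m2⟩ := h.mu_edge
  have hmem : ∀ F ∈ insert e I, mu α c σ F ≠ 0 := by
    rintro F (rfl | hF)
    · rw [m1]
      intro h0
      rw [h0] at m2
      exact hc0 (pow_eq_zero_iff two_ne_zero |>.1 (by linarith))
    · exact abs_pos.1 ((abs_nonneg _).trans_lt (h.abs_lt_abs_mu hF))
  have hmono := strictMonoOn_zeta (t := t) h.sigma hc (sq_nonneg _) ht1 h.convex
    (fun F hF => h.sn_ne_zero hF) hmem fun F hF => h.gap F (h.interior_subset hF)
  have hEe : E ∈ insert e I := Set.mem_insert_of_mem _ hE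
  have hee : e ∈ insert e I := Set.mem_insert _ _
  have hside := h.side E hE
  have hzE := (zeta_eq_iff (h.sn_ne_zero hEe) (hmem E hEe)).1 hEt
  rw [← h.phi_edge b] at hle
  have hsm : 0 < τ * (sn e Real.pi * mu α c σ e) := by
    have h1 := h.sign e hee
    have h2 : 0 < σ * mu α c σ e := by
      rw [m1, h.edge]; exact abs_pos.2 hc0
    have hσ2 : σ ^ 2 = 1 := by rcases h.sigma with rfl | rfl <;> norm_num
    have h3 := mul_pos h1 h2
    have : τ * σ * sn e Real.pi * (σ * mu α c σ e) = τ * (sn e Real.pi * mu α c σ e) := by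
      linear_combination (τ * sn e Real.pi * mu α c σ e) * hσ2
    rwa [this] at h3
  rcases h.tau with rfl | rfl
  · have h1 := hmono hEe hee (by linarith : E < e)
    simp only [hzE] at h1
    rw [lt_div_iff₀ (by linarith)] at h1
    linarith
  · have h1 := hmono hee hEe (by linarith : e < E)
    simp only [hzE] at h1
    rw [div_lt_iff_of_neg (by linarith)] at h1
    linarith

end GapData

end

section


/-! ### The gaps of the chain -/

theorem connectedComponentIn_eq {S : Set ℝ} {x : ℝ} {I : Set ℝ} (hI : I.OrdConnected) (hx : x ∈ I)
    (hIS : I ⊆ S) (hmax : ∀ y ∈ S, y ∉ I → ∃ z ∈ Set.uIcc x y, z ∉ S) :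
    connectedComponentIn S x = I := by
  refine Set.Subset.antisymm (fun y hy => ?_) (hI.isPreconnected.subset_connectedComponentIn hx hIS)
  by_contra hyI
  obtain ⟨z, hz, hzS⟩ := hmax y (connectedComponentIn_subset _ _ hy) hyI
  have hoc : (connectedComponentIn S x).OrdConnected :=
    isPreconnected_connectedComponentIn.ordConnected
  exact hzS (connectedComponentIn_subset _ _
    (hoc.uIcc_subset (mem_connectedComponentIn (hIS hx)) hy hz))

/-- A description of the gaps of a set as an increasing sequence of intervals. -/
structure GapSequence (S : Set ℝ) (G : ℕ → Set ℝ) : Prop where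
  compl_eq : Sᶜ = ⋃ m, G m
  ordConnected : ∀ m, (G m).OrdConnected
  nonempty : ∀ m, (G m).Nonempty
  lt : ∀ m n, m < n → ∀ x ∈ G m, ∀ y ∈ G n, ∃ z ∈ S, x < z ∧ z < y

namespace GapSequence

variable {S : Set ℝ} {G : ℕ → Set ℝ}

theorem subset (h : GapSequence S G) (m : ℕ) : G m ⊆ Sᶜ := by
  rw [h.compl_eq]; exact Set.subset_iUnion G m

theorem component (h : GapSequence S G) {m : ℕ} {x : ℝ} (hx : x ∈ G m) :
    connectedComponentIn Sᶜ x = G m := by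
  refine connectedComponentIn_eq (h.ordConnected m) hx (h.subset m) fun y hy hym => ?_
  rw [h.compl_eq] at hy
  obtain ⟨n, hn⟩ := Set.mem_iUnion.1 hy
  rcases lt_trichotomy m n with hmn | rfl | hmn
  · obtain ⟨z, hz, h1, h2⟩ := h.lt m n hmn x hx y hn
    exact ⟨z, Set.mem_uIcc.2 (.inl ⟨h1.le, h2.le⟩), fun hc => hc hz⟩
  · exact absurd hn hym
  · obtain ⟨z, hz, h1, h2⟩ := h.lt n m hmn y hn x hx
    exact ⟨z, Set.mem_uIcc.2 (.inr ⟨h1.le, h2.le⟩), fun hc => hc hz⟩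

theorem mem_gaps_iff (h : GapSequence S G) {I : Set ℝ} : I ∈ gaps S ↔ ∃ m, I = G m := by
  constructor
  · rintro ⟨x, hx, rfl⟩
    have hx' := hx
    rw [h.compl_eq] at hx'
    obtain ⟨m, hm⟩ := Set.mem_iUnion.1 hx'
    exact ⟨m, h.component hm⟩
  · rintro ⟨m, rfl⟩
    obtain ⟨x, hx⟩ := h.nonempty m
    exact ⟨x, h.subset m hx, (h.component hx).symm⟩

theorem forall_lt_iff (h : GapSequence S G) {m n : ℕ} :
    (∀ x ∈ G m, ∀ y ∈ G n, x < y) ↔ m < n := by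
  constructor
  · intro hlt
    obtain ⟨x, hx⟩ := h.nonempty m
    obtain ⟨y, hy⟩ := h.nonempty n
    by_contra! hcon
    rcases hcon.eq_or_lt with rfl | hcon
    · exact lt_irrefl _ (hlt x hx x hx)
    · obtain ⟨z, -, h1, h2⟩ := h.lt n m hcon y hy x hx
      exact lt_asymm (hlt x hx y hy) (h1.trans h2)
  · intro hmn x hx y hy
    obtain ⟨z, -, h1, h2⟩ := h.lt m n hmn x hx y hy
    exact h1.trans h2

theorem injective (h : GapSequence S G) : Function.Injective G := by
  intro m n hmn
  by_contra hne
  rcases lt_or_gt_of_ne hne with h1 | h1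
  · have := h.forall_lt_iff.2 h1
    rw [hmn] at this
    exact lt_irrefl n (h.forall_lt_iff.1 this)
  · have := h.forall_lt_iff.2 h1
    rw [hmn] at this
    exact lt_irrefl n (h.forall_lt_iff.1 this)

theorem gapNumber_eq (h : GapSequence S G) (m : ℕ) : gapNumber S (G m) = (m + 1 : ℕ) := by
  have : {J ∈ gaps S | ∀ x ∈ J, ∀ y ∈ G m, x < y} = G '' (Finset.range m : Set ℕ) := by
    ext J
    constructor
    · rintro ⟨hJ, hlt⟩
      obtain ⟨n, rfl⟩ := h.mem_gaps_iff.1 hJ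
      exact ⟨n, by simpa using h.forall_lt_iff.1 hlt, rfl⟩
    · rintro ⟨n, hn, rfl⟩
      exact ⟨h.mem_gaps_iff.2 ⟨n, rfl⟩, h.forall_lt_iff.2 (by simpa using hn)⟩
  rw [gapNumber, this, h.injective.encard_image, Set.encard_coe_eq_coe_finsetCard, Finset.card_range]
  norm_num

/-- Indices start at zero and gap numbers at one, so the parity flips. -/
theorem isOddGap (h : GapSequence S G) {m : ℕ} (hm : Even m) : IsOddGap S (G m) :=
  ⟨h.mem_gaps_iff.2 ⟨m, rfl⟩, m + 1, hm.add_one, h.gapNumber_eq m⟩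

theorem isEvenGap (h : GapSequence S G) {m : ℕ} (hm : Odd m) : IsEvenGap S (G m) :=
  ⟨h.mem_gaps_iff.2 ⟨m, rfl⟩, m + 1, hm.add_one, h.gapNumber_eq m⟩

end GapSequence

/-- The band edges in the Dirichlet intervals. -/
structure BandEdges (α c : ℝ) (a b : ℕ → ℝ) : Prop where
  lower_mem : ∀ n, a n ∈ dirichletInterval n
  upper_mem : ∀ n, b n ∈ dirichletInterval n
  lower : ∀ n, ∀ E ∈ dirichletInterval n, (|c| < (-1) ^ n * eta α E ↔ E < a n) ∧
    ((-1) ^ n * eta α E < |c| ↔ a n < E)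
  upper : ∀ n, ∀ E ∈ dirichletInterval n, (-|c| < (-1) ^ n * eta α E ↔ E < b n) ∧
    ((-1) ^ n * eta α E < -|c| ↔ b n < E)

theorem exists_bandEdges (α : ℝ) {c : ℝ} (hc : |c| < 1) : ∃ a b, BandEdges α c a b := by
  choose a ha ha' using fun n => exists_band_edge α n (x := |c|) (by rwa [abs_abs])
  choose b hb hb' using fun n => exists_band_edge α n (x := -|c|) (by rwa [abs_neg, abs_abs])
  exact ⟨a, b, ha, hb, ha', hb'⟩

namespace BandEdges

variable {α c : ℝ} {a b : ℕ → ℝ}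

theorem lower_value (h : BandEdges α c a b) (n : ℕ) : (-1) ^ n * eta α (a n) = |c| := by
  obtain ⟨h1, h2⟩ := h.lower n (a n) (h.lower_mem n)
  exact le_antisymm (not_lt.1 fun h => lt_irrefl _ (h1.1 h)) (not_lt.1 fun h => lt_irrefl _ (h2.1 h))

theorem upper_value (h : BandEdges α c a b) (n : ℕ) : (-1) ^ n * eta α (b n) = -|c| := by
  obtain ⟨h1, h2⟩ := h.upper n (b n) (h.upper_mem n)
  exact le_antisymm (not_lt.1 fun h => lt_irrefl _ (h1.1 h)) (not_lt.1 fun h => lt_irrefl _ (h2.1 h))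

theorem lower_le_upper (h : BandEdges α c a b) (n : ℕ) : a n ≤ b n := by
  by_contra! hlt
  have := (h.lower n (b n) (h.upper_mem n)).1.2 hlt
  rw [h.upper_value] at this
  linarith [abs_nonneg c]

/-- The gap below the `n`-th band. -/
def lowerGap (a : ℕ → ℝ) (n : ℕ) : Set ℝ := {E ∈ dirichletInterval n | E < a n}

/-- The gap above the `n`-th band. -/
def upperGap (b : ℕ → ℝ) (n : ℕ) : Set ℝ := {E ∈ dirichletInterval n | b n < E}

/-- The far end is the Dirichlet eigenvalue `n²`, where `sn = 0` and `μ² = (1 + √(1 - c²))² > 1`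
independently of the perturbation. For `n = 0` the gap is unbounded and a very negative energy takes
that role. -/
theorem gapData_lower (h : BandEdges α c a b) (hc : |c| < 1) (n : ℕ) :
    GapData α c ((-1) ^ n) 1 (a n) (lowerGap a n) := by
  have hε : ((-1 : ℝ) ^ n) * (-1) ^ n = 1 := by rw [← mul_pow]; norm_num
  have hsub : insert (a n) (lowerGap a n) = dirichletInterval n ∩ Set.Iic (a n) := by
    ext E
    constructor
    · rintro (rfl | hE)
      · exact ⟨h.lower_mem n, Set.mem_Iic.2 le_rfl⟩
      · exact ⟨hE.1, hE.2.le⟩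
    · rintro ⟨h1, h2⟩
      rcases (Set.mem_Iic.1 h2).eq_or_lt with h3 | h3
      · exact .inl h3
      · exact .inr ⟨h1, h3⟩
  refine ⟨neg_one_pow_eq_or ℝ n, .inl rfl, ?_, ?_, fun E hE => ?_, fun E hE => ?_, h.lower_value n,
    fun E hE => by linarith [hE.2], fun β => ?_⟩
  · rw [hsub]; exact (convex_dirichletInterval n).inter (convex_Iic _)
  · rw [hsub, interior_inter, interior_Iic]
    exact fun E hE => ⟨interior_subset hE.1, hE.2⟩
  · rw [hsub] at hE
    rw [one_mul]; exact sn_sign hE.1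
  · exact (h.lower n E hE.1).1.2 hE.2
  · rcases Nat.eq_zero_or_pos n with rfl | hn
    · obtain ⟨E₀, h0, h1, h2⟩ := exists_eta_large α β
      have hJ : E₀ ∈ dirichletInterval 0 := ⟨.inl rfl, by norm_num; linarith⟩
      have hlt : E₀ < a 0 := (h.lower 0 E₀ hJ).1.1 (by rw [pow_zero, one_mul]; linarith)
      refine ⟨E₀, by linarith, fun E hE hE' => ⟨⟨.inl rfl, ?_⟩, by linarith⟩, ?_⟩
      · exact (by linarith : E < a 0).trans (h.lower_mem 0).2
      · have := le_sigma_mul_mu (α := α) (c := c) (E := E₀) (.inl rfl : (1 : ℝ) = 1 ∨ _)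
        rw [one_mul, one_mul] at this
        rw [pow_zero]
        nlinarith
    · refine ⟨(n : ℝ) ^ 2, ?_, fun E hE hE' => ⟨⟨.inr (by linarith), ?_⟩, by linarith⟩, ?_⟩
      · have := (h.lower_mem n).1.resolve_left (by omega)
        linarith
      · exact (by linarith : E < a n).trans (h.lower_mem n).2
      · have hs : 0 < √(1 - c ^ 2) := Real.sqrt_pos.2 (by have := (sq_lt_one_iff_abs_lt_one c).2 hc; linarith)
        rw [sn_nat_sq hn, mul_zero, add_zero, mu, eta_nat_sq hn, sq ((-1 : ℝ) ^ n), hε,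
          show ((-1 : ℝ) ^ n + (-1) ^ n * √(1 - c ^ 2)) * ((-1) ^ n + (-1) ^ n * √(1 - c ^ 2)) =
            ((-1 : ℝ) ^ n * (-1) ^ n) * (1 + √(1 - c ^ 2)) ^ 2 by ring, hε]
        nlinarith

/-- Above the band the discriminant has the opposite sign, and the far end is `(n + 1)²`. -/
theorem gapData_upper (h : BandEdges α c a b) (hc : |c| < 1) (n : ℕ) :
    GapData α c (-(-1) ^ n) (-1) (b n) (upperGap b n) := by
  have hε : ((-1 : ℝ) ^ (n + 1)) * (-1) ^ (n + 1) = 1 := by rw [← mul_pow]; norm_num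
  have hsub : insert (b n) (upperGap b n) = dirichletInterval n ∩ Set.Ici (b n) := by
    ext E
    constructor
    · rintro (rfl | hE)
      · exact ⟨h.upper_mem n, Set.mem_Ici.2 le_rfl⟩
      · exact ⟨hE.1, hE.2.le⟩
    · rintro ⟨h1, h2⟩
      rcases (Set.mem_Ici.1 h2).eq_or_lt with h3 | h3
      · exact .inl h3.symm
      · exact .inr ⟨h1, h3⟩
  have hσ : -(-1 : ℝ) ^ n = (-1) ^ (n + 1) := by rw [pow_succ]; ring
  refine ⟨by rw [hσ]; exact neg_one_pow_eq_or ℝ _, .inr rfl, ?_, ?_, fun E hE => ?_, fun E hE => ?_, ?_,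
    fun E hE => by linarith [hE.2], fun β => ?_⟩
  · rw [hsub]; exact (convex_dirichletInterval n).inter (convex_Ici _)
  · rw [hsub, interior_inter, interior_Ici]
    exact fun E hE => ⟨interior_subset hE.1, hE.2⟩
  · rw [hsub] at hE
    rw [neg_one_mul, neg_neg]; exact sn_sign hE.1
  · have := (h.upper n E hE.1).2.2 hE.2
    linarith
  · have := h.upper_value n
    linarith
  · have hlt : b n < ((n + 1 : ℕ) : ℝ) ^ 2 := by exact_mod_cast (h.upper_mem n).2
    refine ⟨((n + 1 : ℕ) : ℝ) ^ 2, by linarith, fun E hE hE' => ⟨⟨?_, ?_⟩, by linarith⟩, ?_⟩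
    · exact (h.upper_mem n).1.imp id fun h => h.trans (by linarith)
    · push_cast at hE' ⊢; linarith
    · have hs : 0 < √(1 - c ^ 2) := Real.sqrt_pos.2 (by have := (sq_lt_one_iff_abs_lt_one c).2 hc; linarith)
      rw [sn_nat_sq (by omega), mul_zero, add_zero, mu, eta_nat_sq (by omega), hσ,
        sq ((-1 : ℝ) ^ (n + 1)), hε,
        show ((-1 : ℝ) ^ (n + 1) + (-1) ^ (n + 1) * √(1 - c ^ 2)) *
          ((-1) ^ (n + 1) + (-1) ^ (n + 1) * √(1 - c ^ 2)) =
          ((-1 : ℝ) ^ (n + 1) * (-1) ^ (n + 1)) * (1 + √(1 - c ^ 2)) ^ 2 by ring, hε]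
      nlinarith

/-- The gaps in increasing order. -/
def gap (a b : ℕ → ℝ) (m : ℕ) : Set ℝ := if Even m then lowerGap a (m / 2) else upperGap b (m / 2)

theorem gap_even (a b : ℕ → ℝ) (n : ℕ) : gap a b (2 * n) = lowerGap a n := by
  simp [gap]

theorem gap_odd (a b : ℕ → ℝ) (n : ℕ) : gap a b (2 * n + 1) = upperGap b n := by
  rw [gap, if_neg (by simp)]
  congr 1; omega

theorem dirichletInterval_le {m n : ℕ} (hmn : m < n) {x y : ℝ} (hx : x ∈ dirichletInterval m)
    (hy : y ∈ dirichletInterval n) : x < ((m : ℝ) + 1) ^ 2 ∧ ((m : ℝ) + 1) ^ 2 < y := by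
  refine ⟨hx.2, lt_of_le_of_lt ?_ (hy.1.resolve_left (by omega))⟩
  have : (m : ℝ) + 1 ≤ n := by exact_mod_cast hmn
  exact pow_le_pow_left₀ (by positivity) this 2

/-- Two gaps in the same Dirichlet interval are separated by a band edge, gaps in different
intervals by a Dirichlet eigenvalue. -/
theorem gapSequence (h : BandEdges α c a b) (hc : |c| < 1) {S : Set ℝ}
    (hS : ∀ E, E ∈ S ↔ sn E Real.pi = 0 ∨ |eta α E| ≤ |c|) : GapSequence S (gap a b) := by
  have hgap : ∀ m, ∃ σ τ e, GapData α c σ τ e (gap a b m) ∧ gap a b m ⊆ dirichletInterval (m / 2) := by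
    intro m
    rcases Nat.even_or_odd' m with ⟨n, rfl | rfl⟩
    · rw [gap_even]
      refine ⟨_, _, _, h.gapData_lower hc n, fun E hE => ?_⟩
      rw [show 2 * n / 2 = n by omega]; exact hE.1
    · rw [gap_odd]
      refine ⟨_, _, _, h.gapData_upper hc n, fun E hE => ?_⟩
      rw [show (2 * n + 1) / 2 = n by omega]; exact hE.1
  refine ⟨?_, fun m => ?_, fun m => ?_, fun m n hmn x hx y hy => ?_⟩
  · ext E
    rw [Set.mem_compl_iff, hS, Set.mem_iUnion]
    constructor
    · intro hE
      push Not at hE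
      rcases exists_dirichletInterval E with ⟨n, hn⟩ | ⟨n, hn, rfl⟩
      · have habs : |eta α E| = |(-1) ^ n * eta α E| := by
          rw [abs_mul, abs_pow, abs_neg, abs_one, one_pow, one_mul]
        rw [habs] at hE
        rcases lt_abs.1 hE.2 with h1 | h1
        · exact ⟨2 * n, by rw [gap_even]; exact ⟨hn, (h.lower n E hn).1.1 h1⟩⟩
        · exact ⟨2 * n + 1, by rw [gap_odd]; exact ⟨hn, (h.upper n E hn).2.1 (by linarith)⟩⟩
      · exact absurd (sn_nat_sq hn) hE.1
    · rintro ⟨m, hm⟩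
      obtain ⟨σ, τ, e, hg, -⟩ := hgap m
      push Not
      refine ⟨hg.sn_ne_zero (Set.mem_insert_of_mem _ hm), (hg.gap E hm).trans_le ?_⟩
      refine (le_abs_self _).trans (le_of_eq ?_)
      rw [abs_mul]
      rcases hg.sigma with rfl | rfl <;> simp
  · rcases Nat.even_or_odd' m with ⟨n, rfl | rfl⟩
    · rw [gap_even]
      exact ((convex_dirichletInterval n).inter (convex_Iio (a n))).ordConnected
    · rw [gap_odd]
      exact ((convex_dirichletInterval n).inter (convex_Ioi (b n))).ordConnected
  · obtain ⟨σ, τ, e, hg, -⟩ := hgap m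
    obtain ⟨E₀, h1, h2, -⟩ := hg.far 0
    refine ⟨(e + E₀) / 2, h2 _ ?_ ?_⟩ <;> linarith
  · obtain ⟨-, -, -, -, hm⟩ := hgap m
    obtain ⟨-, -, -, -, hn⟩ := hgap n
    rcases (Nat.div_le_div_right hmn.le : m / 2 ≤ n / 2).eq_or_lt with heq | hlt
    · have hm2 : m = 2 * (m / 2) := by omega
      have hn2 : n = 2 * (m / 2) + 1 := by omega
      rw [hm2, gap_even] at hx
      rw [hn2, gap_odd] at hy
      refine ⟨a (m / 2), (hS _).2 (.inr ?_), hx.2, (h.lower_le_upper _).trans_lt hy.2⟩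
      have := congrArg abs (h.lower_value (m / 2))
      rw [abs_mul, abs_pow, abs_neg, abs_one, one_pow, one_mul, abs_abs] at this
      exact this.le
    · obtain ⟨h1, h2⟩ := dirichletInterval_le hlt (hm hx) (hn hy)
      refine ⟨_, (hS _).2 (.inl ?_), h1, h2⟩
      have := sn_nat_sq (n := m / 2 + 1) (by omega)
      exact_mod_cast this

end BandEdges

end

/-! ### Counting the eigenvalues in the gaps -/

section


variable {α A A₁ α₁ : ℝ} {a b : ℕ → ℝ}

theorem abs_cos_mul_pi_lt_one (hA : ∀ n : ℤ, A ≠ n) : |Real.cos (A * Real.pi)| < 1 := by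
  have h : Real.sin (A * Real.pi) ≠ 0 := by
    intro h
    obtain ⟨n, hn⟩ := Real.sin_eq_zero_iff.mp h
    exact hA n (mul_right_cancel₀ Real.pi_ne_zero hn.symm)
  rw [← sq_lt_one_iff_abs_lt_one]
  have := Real.sin_sq_add_cos_sq (A * Real.pi)
  have : 0 < Real.sin (A * Real.pi) ^ 2 := by positivity
  linarith

theorem finite_setOf_le_mul {s : ℕ → ℝ} (hs : ∀ n : ℕ, 1 ≤ n → s n ≤ 1 / n) {K ε : ℝ} (hK : 0 ≤ K)
    (hε : 0 < ε) : {n | ε ≤ K * s n}.Finite := by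
  refine (Set.finite_Iic ⌈K / ε⌉₊).subset fun n hn => ?_
  by_contra h
  have hlt : K / ε < n := (Nat.lt_of_ceil_lt (not_le.mp h))
  have hn0 : (0 : ℝ) < n := lt_of_le_of_lt (by positivity) hlt
  have h1 : K * s n ≤ K * (1 / n) :=
    mul_le_mul_of_nonneg_left (hs n (by exact_mod_cast hn0)) hK
  have h2 : K * (1 / n) < ε := by
    rw [mul_one_div, div_lt_iff₀ hn0]
    rwa [div_lt_iff₀ hε, mul_comm] at hlt
  exact absurd (hn.trans h1) (not_le.mpr h2)

theorem exists_bound_of_le_one_div {s : ℕ → ℝ} (hs : ∀ n : ℕ, 1 ≤ n → s n ≤ 1 / n) :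
    ∃ M, ∀ n, s n ≤ M := by
  refine ⟨max (s 0) 1, fun n => ?_⟩
  rcases Nat.eq_zero_or_pos n with rfl | hn
  · exact le_max_left _ _
  · refine (hs n hn).trans (le_max_of_le_right ?_)
    exact (div_le_one (by exact_mod_cast hn)).mpr (by exact_mod_cast hn)

namespace BandEdges

variable {c : ℝ}

theorem abs_sn_lower_le (h : BandEdges α c a b) (n : ℕ) (hn : 1 ≤ n) :
    |sn (a n) Real.pi| ≤ 1 / n := abs_sn_le hn (h.lower_mem n)

theorem abs_sn_upper_le (h : BandEdges α c a b) (n : ℕ) (hn : 1 ≤ n) :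
    |sn (b n) Real.pi| ≤ 1 / n := abs_sn_le hn (h.upper_mem n)

/-- A bound valid for all edges at once, so that one `δ` serves every gap. -/
theorem exists_abs_sn_le (h : BandEdges α c a b) :
    ∃ M > 0, ∀ n, |sn (a n) Real.pi| ≤ M ∧ |sn (b n) Real.pi| ≤ M := by
  obtain ⟨M, hM⟩ := exists_bound_of_le_one_div h.abs_sn_lower_le
  obtain ⟨N, hN⟩ := exists_bound_of_le_one_div h.abs_sn_upper_le
  refine ⟨max 1 (max M N), by positivity, fun n => ⟨(hM n).trans ?_, (hN n).trans ?_⟩⟩ <;> simp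

theorem gapSequence_perturbed (h : BandEdges α (Real.cos (A * Real.pi)) a b)
    (hc : |Real.cos (A * Real.pi)| < 1) (α₁ A₁ : ℝ) :
    GapSequence (essentialSpectrum (perturbedHamiltonian α A α₁ A₁)) (gap a b) :=
  h.gapSequence hc fun _ => mem_essentialSpectrum_iff

end BandEdges

theorem GapSequence.forall_gaps {S : Set ℝ} {G : ℕ → Set ℝ} (h : GapSequence S G)
    {P : Set ℝ → Prop} : (∀ I ∈ gaps S, P I) ↔ (∀ n, P (G (2 * n))) ∧ ∀ n, P (G (2 * n + 1)) := by
  refine ⟨fun hP => ⟨fun n => hP _ (h.mem_gaps_iff.mpr ⟨_, rfl⟩),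
    fun n => hP _ (h.mem_gaps_iff.mpr ⟨_, rfl⟩)⟩, fun ⟨h0, h1⟩ I hI => ?_⟩
  obtain ⟨m, rfl⟩ := h.mem_gaps_iff.mp hI
  obtain ⟨n, rfl | rfl⟩ := Nat.even_or_odd' m
  exacts [h0 n, h1 n]

theorem mul_abs_sn_lt {x M c τ s d : ℝ} (hτ : |τ| = 1) (hc : |c| < 1) (hM : 0 < M) (hs : |s| ≤ M)
    (hx : |x| < d / M) : |τ * (x / 2) * (|c| * |s|)| < d := by
  have h1 : |τ * (x / 2) * (|c| * |s|)| = |x| / 2 * (|c| * |s|) := by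
    rw [abs_mul, abs_mul, hτ, abs_div, abs_two, abs_mul, abs_abs, abs_abs, one_mul]
  have h2 : |x| * M < d := (lt_div_iff₀ hM).mp hx
  have h3 : |c| * |s| ≤ M := (mul_le_of_le_one_left (abs_nonneg s) hc.le).trans hs
  have h4 : |x| / 2 * (|c| * |s|) ≤ |x| / 2 * M := mul_le_mul_of_nonneg_left h3 (by positivity)
  have h5 : 0 ≤ |x| * M := by positivity
  linarith

section Results

variable (h : BandEdges α (Real.cos (A * Real.pi)) a b) (hc : |Real.cos (A * Real.pi)| < 1)

include h hc

/-- For `α₁ > α` the edge term lowers the value in even gaps, which keeps it below `t`. In odd gaps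
it raises the value and can reach `t - c²` only for finitely many `n`; those gaps form the
exceptional set. -/
theorem exists_exceptional_odd
    (hlt : Real.cos (A * Real.pi) ^ 2 < Real.cos (A₁ * Real.pi) ^ 2) (hα : α < α₁) :
    ∃ X : Set (Set ℝ), X.Finite ∧
      (∀ I ∈ X, IsOddGap (essentialSpectrum (perturbedHamiltonian α A α₁ A₁)) I) ∧
      ∀ I ∈ gaps (essentialSpectrum (perturbedHamiltonian α A α₁ A₁)), I ∉ X →
        HasExactlyOneSimpleEigenvalueIn (perturbedHamiltonian α A α₁ A₁) I := by
  have hG := h.gapSequence_perturbed hc α₁ A₁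
  have hK : 0 ≤ (α₁ - α) / 2 * |Real.cos (A * Real.pi)| :=
    mul_nonneg (by linarith) (abs_nonneg _)
  refine ⟨_, (finite_setOf_le_mul h.abs_sn_lower_le hK (sub_pos.mpr hlt)).image
    fun n => BandEdges.gap a b (2 * n), ?_, ?_⟩
  · rintro _ ⟨n, -, rfl⟩
    exact hG.isOddGap (even_two_mul n)
  refine (hG.forall_gaps).mpr ⟨fun n hn => ?_, fun n _ => ?_⟩
  · rw [BandEdges.gap_even]
    refine (h.gapData_lower hc n).exactlyOne hc ?_
    by_contra hle
    exact hn ⟨n, by rw [Set.mem_ofPred_eq]; linarith, rfl⟩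
  · rw [BandEdges.gap_odd]
    refine (h.gapData_upper hc n).exactlyOne hc ?_
    have := mul_nonneg hK (abs_nonneg (sn (b n) Real.pi))
    linarith

/-- Reversing the sign of `α₁ - α` exchanges the roles of the gaps below and above the bands. -/
theorem exists_exceptional_even
    (hlt : Real.cos (A * Real.pi) ^ 2 < Real.cos (A₁ * Real.pi) ^ 2) (hα : α₁ < α) :
    ∃ X : Set (Set ℝ), X.Finite ∧
      (∀ I ∈ X, IsEvenGap (essentialSpectrum (perturbedHamiltonian α A α₁ A₁)) I) ∧
      ∀ I ∈ gaps (essentialSpectrum (perturbedHamiltonian α A α₁ A₁)), I ∉ X →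
        HasExactlyOneSimpleEigenvalueIn (perturbedHamiltonian α A α₁ A₁) I := by
  have hG := h.gapSequence_perturbed hc α₁ A₁
  have hK : 0 ≤ (α - α₁) / 2 * |Real.cos (A * Real.pi)| :=
    mul_nonneg (by linarith) (abs_nonneg _)
  refine ⟨_, (finite_setOf_le_mul h.abs_sn_upper_le hK (sub_pos.mpr hlt)).image
    fun n => BandEdges.gap a b (2 * n + 1), ?_, ?_⟩
  · rintro _ ⟨n, -, rfl⟩
    exact hG.isEvenGap (odd_two_mul_add_one n)
  refine (hG.forall_gaps).mpr ⟨fun n _ => ?_, fun n hn => ?_⟩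
  · rw [BandEdges.gap_even]
    refine (h.gapData_lower hc n).exactlyOne hc ?_
    have := mul_nonneg hK (abs_nonneg (sn (a n) Real.pi))
    linarith
  · rw [BandEdges.gap_odd]
    refine (h.gapData_upper hc n).exactlyOne hc ?_
    by_contra hle
    exact hn ⟨n, by rw [Set.mem_ofPred_eq]; linarith, rfl⟩

/-- For `|α₁ - α| < (t - c²) / M` the edge term is smaller than `t - c²` in every gap. -/
theorem exists_forall_exactlyOne
    (hlt : Real.cos (A * Real.pi) ^ 2 < Real.cos (A₁ * Real.pi) ^ 2) :
    ∃ δ > 0, ∀ α₁ : ℝ, |α₁ - α| < δ →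
      ∀ I ∈ gaps (essentialSpectrum (perturbedHamiltonian α A α₁ A₁)),
        HasExactlyOneSimpleEigenvalueIn (perturbedHamiltonian α A α₁ A₁) I := by
  obtain ⟨M, hM, hs⟩ := h.exists_abs_sn_le
  refine ⟨_, div_pos (sub_pos.mpr hlt) hM, fun α₁ hα => ?_⟩
  refine (h.gapSequence_perturbed hc α₁ A₁).forall_gaps.mpr ⟨fun n => ?_, fun n => ?_⟩
  · rw [BandEdges.gap_even]
    refine (h.gapData_lower hc n).exactlyOne hc ?_
    have := (abs_lt.mp (mul_abs_sn_lt (τ := 1) (by simp) hc hM (hs n).1 hα)).2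
    linarith
  · rw [BandEdges.gap_odd]
    refine (h.gapData_upper hc n).exactlyOne hc ?_
    have := (abs_lt.mp (mul_abs_sn_lt (τ := -1) (by simp) hc hM (hs n).2 hα)).2
    linarith

/-- Now `t < c²`, so an eigenvalue requires the edge term to be negative and larger than `c² - t` in
modulus. The set is defined by the strict inequality, since equality belongs to the case without an
eigenvalue. -/
theorem exists_exactlyOne_even
    (hlt : Real.cos (A₁ * Real.pi) ^ 2 < Real.cos (A * Real.pi) ^ 2) (hα : α < α₁) :
    ∃ X : Set (Set ℝ), X.Finite ∧
      (∀ I ∈ X, IsEvenGap (essentialSpectrum (perturbedHamiltonian α A α₁ A₁)) I ∧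
        HasExactlyOneSimpleEigenvalueIn (perturbedHamiltonian α A α₁ A₁) I) ∧
      ∀ I ∈ gaps (essentialSpectrum (perturbedHamiltonian α A α₁ A₁)), I ∉ X →
        ∀ E ∈ I, ¬ HasEigenvalue (perturbedHamiltonian α A α₁ A₁) E := by
  have hG := h.gapSequence_perturbed hc α₁ A₁
  have hc0 : Real.cos (A * Real.pi) ≠ 0 := sq_pos_iff.mp ((sq_nonneg _).trans_lt hlt)
  have hK : 0 ≤ (α₁ - α) / 2 * |Real.cos (A * Real.pi)| :=
    mul_nonneg (by linarith) (abs_nonneg _)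
  refine ⟨(fun n => BandEdges.gap a b (2 * n + 1)) ''
    {n | Real.cos (A * Real.pi) ^ 2 - Real.cos (A₁ * Real.pi) ^ 2 <
      (α₁ - α) / 2 * |Real.cos (A * Real.pi)| * |sn (b n) Real.pi|},
    ((finite_setOf_le_mul h.abs_sn_upper_le hK (sub_pos.mpr hlt)).subset
      fun n hn => le_of_lt (Set.mem_ofPred_eq ▸ hn)).image _, ?_, ?_⟩
  · rintro _ ⟨n, hn, rfl⟩
    refine ⟨hG.isEvenGap (odd_two_mul_add_one n), ?_⟩
    simp only [Set.mem_ofPred_eq] at hn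
    simp only [BandEdges.gap_odd]
    refine (h.gapData_upper hc n).exactlyOne hc ?_
    linarith
  refine (hG.forall_gaps).mpr ⟨fun n _ => ?_, fun n hn => ?_⟩
  · rw [BandEdges.gap_even]
    refine (h.gapData_lower hc n).no_eigenvalue hc hc0 ?_
    have := mul_nonneg hK (abs_nonneg (sn (a n) Real.pi))
    linarith
  · rw [BandEdges.gap_odd]
    refine (h.gapData_upper hc n).no_eigenvalue hc hc0 ?_
    by_contra hle
    exact hn ⟨n, by rw [Set.mem_ofPred_eq]; linarith, rfl⟩

theorem exists_exactlyOne_odd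
    (hlt : Real.cos (A₁ * Real.pi) ^ 2 < Real.cos (A * Real.pi) ^ 2) (hα : α₁ < α) :
    ∃ X : Set (Set ℝ), X.Finite ∧
      (∀ I ∈ X, IsOddGap (essentialSpectrum (perturbedHamiltonian α A α₁ A₁)) I ∧
        HasExactlyOneSimpleEigenvalueIn (perturbedHamiltonian α A α₁ A₁) I) ∧
      ∀ I ∈ gaps (essentialSpectrum (perturbedHamiltonian α A α₁ A₁)), I ∉ X →
        ∀ E ∈ I, ¬ HasEigenvalue (perturbedHamiltonian α A α₁ A₁) E := by
  have hG := h.gapSequence_perturbed hc α₁ A₁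
  have hc0 : Real.cos (A * Real.pi) ≠ 0 := sq_pos_iff.mp ((sq_nonneg _).trans_lt hlt)
  have hK : 0 ≤ (α - α₁) / 2 * |Real.cos (A * Real.pi)| :=
    mul_nonneg (by linarith) (abs_nonneg _)
  refine ⟨(fun n => BandEdges.gap a b (2 * n)) ''
    {n | Real.cos (A * Real.pi) ^ 2 - Real.cos (A₁ * Real.pi) ^ 2 <
      (α - α₁) / 2 * |Real.cos (A * Real.pi)| * |sn (a n) Real.pi|},
    ((finite_setOf_le_mul h.abs_sn_lower_le hK (sub_pos.mpr hlt)).subset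
      fun n hn => le_of_lt (Set.mem_ofPred_eq ▸ hn)).image _, ?_, ?_⟩
  · rintro _ ⟨n, hn, rfl⟩
    refine ⟨hG.isOddGap (even_two_mul n), ?_⟩
    simp only [Set.mem_ofPred_eq] at hn
    simp only [BandEdges.gap_even]
    refine (h.gapData_lower hc n).exactlyOne hc ?_
    linarith
  refine (hG.forall_gaps).mpr ⟨fun n hn => ?_, fun n _ => ?_⟩
  · rw [BandEdges.gap_even]
    refine (h.gapData_lower hc n).no_eigenvalue hc hc0 ?_
    by_contra hle
    exact hn ⟨n, by rw [Set.mem_ofPred_eq]; linarith, rfl⟩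
  · rw [BandEdges.gap_odd]
    refine (h.gapData_upper hc n).no_eigenvalue hc hc0 ?_
    have := mul_nonneg hK (abs_nonneg (sn (b n) Real.pi))
    linarith

theorem exists_forall_no_eigenvalue
    (hlt : Real.cos (A₁ * Real.pi) ^ 2 < Real.cos (A * Real.pi) ^ 2) :
    ∃ δ > 0, ∀ α₁ : ℝ, |α₁ - α| < δ →
      ∀ I ∈ gaps (essentialSpectrum (perturbedHamiltonian α A α₁ A₁)),
        ∀ E ∈ I, ¬ HasEigenvalue (perturbedHamiltonian α A α₁ A₁) E := by
  obtain ⟨M, hM, hs⟩ := h.exists_abs_sn_le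
  have hc0 : Real.cos (A * Real.pi) ≠ 0 := sq_pos_iff.mp ((sq_nonneg _).trans_lt hlt)
  refine ⟨_, div_pos (sub_pos.mpr hlt) hM, fun α₁ hα => ?_⟩
  refine (h.gapSequence_perturbed hc α₁ A₁).forall_gaps.mpr ⟨fun n => ?_, fun n => ?_⟩
  · rw [BandEdges.gap_even]
    refine (h.gapData_lower hc n).no_eigenvalue hc hc0 ?_
    have := (abs_lt.mp (mul_abs_sn_lt (τ := 1) (by simp) hc hM (hs n).1 hα)).1
    linarith
  · rw [BandEdges.gap_odd]
    refine (h.gapData_upper hc n).no_eigenvalue hc hc0 ?_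
    have := (abs_lt.mp (mul_abs_sn_lt (τ := -1) (by simp) hc hM (hs n).2 hα)).1
    linarith

end Results

/-- Energies outside the essential spectrum lie in gaps, which are excluded by assumption. Band
energies with `sn ≠ 0` are excluded by `no_eigenvalue_in_band`, so only the Dirichlet eigenvalues
remain. -/
theorem mem_essentialSpectrum_of_hasEigenvalue (hc0 : Real.cos (A * Real.pi) ≠ 0)
    (hgap : ∀ I ∈ gaps (essentialSpectrum (perturbedHamiltonian α A α₁ A₁)),
      ∀ E ∈ I, ¬ HasEigenvalue (perturbedHamiltonian α A α₁ A₁) E)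
    {E : ℝ} (hE : HasEigenvalue (perturbedHamiltonian α A α₁ A₁) E) :
    E ∈ essentialSpectrum (perturbedHamiltonian α A α₁ A₁) ∧ ∃ n : ℕ, 1 ≤ n ∧ E = (n : ℝ) ^ 2 := by
  have hess : E ∈ essentialSpectrum (perturbedHamiltonian α A α₁ A₁) := by
    by_contra hn
    exact hgap _ ⟨E, hn, rfl⟩ E (mem_connectedComponentIn hn) hE
  refine ⟨hess, ?_⟩
  rcases exists_dirichletInterval E with ⟨n, hn⟩ | hn
  · have hs := sn_ne_zero hn
    exact absurd hE (no_eigenvalue_in_band hs hc0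
      ((mem_essentialSpectrum_iff.mp hess).resolve_left hs))
  · exact hn

end

end MagneticChain

end

open MagneticChain in
theorem mainTheorem5 (α A A₁ : ℝ) (hA : ∀ n : ℤ, A ≠ n) :
    (|Real.cos (A₁ * Real.pi)| > |Real.cos (A * Real.pi)| →
      (∀ α₁ : ℝ, α₁ > α → ∃ X : Set (Set ℝ), X.Finite ∧
        (∀ I ∈ X, IsOddGap (essentialSpectrum (perturbedHamiltonian α A α₁ A₁)) I) ∧
        ∀ I ∈ gaps (essentialSpectrum (perturbedHamiltonian α A α₁ A₁)), I ∉ X →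
          HasExactlyOneSimpleEigenvalueIn (perturbedHamiltonian α A α₁ A₁) I) ∧
      (∀ α₁ : ℝ, α₁ < α → ∃ X : Set (Set ℝ), X.Finite ∧
        (∀ I ∈ X, IsEvenGap (essentialSpectrum (perturbedHamiltonian α A α₁ A₁)) I) ∧
        ∀ I ∈ gaps (essentialSpectrum (perturbedHamiltonian α A α₁ A₁)), I ∉ X →
          HasExactlyOneSimpleEigenvalueIn (perturbedHamiltonian α A α₁ A₁) I) ∧
      (∃ δ > 0, ∀ α₁ : ℝ, α₁ ≠ α → |α₁ - α| < δ →
        ∀ I ∈ gaps (essentialSpectrum (perturbedHamiltonian α A α₁ A₁)),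
          HasExactlyOneSimpleEigenvalueIn (perturbedHamiltonian α A α₁ A₁) I)) ∧
    (|Real.cos (A₁ * Real.pi)| < |Real.cos (A * Real.pi)| →
      (∀ α₁ : ℝ, α₁ > α → ∃ X : Set (Set ℝ), X.Finite ∧
        (∀ I ∈ X, IsEvenGap (essentialSpectrum (perturbedHamiltonian α A α₁ A₁)) I ∧
          HasExactlyOneSimpleEigenvalueIn (perturbedHamiltonian α A α₁ A₁) I) ∧
        ∀ I ∈ gaps (essentialSpectrum (perturbedHamiltonian α A α₁ A₁)), I ∉ X →
          ∀ E ∈ I, ¬ HasEigenvalue (perturbedHamiltonian α A α₁ A₁) E) ∧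
      (∀ α₁ : ℝ, α₁ < α → ∃ X : Set (Set ℝ), X.Finite ∧
        (∀ I ∈ X, IsOddGap (essentialSpectrum (perturbedHamiltonian α A α₁ A₁)) I ∧
          HasExactlyOneSimpleEigenvalueIn (perturbedHamiltonian α A α₁ A₁) I) ∧
        ∀ I ∈ gaps (essentialSpectrum (perturbedHamiltonian α A α₁ A₁)), I ∉ X →
          ∀ E ∈ I, ¬ HasEigenvalue (perturbedHamiltonian α A α₁ A₁) E) ∧
      (∃ δ > 0, ∀ α₁ : ℝ, α₁ ≠ α → |α₁ - α| < δ →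
        ∀ E : ℝ, HasEigenvalue (perturbedHamiltonian α A α₁ A₁) E →
          E ∈ essentialSpectrum (perturbedHamiltonian α A α₁ A₁) ∧
            ∃ n : ℕ, 1 ≤ n ∧ E = (n : ℝ) ^ 2)) := by
  have hc := abs_cos_mul_pi_lt_one hA
  obtain ⟨a, b, h⟩ := exists_bandEdges α hc
  constructor <;> intro hlt <;> have hlt := sq_lt_sq.mpr hlt
  · refine ⟨fun α₁ hα => exists_exceptional_odd h hc hlt hα,
      fun α₁ hα => exists_exceptional_even h hc hlt hα, ?_⟩
    obtain ⟨δ, hδ, H⟩ := exists_forall_exactlyOne h hc hlt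
    exact ⟨δ, hδ, fun α₁ _ => H α₁⟩
  · refine ⟨fun α₁ hα => exists_exactlyOne_even h hc hlt hα,
      fun α₁ hα => exists_exactlyOne_odd h hc hlt hα, ?_⟩
    obtain ⟨δ, hδ, H⟩ := exists_forall_no_eigenvalue h hc hlt
    have hc0 : Real.cos (A * Real.pi) ≠ 0 := sq_pos_iff.mp ((sq_nonneg _).trans_lt hlt)
    exact ⟨δ, hδ, fun α₁ _ hα _ hE => mem_essentialSpectrum_of_hasEigenvalue hc0 (H α₁ hα) hE⟩
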